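/- Consider four bodies in the plane with masses $m_1=m_2=m_3=1$, $m_4=m$ and total mass $M=3+m$. For $x=(\lambda_0,\mu,r_{12},r_{13},r_{14},r_{23},r_{24},r_{34})\in\mathbb R^8$ let $U=\sum_{i<j}m_im_j/r_{ij}$, $I=\frac1M\sum_{i<j}m_im_jr_{ij}^2$, and let $S$ be the Cayley--Menger determinant of the $r_{ij}$, that is, the determinant of the symmetric $5\times5$ matrix with zero diagonal whose first row is $(0,1,1,1,1)$ and whose other off-diagonal entries are the $r_{ij}^2$. Put $V=U+\lambda_0(I-1)+\mu S$. The Dziobek map $F(x,m)\in\mathbb R^8$ has the polynomial components $M\,\partial V/\partial\lambda_0$, $\partial V/\partial\mu$, and $M r_{ij}^2\,\partial V/\partial r_{ij}$ (in the order of the unknowns); the Dziobek equations are $F(x,m)=0$. Write $DF$ for the Jacobian matrix in $x$ and a subscript $m$ for the derivative in $m$. The dihedral group of order six $\{E,g_1,\dots,g_5\}$ acts on $\mathbb R^8$ by maps $\Phi_g$ that permute the $r_{ij}$ according to the permutations of the bodies $1,2,3$; here $g_1,g_2,g_3$ are the transpositions $(2\,3)$, $(1\,3)$, $(1\,2)$.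 Let $B\subset\mathbb R^8\times\mathbb R$ be the box of all $(x,m)$ with $\lambda_0=4.07733304636361696432719$, $\mu=0.777155400247894593452215$, $r_{12}=1.013474951606110121651278$, $r_{13}=r_{23}=0.57621299527180$, $r_{14}=r_{24}=0.995153301920946$, $r_{34}=0.582177257875351248071238$, $m=0.99184227439094091554349$, each of these nine coordinates being allowed, independently, an error of at most one unit in its last printed decimal. There is exactly one $(x_{**},m_{**})\in B$ with $F(x_{**},m_{**})=0$ and $\det DF(x_{**},m_{**})=0$. With $R=\Phi_{g_3}$ it satisfies $Rx_{**}=x_{**}$. The kernels of $A=DF(x_{**},m_{**})$ and of $A^T$ are one-dimensional, spanned by vectors $v$ and $w$ whose $r_{24}$-components are equal to $1$; moreover $Rv=-v$, and at $(x_{**},m_{**})$ $$w^TF_m=0,\quad w^T[DF_m\,v]>0,\quad w^T[D^2F(v,v)]=0,\quad w^T[D^3F(v,v,v)]<0 .$$ At $(x_{**},m_{**})$ the solutions of $F=0$ undergo a supercritical symmetry-breaking pitchfork bifurcation. That is, there are an open neighbourhood $W$ of $x_{**}$, numbers $\varepsilon,\delta>0$, and smooth curves $s:(m_{**}-\varepsilon,m_{**}+\varepsilon)\to\mathbb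 R^8$ and $(y,\tau):(-\delta,\delta)\to W\times\mathbb R$ with $s(m_{**})=y(0)=x_{**}$, $\tau(0)=m_{**}$, $y'(0)=v$, $\tau'(0)=0$, $\tau''(0)>0$, $F(y(t),\tau(t))=0$ for all $t$, such that the set of solutions of $F(x,m)=0$ in $W$ is $\{s(m)\}$ for $m_{**}-\varepsilon<m\le m_{**}$, and for $m_{**}<m<m_{**}+\varepsilon$ it consists of exactly three points $s(m)$, $y(t_1)$, $y(t_2)$ with $-\delta<t_1<0<t_2<\delta$ and $\tau(t_1)=\tau(t_2)=m$. The isotropy group of $s(m)$ is $\{E,g_3\}$ for all $m$ in the interval; the isotropy group of $y(t)$ is trivial for $t\ne0$; and $Ry(t)=y(-t)$, $\tau(-t)=\tau(t)$. All these solutions are the mutual distances of planar configurations in which body $3$ lies in the interior of the triangle formed by the other three. The same holds for the two other configurations of the orbit: for $\Phi_{g_1}x_{**}$ with reflection $g_2$, vectors $\Phi_{g_1}v,\Phi_{g_1}w$ and body $2$ inside, and for $\Phi_{g_2}x_{**}$ with reflection $g_1$, vectors $\Phi_{g_2}v,\Phi_{g_2}w$ and body $1$ inside: at each of them the conditions above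 and a supercritical symmetry-breaking pitchfork hold at $m=m_{**}$. -/

import Mathlib

open scoped ContDiff

noncomputable section

namespace FourBody

/-- The eight unknowns, in the order `(λ₀, μ, r₁₂, r₁₃, r₁₄, r₂₃, r₂₄, r₃₄)`. -/
abbrev Vec : Type := Fin 8 → ℝ

/-- The Cayley-Menger matrix of the six mutual distances. -/
def cayleyMenger (x : Vec) : Matrix (Fin 5) (Fin 5) ℝ :=
  !![0, 1, 1, 1, 1;
     1, 0, x 2 ^ 2, x 3 ^ 2, x 4 ^ 2;
     1, x 2 ^ 2, 0, x 5 ^ 2, x 6 ^ 2;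
     1, x 3 ^ 2, x 5 ^ 2, 0, x 7 ^ 2;
     1, x 4 ^ 2, x 6 ^ 2, x 7 ^ 2, 0]

/-- The Cayley-Menger determinant `S`. -/
def cmDet (x : Vec) : ℝ := (cayleyMenger x).det

/-- `pairMass m k = mᵢ mⱼ` for the pair `i < j` whose distance is the coordinate `k`, when the
masses are `1, 1, 1, m` (the first two entries belong to no pair and are not used). -/
def pairMass (m : ℝ) : Fin 8 → ℝ := ![0, 0, 1, 1, m, 1, m, m]

/-- The Newtonian potential `U = ∑ mᵢ mⱼ / rᵢⱼ`. -/
def potential (m : ℝ) (x : Vec) : ℝ := ∑ k ∈ Finset.Ici (2 : Fin 8), pairMass m k / x k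

/-- The moment of inertia `I = (∑ mᵢ mⱼ rᵢⱼ²) / M`, where `M = 3 + m` is the total mass. -/
def inertia (m : ℝ) (x : Vec) : ℝ :=
  (∑ k ∈ Finset.Ici (2 : Fin 8), pairMass m k * x k ^ 2) / (3 + m)

/-- The Lagrangian `U + λ₀ (I - 1) + μ S`. -/
def lagrangian (m : ℝ) (x : Vec) : ℝ :=
  potential m x + x 0 * (inertia m x - 1) + x 1 * cmDet x

/-- Partial derivative of a function of the eight unknowns in the `k`-th one. -/
def partialDeriv (f : Vec → ℝ) (k : Fin 8) (x : Vec) : ℝ :=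
  deriv (fun t => f (Function.update x k t)) (x k)

/-- The Dziobek map: the partial derivatives of the Lagrangian with denominators cleared.
The first component is `M ∂/∂λ₀`, the second is `∂/∂μ`, and the one that belongs to `rᵢⱼ`
is `M rᵢⱼ² ∂/∂rᵢⱼ`; see `dziobek_zero`, `dziobek_one` and `dziobek_dist`. -/
def dziobek (x : Vec) (m : ℝ) : Vec := fun k =>
  if k = 0 then (∑ l ∈ Finset.Ici (2 : Fin 8), pairMass m l * x l ^ 2) - (3 + m)
  else if k = 1 then cmDet x
  else -(3 + m) * pairMass m k + 2 * x 0 * pairMass m k * x k ^ 3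
    + x 1 * (3 + m) * x k ^ 2 * partialDeriv cmDet k x

/-- The Jacobian matrix `DF` of the Dziobek map in the eight unknowns. -/
def jacobian (x : Vec) (m : ℝ) : Matrix (Fin 8) (Fin 8) ℝ :=
  LinearMap.toMatrix' (fderiv ℝ (fun z => dziobek z m) x : Vec →ₗ[ℝ] Vec)

/-- The six elements of the dihedral group of order six. -/
inductive D6 : Type
  | e | g1 | g2 | g3 | g4 | g5

/-- The action of the dihedral group on the unknowns by relabelling the three equal masses. -/
def Phi : D6 → Vec → Vec
  | .e, x => x
  | .g1, x => ![x 0, x 1, x 3, x 2, x 4, x 5, x 7, x 6]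
  | .g2, x => ![x 0, x 1, x 5, x 3, x 7, x 2, x 6, x 4]
  | .g3, x => ![x 0, x 1, x 2, x 5, x 6, x 3, x 4, x 7]
  | .g4, x => ![x 0, x 1, x 3, x 5, x 7, x 2, x 4, x 6]
  | .g5, x => ![x 0, x 1, x 5, x 2, x 6, x 3, x 7, x 4]

/-- The isotropy group of a point. -/
def isotropy (x : Vec) : Set D6 := {g | Phi g x = x}

/-- The distances in `x` are those of four points of the plane, and the body `k` lies in the
interior of the triangle formed by the other three. -/
def BodyInside (k : Fin 4) (x : Vec) : Prop :=
  ∃ q : Fin 4 → EuclideanSpace ℝ (Fin 2),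
    dist (q 0) (q 1) = x 2 ∧ dist (q 0) (q 2) = x 3 ∧ dist (q 0) (q 3) = x 4 ∧
    dist (q 1) (q 2) = x 5 ∧ dist (q 1) (q 3) = x 6 ∧ dist (q 2) (q 3) = x 7 ∧
    q k ∈ interior (convexHull ℝ (q '' {k}ᶜ))

/-- The box that encloses the bifurcating solution: decimal centres, with an error of at most one
unit in the last decimal. -/
def xBox : Set Vec :=
  {x | |x 0 - 4.07733304636361696432719| ≤ 1 / 10 ^ 23 ∧
       |x 1 - 0.777155400247894593452215| ≤ 1 / 10 ^ 24 ∧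
       |x 2 - 1.013474951606110121651278| ≤ 1 / 10 ^ 24 ∧
       |x 3 - 0.57621299527180| ≤ 1 / 10 ^ 14 ∧
       |x 4 - 0.995153301920946| ≤ 1 / 10 ^ 15 ∧
       |x 5 - 0.57621299527180| ≤ 1 / 10 ^ 14 ∧
       |x 6 - 0.995153301920946| ≤ 1 / 10 ^ 15 ∧
       |x 7 - 0.582177257875351248071238| ≤ 1 / 10 ^ 24}

/-- The interval that encloses the bifurcation value of the mass. -/
def mBox : Set ℝ := {m | |m - 0.99184227439094091554349| ≤ 1 / 10 ^ 23}

/-- `x` solves the Dziobek equations at `m` and the Jacobian determinant vanishes there. -/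
def IsSingularSolution (x : Vec) (m : ℝ) : Prop :=
  dziobek x m = 0 ∧ (jacobian x m).det = 0

/-- The data of a symmetry-breaking pitchfork at `(x, m)`: `DF` has the one-dimensional kernel
spanned by `v`, its transpose has the one-dimensional kernel spanned by `w`, the reflection `g`
fixes `x` and reverses `v`, and
`wᵀ F_m = 0`, `wᵀ DF_m v > 0`, `wᵀ D²F(v,v) = 0`, `wᵀ D³F(v,v,v) < 0`. -/
structure PitchforkConditions (g : D6) (x : Vec) (m : ℝ) (v w : Vec) : Prop where
  v_ne : v ≠ 0
  w_ne : w ≠ 0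
  ker : LinearMap.ker (jacobian x m).mulVecLin = Submodule.span ℝ {v}
  coker : LinearMap.ker (jacobian x m).transpose.mulVecLin = Submodule.span ℝ {w}
  fix : Phi g x = x
  anti : Phi g v = -v
  first : w ⬝ᵥ deriv (fun μ => dziobek x μ) m = 0
  mixed : 0 < w ⬝ᵥ deriv (fun μ => fderiv ℝ (fun z => dziobek z μ) x v) m
  second : w ⬝ᵥ iteratedFDeriv ℝ 2 (fun z => dziobek z m) x ![v, v] = 0
  third : w ⬝ᵥ iteratedFDeriv ℝ 3 (fun z => dziobek z m) x ![v, v, v] < 0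

/-- The zero set of `F` near `(x₀, μ₀)` is a supercritical pitchfork: in `W × (μ₀ - ε, μ₀ + ε)` it
consists of the graph of the smooth curve `s` and of the smooth curve `t ↦ (y t, τ t)`, which is
tangent to the fibre `μ = μ₀` and bends towards `μ > μ₀`. So there is exactly one zero for
`μ ≤ μ₀` and there are exactly three for `μ > μ₀`. -/
structure IsSupercriticalPitchfork {E : Type*} [NormedAddCommGroup E] [NormedSpace ℝ E]
    (F : E → ℝ → E) (x₀ : E) (μ₀ : ℝ) (W : Set E) (ε δ : ℝ)
    (s : ℝ → E) (y : ℝ → E) (τ : ℝ → ℝ) : Prop where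
  isOpen : IsOpen W
  mem : x₀ ∈ W
  ε_pos : 0 < ε
  δ_pos : 0 < δ
  s_smooth : ContDiffOn ℝ ∞ s (Set.Ioo (μ₀ - ε) (μ₀ + ε))
  s_base : s μ₀ = x₀
  y_smooth : ContDiffOn ℝ ∞ y (Set.Ioo (-δ) δ)
  τ_smooth : ContDiffOn ℝ ∞ τ (Set.Ioo (-δ) δ)
  y_base : y 0 = x₀
  τ_base : τ 0 = μ₀
  y_tangent : deriv y 0 ≠ 0
  τ_tangent : deriv τ 0 = 0
  τ_bend : 0 < deriv (deriv τ) 0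
  y_zero : ∀ t ∈ Set.Ioo (-δ) δ, y t ∈ W ∧ F (y t) (τ t) = 0
  below : ∀ μ ∈ Set.Ioc (μ₀ - ε) μ₀, {x ∈ W | F x μ = 0} = {s μ}
  above : ∀ μ ∈ Set.Ioo μ₀ (μ₀ + ε), ∃ t₁ ∈ Set.Ioo (-δ) 0, ∃ t₂ ∈ Set.Ioo 0 δ,
    τ t₁ = μ ∧ τ t₂ = μ ∧ {x ∈ W | F x μ = 0} = {s μ, y t₁, y t₂} ∧
    {x ∈ W | F x μ = 0}.ncard = 3

/-- The solutions of the Dziobek equations undergo at `(x, m)` a supercritical pitchfork in the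
direction `v` which breaks the symmetry `g`: the branch `s` has isotropy group `{e, g}`, and
the points of the branch `y` other than `x` have trivial isotropy and are interchanged by `g`.
All solutions nearby are planar configurations with the body `k` inside the triangle of the
other three. -/
def SymmetryBreakingPitchfork (g : D6) (k : Fin 4) (x : Vec) (m : ℝ) (v : Vec) : Prop :=
  ∃ (W : Set Vec) (ε δ : ℝ) (s : ℝ → Vec) (y : ℝ → Vec) (τ : ℝ → ℝ),
    IsSupercriticalPitchfork dziobek x m W ε δ s y τ ∧
    deriv y 0 = v ∧
    (∀ μ ∈ Set.Ioo (m - ε) (m + ε), isotropy (s μ) = {D6.e, g}) ∧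
    (∀ t ∈ Set.Ioo (-δ) δ, t ≠ 0 → isotropy (y t) = {D6.e}) ∧
    (∀ t ∈ Set.Ioo (-δ) δ, Phi g (y t) = y (-t) ∧ τ (-t) = τ t) ∧
    (∀ μ ∈ Set.Ioo (m - ε) (m + ε), ∀ z ∈ W, dziobek z μ = 0 → BodyInside k z)

theorem dziobek_zero (x : Vec) (m : ℝ) (hm : 3 + m ≠ 0) :
    dziobek x m 0 = (3 + m) * partialDeriv (lagrangian m) 0 x := by
  have h : (fun t => lagrangian m (Function.update x 0 t)) =
      fun t => t * (inertia m x - 1) + (potential m x + x 1 * cmDet x) := by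
    funext t
    simp [lagrangian, potential, inertia, cmDet, cayleyMenger,
      show Finset.Ici (2 : Fin 8) = {2, 3, 4, 5, 6, 7} by decide]
    ring
  simp only [partialDeriv, h]
  rw [((hasDerivAt_id' (x 0)).mul_const (inertia m x - 1)).add_const _ |>.deriv]
  simp only [dziobek, inertia, if_true]
  field_simp

theorem dziobek_one (x : Vec) (m : ℝ) :
    dziobek x m 1 = partialDeriv (lagrangian m) 1 x := by
  have h : (fun t => lagrangian m (Function.update x 1 t)) =
      fun t => t * cmDet x + (potential m x + x 0 * (inertia m x - 1)) := by
    funext t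
    simp [lagrangian, potential, inertia, cmDet, cayleyMenger,
      show Finset.Ici (2 : Fin 8) = {2, 3, 4, 5, 6, 7} by decide]
    ring
  simp only [partialDeriv, h]
  rw [((hasDerivAt_id' (x 1)).mul_const (cmDet x)).add_const _ |>.deriv]
  simp [dziobek]

theorem dziobek_dist (x : Vec) (m : ℝ) (hm : 3 + m ≠ 0) (k : Fin 8) (hk : 2 ≤ k)
    (hx : x k ≠ 0) :
    dziobek x m k = (3 + m) * x k ^ 2 * partialDeriv (lagrangian m) k x := by
  have h0 : k ≠ 0 := by rintro rfl; exact absurd hk (by decide)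
  have h1 : k ≠ 1 := by rintro rfl; exact absurd hk (by decide)
  have hk' : k ∈ Finset.Ici (2 : Fin 8) := by simpa using hk
  have hS : DifferentiableAt ℝ (fun t => cmDet (Function.update x k t)) (x k) := by
    have hc : ∀ l, Differentiable ℝ (fun t => Function.update x k t l) := fun l => by
      by_cases hl : l = k
      · subst hl; simp
      · simp [Function.update_of_ne hl]
    have h : ∀ i j, Differentiable ℝ (fun t => cayleyMenger (Function.update x k t) i j) := by
      intro i j
      fin_cases i <;> fin_cases j <;> simp [cayleyMenger] <;> exact (hc _).pow 2
    simp only [cmDet, Matrix.det_apply']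
    exact DifferentiableAt.fun_sum fun σ _ => DifferentiableAt.const_mul
      (DifferentiableAt.fun_finsetProd fun i _ => (h (σ i) i).differentiableAt) _
  have h : (fun t => lagrangian m (Function.update x k t)) =ᶠ[nhds (x k)]
      fun t => pairMass m k * t⁻¹ + x 0 / (3 + m) * pairMass m k * t ^ 2
        + x 1 * cmDet (Function.update x k t)
        + (∑ l ∈ (Finset.Ici (2 : Fin 8)).erase k, pairMass m l / x l + x 0 *
          ((∑ l ∈ (Finset.Ici (2 : Fin 8)).erase k, pairMass m l * x l ^ 2) / (3 + m) - 1)) := by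
    refine Filter.Eventually.of_forall fun t => ?_
    have e1 : ∑ l ∈ (Finset.Ici (2 : Fin 8)).erase k, pairMass m l / Function.update x k t l =
        ∑ l ∈ (Finset.Ici (2 : Fin 8)).erase k, pairMass m l / x l :=
      Finset.sum_congr rfl fun l hl => by rw [Function.update_of_ne (Finset.ne_of_mem_erase hl)]
    have e2 : ∑ l ∈ (Finset.Ici (2 : Fin 8)).erase k, pairMass m l * Function.update x k t l ^ 2 =
        ∑ l ∈ (Finset.Ici (2 : Fin 8)).erase k, pairMass m l * x l ^ 2 :=
      Finset.sum_congr rfl fun l hl => by rw [Function.update_of_ne (Finset.ne_of_mem_erase hl)]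
    simp only [lagrangian, potential, inertia]
    rw [← Finset.add_sum_erase _ _ hk', ← Finset.add_sum_erase _ _ hk', e1, e2,
      Function.update_self, Function.update_of_ne h0.symm, Function.update_of_ne h1.symm]
    ring
  have hd : HasDerivAt (fun t => lagrangian m (Function.update x k t))
      (pairMass m k * (-(x k ^ 2)⁻¹) + x 0 / (3 + m) * pairMass m k * (2 * x k)
        + x 1 * partialDeriv cmDet k x) (x k) := by
    refine HasDerivAt.congr_of_eventuallyEq ?_ h
    refine HasDerivAt.add_const _ (((hasDerivAt_inv hx).const_mul _).add ?_ |>.add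
      (hS.hasDerivAt.const_mul _))
    simpa using (hasDerivAt_pow 2 (x k)).const_mul (x 0 / (3 + m) * pairMass m k)
  have hp : partialDeriv (lagrangian m) k x = _ := hd.deriv
  rw [hp]
  simp only [dziobek, if_neg h0, if_neg h1]
  field_simp

end FourBody

end

/-! Write `x₃, x₅ = a ∓ α` and `x₄, x₆ = b ∓ t`. The exchange of bodies 1 and 2 reverses `(α, t)`,
so the six symmetric components of the Dziobek map are even in `(α, t)` and the two antisymmetric
ones are odd. Put `α = β t` and `T = t²` and divide the odd components by `t`. The result is a
polynomial system `redMap` of eight equations in the nine unknowns `(λ₀, μ, c, a, b, d, β, m, T)`,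
and `dziobek_toVec` relates it to the Dziobek map. This blow-up desingularizes the pitchfork: the
derivative of `redMap` in the first eight unknowns is invertible on a whole box, so its zero set is
a regular curve with parameter `T`, on which `dm/dT` is about 24 (`nearJac_kernel`,
`IsBase.exists_branch`).

With `T = t²` this curve becomes the asymmetric branch. There `m` is an increasing function of `t²`,
whence the supercritical bend. The symmetric branch solves the six even equations with `α = t = 0`,
whose Jacobian block in the six symmetric unknowns is also invertible (`IsBase.exists_symmBranch`).
Near the bifurcation there are no other zeros (`exists_param`).

Singular solutions correspond to zeros of `redMap` with `T = 0` (`IsSingularSolution.exists_param`).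
A symmetric one has an antisymmetric kernel vector, whose slope is the missing unknown `β`. An
asymmetric one would give a tangent vector of the zero set of `redMap` with zero `m`-component,
contrary to `dm/dT ≠ 0`. The zero with `T = 0` exists by a contraction argument for a simplified
Newton map (`exists_redMap_eq_zero`) and is unique in the box by the mean value theorem
(`redMap_injOn`).

The sign conditions on `w` and `v` are read off the same Jacobian matrix. The bend is not deduced
from them: the third derivative along the straight line in direction `v` ignores the response of the
symmetric unknowns, which the slope 24 includes.

All numerical facts are rational interval computations on syntactic polynomials, evaluated by the
kernel. The other two configurations follow by relabelling the bodies. -/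

open scoped Matrix Topology

/-! ### Polynomial expressions: formal derivatives and interval enclosures -/

/-- Polynomial expressions in `n` variables with rational coefficients. -/
inductive PolyExpr (n : ℕ) : Type
  | const (q : ℚ)
  | var (i : Fin n)
  | add (a b : PolyExpr n)
  | mul (a b : PolyExpr n)

namespace PolyExpr

variable {n : ℕ}

instance : Add (PolyExpr n) := ⟨add⟩
instance : Mul (PolyExpr n) := ⟨mul⟩
instance : Neg (PolyExpr n) := ⟨fun a => mul (const (-1)) a⟩
instance : Sub (PolyExpr n) := ⟨fun a b => add a (mul (const (-1)) b)⟩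
instance (k : ℕ) : OfNat (PolyExpr n) k := ⟨const k⟩

/-- Powers with a natural exponent. -/
def pow (a : PolyExpr n) : ℕ → PolyExpr n
  | 0 => const 1
  | 1 => a
  | k + 2 => mul (pow a (k + 1)) a

instance : HPow (PolyExpr n) ℕ (PolyExpr n) := ⟨pow⟩

/-- The value at a real point. -/
noncomputable def eval (ρ : Fin n → ℝ) : PolyExpr n → ℝ
  | const q => q
  | var i => ρ i
  | add a b => eval ρ a + eval ρ b
  | mul a b => eval ρ a * eval ρ b

/-- Whether an expression is the constant `0`. -/
def isZero : PolyExpr n → Bool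
  | const q => decide (q = 0)
  | _ => false

/-- Sum that drops a summand `0`. -/
def addSimp (a b : PolyExpr n) : PolyExpr n :=
  if a.isZero then b else if b.isZero then a else add a b

/-- Product that is `0` if the first factor is. -/
def mulSimp (a b : PolyExpr n) : PolyExpr n :=
  if a.isZero then const 0 else mul a b

/-- The formal partial derivative in the variable `i`. -/
def D (i : Fin n) : PolyExpr n → PolyExpr n
  | const _ => const 0
  | var j => const (if j = i then 1 else 0)
  | add a b => addSimp (D i a) (D i b)
  -- The derivative is the first factor of both products because `mulSimp` tests only its first
  -- factor. Dropping zero terms keeps repeated derivatives small enough for evaluation.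
  | mul a b => addSimp (mulSimp (D i a) b) (mulSimp (D i b) a)

/-- Midpoint and radius of an interval that contains all values of the expression on the box
with centre `c` and radii `r`. -/
def ball (c r : Fin n → ℚ) : PolyExpr n → ℚ × ℚ
  | const q => (q, 0)
  | var i => (c i, r i)
  | add a b =>
      let x := ball c r a
      let y := ball c r b
      (x.1 + y.1, x.2 + y.2)
  | mul a b =>
      let x := ball c r a
      let y := ball c r b
      (x.1 * y.1, |x.1| * y.2 + x.2 * |y.1| + x.2 * y.2)

variable (ρ : Fin n → ℝ)

@[simp] theorem eval_const (q : ℚ) : eval ρ (const q) = q := rfl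
@[simp] theorem eval_var (i : Fin n) : eval ρ (var i) = ρ i := rfl
@[simp] theorem eval_add (a b : PolyExpr n) : eval ρ (a + b) = eval ρ a + eval ρ b := rfl
@[simp] theorem eval_mul (a b : PolyExpr n) : eval ρ (a * b) = eval ρ a * eval ρ b := rfl

@[simp] theorem eval_neg (a : PolyExpr n) : eval ρ (-a) = -eval ρ a := by
  change ((-1 : ℚ) : ℝ) * eval ρ a = _
  push_cast; ring

@[simp] theorem eval_sub (a b : PolyExpr n) : eval ρ (a - b) = eval ρ a - eval ρ b := by
  change eval ρ a + ((-1 : ℚ) : ℝ) * eval ρ b = _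
  push_cast; ring

@[simp] theorem eval_ofNat (k : ℕ) [k.AtLeastTwo] :
    eval ρ (ofNat(k) : PolyExpr n) = ofNat(k) := by
  change (((k : ℕ) : ℚ) : ℝ) = _
  push_cast; rfl

@[simp] theorem eval_pow (a : PolyExpr n) (k : ℕ) : eval ρ (a ^ k) = eval ρ a ^ k := by
  change eval ρ (pow a k) = _
  induction k with
  | zero => simp [pow]
  | succ k ih =>
    cases k with
    | zero => simp [pow]
    | succ k => rw [pow, pow_succ, ← ih]; rfl

theorem eval_eq_zero_of_isZero {a : PolyExpr n} (h : a.isZero = true) : eval ρ a = 0 := by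
  cases a <;> simp_all [isZero]

theorem eval_addSimp (a b : PolyExpr n) : eval ρ (addSimp a b) = eval ρ a + eval ρ b := by
  unfold addSimp
  split_ifs with h h'
  · simp [eval_eq_zero_of_isZero ρ h]
  · simp [eval_eq_zero_of_isZero ρ h']
  · rfl

theorem eval_mulSimp (a b : PolyExpr n) : eval ρ (mulSimp a b) = eval ρ a * eval ρ b := by
  unfold mulSimp
  split_ifs with h
  · simp [eval_eq_zero_of_isZero ρ h]
  · rfl

theorem contDiff_eval (e : PolyExpr n) : ContDiff ℝ ω (fun ρ => eval ρ e) := by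
  induction e with
  | const q => exact contDiff_const
  | var i => exact contDiff_apply ℝ ℝ i
  | add a b ha hb => exact ha.add hb
  | mul a b ha hb => exact ha.mul hb

/-- The chain rule along a curve is the only differentiation rule needed: partial derivatives, the
mean value theorem and tangent vectors of solution branches are all obtained from suitable curves.
-/
theorem hasDerivAt_eval (e : PolyExpr n) {γ : ℝ → Fin n → ℝ} {γ' : Fin n → ℝ} {s : ℝ}
    (h : ∀ i, HasDerivAt (fun s => γ s i) (γ' i) s) :
    HasDerivAt (fun s => eval (γ s) e) (∑ i, eval (γ s) (D i e) * γ' i) s := by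
  induction e with
  | const q => simpa [eval, D] using hasDerivAt_const s (q : ℝ)
  | var i =>
    have : ∑ j, eval (γ s) (D j (var i)) * γ' j = γ' i := by
      rw [Finset.sum_eq_single i] <;> simp +contextual [D, eq_comm]
    rw [this]; exact h i
  | add a b ha hb =>
    have : ∑ j, eval (γ s) (D j (add a b)) * γ' j =
        ∑ j, eval (γ s) (D j a) * γ' j + ∑ j, eval (γ s) (D j b) * γ' j := by
      rw [← Finset.sum_add_distrib]
      exact Finset.sum_congr rfl fun j _ => by simp only [D, eval_addSimp]; ring
    rw [this]; exact ha.add hb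
  | mul a b ha hb =>
    have : ∑ j, eval (γ s) (D j (mul a b)) * γ' j =
        (∑ j, eval (γ s) (D j a) * γ' j) * eval (γ s) b
          + eval (γ s) a * ∑ j, eval (γ s) (D j b) * γ' j := by
      rw [Finset.sum_mul, Finset.mul_sum, ← Finset.sum_add_distrib]
      exact Finset.sum_congr rfl fun j _ => by simp only [D, eval_addSimp, eval_mulSimp]; ring
    rw [this]; exact ha.mul hb

/-- The mean value theorem on the segment between two points. -/
theorem exists_eval_sub_eq (e : PolyExpr n) (x y : Fin n → ℝ) :
    ∃ ξ ∈ segment ℝ y x, eval x e - eval y e = ∑ i, eval ξ (D i e) * (x i - y i) := by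
  have hγ : ∀ s i, HasDerivAt (fun s : ℝ => (fun i => y i + s * (x i - y i)) i) (x i - y i) s := by
    intro s i
    simpa using ((hasDerivAt_id s).mul_const (x i - y i)).const_add (y i)
  obtain ⟨s, hs, h⟩ := exists_hasDerivAt_eq_slope
    (fun s : ℝ => eval (fun i => y i + s * (x i - y i)) e) _ zero_lt_one
    (fun s _ => (hasDerivAt_eval e (hγ s)).continuousAt.continuousWithinAt)
    (fun s _ => hasDerivAt_eval e (hγ s))
  refine ⟨fun i => y i + s * (x i - y i), ?_, ?_⟩
  · rw [segment_eq_image']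
    exact ⟨s, ⟨hs.1.le, hs.2.le⟩, rfl⟩
  · rw [h]; simp

/-- Soundness of `ball`. The radius of a product comes from `xy - pq = p (y - q) + (x - p) q + (x -
p) (y - q)`. -/
theorem abs_eval_sub_le {c r : Fin n → ℚ} {ρ : Fin n → ℝ} (h : ∀ i, |ρ i - c i| ≤ r i)
    (e : PolyExpr n) : |eval ρ e - (ball c r e).1| ≤ (ball c r e).2 := by
  induction e with
  | const q => simp [ball]
  | var i => exact h i
  | add a b ha hb =>
    simp only [ball, eval]
    push_cast
    calc _ = |(eval ρ a - (ball c r a).1) + (eval ρ b - (ball c r b).1)| := by ring_nf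
      _ ≤ _ := (abs_add_le _ _).trans (add_le_add ha hb)
  | mul a b ha hb =>
    simp only [ball, eval]
    push_cast
    set p := (((ball c r a).1 : ℚ) : ℝ)
    set q := (((ball c r b).1 : ℚ) : ℝ)
    calc _ = |p * (eval ρ b - q) + (eval ρ a - p) * q + (eval ρ a - p) * (eval ρ b - q)| := by
          ring_nf
      _ ≤ |p * (eval ρ b - q)| + |(eval ρ a - p) * q| + |(eval ρ a - p) * (eval ρ b - q)| :=
          abs_add_three _ _ _
      _ ≤ _ := by
          simp only [abs_mul]
          have := abs_nonneg (eval ρ a - p)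
          gcongr
          exact this.trans ha

end PolyExpr

/-! ### The reduced system and its numerical data -/

namespace FourBody

open PolyExpr

section Reduced

variable (p q r : PolyExpr 9)

/-!
Write `x₃, x₅ = a ∓ α` and `x₄, x₆ = b ∓ t`. The components of the Dziobek map that are symmetric
under the exchange of the bodies 1 and 2 are polynomials in `p = α²`, `q = α t`, `r = t²`, and the
antisymmetric ones are linear combinations of `α` and `t` with coefficients of this form.
The variables `0, …, 5` and `7` stand for `λ₀, μ, c, a, b, d` and `m`.
-/

/-- Mean of the squares of `a ± α`. -/
def sqA : PolyExpr 9 := var 3 ^ 2 + p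

/-- Mean of the squares of `b ± t`. -/
def sqB : PolyExpr 9 := var 4 ^ 2 + r

/-- Total mass. -/
def totalMass : PolyExpr 9 := 3 + var 7

/-- The Cayley-Menger determinant. -/
def cmEven : PolyExpr 9 :=
  var 2 ^ 2 * (-2 * var 2 ^ 2 * var 5 ^ 2 - 2 * sqA p ^ 2 + 4 * sqA p * sqB r
    + 4 * sqA p * var 5 ^ 2 + 8 * var 3 ^ 2 * p - 16 * var 3 * var 4 * q - 2 * sqB r ^ 2
    + 4 * sqB r * var 5 ^ 2 + 8 * var 4 ^ 2 * r - 2 * var 5 ^ 4)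
  + 32 * var 3 * var 4 * q * (sqA p + sqB r - var 5 ^ 2) - 32 * sqA p * var 4 ^ 2 * r
  - 32 * var 3 ^ 2 * p * sqB r

/-- Derivative of the Cayley-Menger determinant in `c²`. -/
def cmC : PolyExpr 9 :=
  -4 * var 2 ^ 2 * var 5 ^ 2 - 2 * sqA p ^ 2 + 4 * sqA p * sqB r + 4 * sqA p * var 5 ^ 2
    + 8 * var 3 ^ 2 * p - 16 * var 3 * var 4 * q - 2 * sqB r ^ 2 + 4 * sqB r * var 5 ^ 2
    + 8 * var 4 ^ 2 * r - 2 * var 5 ^ 4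

/-- Derivative of the Cayley-Menger determinant in `d²`. -/
def cmD : PolyExpr 9 :=
  var 2 ^ 2 * (-2 * var 2 ^ 2 + 4 * sqA p + 4 * sqB r - 4 * var 5 ^ 2) - 32 * var 3 * var 4 * q

/-- Symmetric part of the derivative of the Cayley-Menger determinant in `(a + α)²`. -/
def cmA : PolyExpr 9 :=
  2 * var 2 ^ 2 * (sqB r + var 5 ^ 2 - sqA p) + 16 * var 3 * var 4 * q - 16 * var 4 ^ 2 * r

/-- Symmetric part of the derivative of the Cayley-Menger determinant in `(b + t)²`. -/
def cmB : PolyExpr 9 :=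
  2 * var 2 ^ 2 * (sqA p + var 5 ^ 2 - sqB r) + 16 * var 3 * var 4 * q - 16 * var 3 ^ 2 * p

def cmAA : PolyExpr 9 := 2 * var 2 ^ 2 - 8 * sqB r
def cmAB : PolyExpr 9 := 4 * sqA p + 4 * sqB r - 4 * var 5 ^ 2 - 2 * var 2 ^ 2
def cmBB : PolyExpr 9 := 2 * var 2 ^ 2 - 8 * sqA p

/-- Symmetric and antisymmetric part of `(a + α)³`, the latter divided by `α`. -/
def cubeA : PolyExpr 9 := var 3 ^ 3 + 3 * var 3 * p
def cubeA' : PolyExpr 9 := 3 * var 3 ^ 2 + p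

/-- Symmetric and antisymmetric part of `(b + t)³`, the latter divided by `t`. -/
def cubeB : PolyExpr 9 := var 4 ^ 3 + 3 * var 4 * r
def cubeB' : PolyExpr 9 := 3 * var 4 ^ 2 + r

/-- The symmetric components of the Dziobek map. -/
def even : Fin 6 → PolyExpr 9 := ![
  var 2 ^ 2 + 2 * sqA p + 2 * var 7 * sqB r + var 7 * var 5 ^ 2 - totalMass,
  cmEven p q r,
  -totalMass + 2 * var 2 ^ 3 * (var 0 + var 1 * totalMass * cmC p q r),
  -totalMass + 2 * var 0 * cubeA p + 2 * var 1 * totalMass * (cubeA p * cmA p q r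
    + 2 * cubeA' p * (var 3 * p * cmAA r + var 4 * q * cmAB p r)),
  -totalMass * var 7 + 2 * var 0 * var 7 * cubeB r + 2 * var 1 * totalMass * (cubeB r * cmB p q r
    + 2 * cubeB' r * (var 3 * q * cmAB p r + var 4 * r * cmBB p)),
  -totalMass * var 7 + 2 * var 5 ^ 3 * (var 0 * var 7 + var 1 * totalMass * cmD p q r)]

/-- Coefficients of the antisymmetric components: `(F₅ - F₃) / 2 = oddAA * α + oddAB * t` and
`(F₆ - F₄) / 2 = oddBA * α + oddBB * t`. -/
def oddAA : PolyExpr 9 :=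
  2 * var 0 * cubeA' p
    + 2 * var 1 * totalMass * (2 * var 3 * cubeA p * cmAA r + cubeA' p * cmA p q r)
def oddAB : PolyExpr 9 := 4 * var 1 * totalMass * var 4 * cubeA p * cmAB p r
def oddBA : PolyExpr 9 := 4 * var 1 * totalMass * var 3 * cubeB r * cmAB p r
def oddBB : PolyExpr 9 :=
  2 * var 0 * var 7 * cubeB' r
    + 2 * var 1 * totalMass * (2 * var 4 * cubeB r * cmBB p + cubeB' r * cmB p q r)

end Reduced

/-- The reduced system in the unknowns `(λ₀, μ, c, a, b, d, β, m, T)`, where `α = β t` and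
`T = t²`: the symmetric components, and the antisymmetric ones divided by `t`. -/
def reduced : Fin 8 → PolyExpr 9 :=
  let p := var 8 * var 6 ^ 2
  let q := var 8 * var 6
  let r := var 8
  ![even p q r 0, even p q r 1, even p q r 2, even p q r 3, even p q r 4, even p q r 5,
    var 6 * oddAA p q r + oddAB p r, var 6 * oddBA p r + oddBB p q r]

/-- Centre of the box in which the reduced system is studied. -/
def boxCenter : Fin 9 → ℚ :=
  ![4.0773330463636, 0.7771554002479, 1.0134749516061, 0.5762129952718, 0.9951533019209,
    0.5821772578754, -0.3481037459704, 0.9918422743909, 0]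

/-- Radius of the box in which the reduced system is studied. -/
def boxRadius : ℚ := 1 / 10 ^ 9

/-- Approximate Jacobian matrix of the reduced system on the box. -/
def approxJac : Matrix (Fin 8) (Fin 9) ℚ :=
  !![0, 0, 2.0269, 2.3049, 3.9481, 1.1549, 0, 1.3196, 2.226;
    0, 0, -1.4113, 4.7217, -2.6116, 2.2477, 0, 0, -7.1457;
    2.0819, -5.7864, -5.9323, 29.6908, -16.4224, -1.3149, 0, -2.1265, 68.748;
    0.3826, 3.129, 4.7988, 17.973, 4.8533, 2.8392, 0, -0.3908, -29.1982;
    1.955, -5.1622, -7.917, 14.4761, -13.0653, 14.6259, 0, 2.048, -58.4923;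
    0.3914, 3.041, -0.4339, 5.7966, 10.0111, 14.5458, 0, -2.7826, 13.4595;
    -0.6935, 3.6383, -20.2052, 33.389, 22.0568, -16.1491, 12.7555, 0.7083, 58.5214;
    5.8935, -30.9202, 35.4149, -87.872, -114.2523, 55.5162, 13.244, 18.2077, -158.9564]

/-- Accuracy of `approxJac`. -/
def jacError : ℚ := 1 / 10 ^ 4

/-- Approximate inverse of the first eight columns of `approxJac`. -/
def approxInv : Matrix (Fin 8) (Fin 8) ℚ :=
  !![-1.53212, -3.00218, -0.23778, 0.78404, 0.70561, -0.22655, 0.01503, -0.01448;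
    -0.6814, -0.31477, -0.18808, 0.33068, 0.18388, -0.13137, 0.00675, -0.00651;
    0.12694, 0.03566, 0.03826, 0.01116, -0.07178, 0.02195, -0.00751, 0.00723;
    0.07217, 0.10736, 0.02006, -0.00222, -0.01998, 0.002, 0.00041, -0.0004;
    0.12465, -0.08548, 0.01608, -0.04019, -0.00773, 0.03205, 0.00244, -0.00235;
    0.07292, 0.14244, 0.00056, -0.03502, -0.01207, 0.04681, -0.00275, 0.00265;
    0, 0.03635, 0.02963, -0.01066, -0.08733, 0.0682, 0.05629, 0.02129;
    0, -0.11118, -0.14241, 0.13764, 0.17886, -0.17406, 0.00592, -0.0057]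

/-- Approximate inverse of the block of `approxJac` that belongs to symmetric configurations. -/
def approxInvSymm : Matrix (Fin 6) (Fin 6) ℚ :=
  !![-1.53212, -2.72004, 0.12359, 0.43475, 0.25173, 0.21515;
    -0.6814, -0.18797, -0.02567, 0.1737, -0.02011, 0.06714;
    0.12694, -0.10523, -0.14219, 0.18559, 0.15487, -0.19862;
    0.07217, 0.11511, 0.03, -0.01183, -0.03246, 0.01414;
    0.12465, -0.03974, 0.07466, -0.09682, -0.08131, 0.10365;
    0.07292, 0.09083, -0.06554, 0.02887, 0.07095, -0.03398]

/-- Approximate zero of the reduced system. -/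
def approxZero : Fin 9 → ℚ :=
  ![4.07733304636361696432719603508202,
    0.77715540024789459345221571833534,
    1.01347495160611012165127833256593,
    0.57621299527180807511793645654536,
    0.99515330192094671865163367610487,
    0.58217725787535124807123864079827,
    -0.34810374597044168798328600809173,
    0.99184227439094091554349694436441,
    0]

/-- Indices of the symmetric components of the reduced system. -/
def symmRow : Fin 6 → Fin 8 := Fin.castLE (by decide)

/-- Indices of the unknowns that describe a symmetric configuration. -/
def symmCol : Fin 6 → Fin 9 := Fin.castLE (by decide)

/-- The interval computation behind all estimates of `redMap`: since the partial derivatives are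
enclosed on a whole convex box, the mean value theorem applies between any two of its points. -/
theorem ball_jac (i : Fin 8) (j : Fin 9) :
    |(ball boxCenter (fun _ => boxRadius) (D j (reduced i))).1 - approxJac i j|
      + (ball boxCenter (fun _ => boxRadius) (D j (reduced i))).2 ≤ jacError := by
  revert i j
  decide +kernel

/-- With radius zero the enclosure is an exact rational evaluation of the residual. -/
theorem ball_approxZero (i : Fin 8) :
    |(ball approxZero (fun _ => 0) (reduced i)).1|
      + (ball approxZero (fun _ => 0) (reduced i)).2 ≤ 1 / 10 ^ 28 := by
  revert i
  decide +kernel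

theorem abs_approxZero_sub_boxCenter_le (i : Fin 9) :
    |approxZero i - boxCenter i| ≤ 1 / 10 ^ 13 := by
  revert i
  decide +kernel

/-- Turns the residual `10⁻²⁸` into a Newton step of at most `10⁻²⁷`. -/
theorem approxInv_sum_le (i : Fin 8) : ∑ k, |approxInv i k| ≤ 10 := by
  revert i
  decide +kernel

/-- Bounds `‖1 - P J‖` in the maximum norm for every `J` within `jacError` of the approximate
Jacobian. This is the contraction constant of the Newton map and the source of all invertibility
statements for the eight-dimensional block. -/
theorem approxInv_mul (i : Fin 8) :
    ∑ j : Fin 8, (|(if i = j then 1 else 0) - ∑ k, approxInv i k * approxJac k j.castSucc|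
      + jacError * ∑ k, |approxInv i k|) ≤ 1 / 50 := by
  revert i
  decide +kernel

theorem approxInvSymm_mul (i : Fin 6) :
    ∑ j : Fin 6, (|(if i = j then 1 else 0)
        - ∑ k : Fin 6, approxInvSymm i k * approxJac (symmRow k) (symmCol j)|
      + jacError * ∑ k, |approxInvSymm i k|) ≤ 1 / 50 := by
  revert i
  decide +kernel

theorem approxInv_mul_last (i : Fin 8) :
    |∑ k, approxInv i k * approxJac k 8| + jacError * ∑ k, |approxInv i k| ≤ 65 := by
  revert i
  decide +kernel

/-- Row 7 belongs to the mass. On a tangent vector of the zero set the first eight components are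
minus the inverse block times column 8, times the `T`-component; hence the slope `dm/dT ≈ 24`. -/
theorem approxInv_mul_last_seven :
    |(∑ k, approxInv 7 k * approxJac k 8) + 24| + jacError * ∑ k, |approxInv 7 k| ≤ 1 := by
  decide +kernel

/-- Radii of the box of symmetric and antisymmetric parts of configurations. -/
def configRadius : ℚ := 1 / 10 ^ 12

/-- Centre of the box of symmetric and antisymmetric parts of configurations. -/
def configCenter : Fin 9 → ℚ := Function.update boxCenter 6 0

/-- The coefficient of `α` in the first antisymmetric equation is bounded away from zero, so this
equation determines `α / t`. -/
theorem ball_oddAA :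
    12 + (ball configCenter (fun _ => configRadius)
        (oddAA (var 6 ^ 2) (var 6 * var 8) (var 8 ^ 2))).2 ≤
      (ball configCenter (fun _ => configRadius)
        (oddAA (var 6 ^ 2) (var 6 * var 8) (var 8 ^ 2))).1 := by
  decide +kernel

/-- The central value of `β` almost solves the equation `β * oddAA + oddAB = 0`. The configuration
box is much smaller than `boxRadius` so that the root of this equation stays in the box of the
reduced system. -/
theorem ball_oddAB :
    |(ball configCenter (fun _ => configRadius)
        (const (boxCenter 6) * oddAA (var 6 ^ 2) (var 6 * var 8) (var 8 ^ 2)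
          + oddAB (var 6 ^ 2) (var 8 ^ 2))).1|
      + (ball configCenter (fun _ => configRadius)
        (const (boxCenter 6) * oddAA (var 6 ^ 2) (var 6 * var 8) (var 8 ^ 2)
          + oddAB (var 6 ^ 2) (var 8 ^ 2))).2 ≤ boxRadius := by
  decide +kernel

end FourBody

/-! ### Approximate inverses and the zero of the reduced system -/

/-- If the rational matrix `P` is almost inverse to `A`, then it is almost inverse to every real
matrix `J` that is close to `A`. -/
theorem norm_sub_approxInverse_le {ι κ : Type*} [Fintype ι] [Fintype κ] [DecidableEq ι]
    (P : Matrix ι κ ℚ) (A : Matrix κ ι ℚ) {η q : ℚ} {J : Matrix κ ι ℝ}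
    (hJ : ∀ k j, |J k j - A k j| ≤ η) (hq : 0 ≤ q)
    (h : ∀ i, ∑ j, (|(if i = j then 1 else 0) - ∑ k, P i k * A k j| + η * ∑ k, |P i k|) ≤ q)
    (u : ι → ℝ) : ‖u - P.map (Rat.cast : ℚ → ℝ) *ᵥ (J *ᵥ u)‖ ≤ q * ‖u‖ := by
  refine (pi_norm_le_iff_of_nonneg (by positivity)).2 fun i => ?_
  -- `1 - P J = (1 - P A) - P (J - A)`: the first summand is an explicit rational matrix, the second
  -- is bounded by `η` times the row sums of `|P|`.
  have e : (u - P.map (Rat.cast : ℚ → ℝ) *ᵥ (J *ᵥ u)) i =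
      ∑ j, ((((if i = j then 1 else 0) - ∑ k, P i k * A k j : ℚ) : ℝ)
        - ∑ k, (P i k : ℝ) * (J k j - A k j)) * u j := by
    have h1 : (P.map (Rat.cast : ℚ → ℝ) *ᵥ (J *ᵥ u)) i = ∑ j, (∑ k, (P i k : ℝ) * J k j) * u j := by
      rw [Matrix.mulVec_mulVec]
      rfl
    have h2 : u i = ∑ j, (if i = j then (1 : ℝ) else 0) * u j := by simp
    rw [Pi.sub_apply, h1, h2, ← Finset.sum_sub_distrib]
    refine Finset.sum_congr rfl fun j _ => ?_
    simp only [mul_sub, Finset.sum_sub_distrib]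
    push_cast
    split_ifs <;> push_cast <;> ring
  rw [e, Real.norm_eq_abs]
  have h' : ((∑ j, (|(if i = j then 1 else 0) - ∑ k, P i k * A k j| + η * ∑ k, |P i k|) : ℚ) : ℝ)
      ≤ q := by exact_mod_cast h i
  refine le_trans (Finset.abs_sum_le_sum_abs _ _) (le_trans ?_
    (mul_le_mul_of_nonneg_right h' (norm_nonneg u)))
  rw [Rat.cast_sum, Finset.sum_mul]
  refine Finset.sum_le_sum fun j _ => ?_
  rw [abs_mul]
  refine mul_le_mul ?_ (norm_le_pi_norm u j) (abs_nonneg _) (le_trans (abs_nonneg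
    ((((if i = j then 1 else 0) - ∑ k, P i k * A k j : ℚ) : ℝ)
        - ∑ k, (P i k : ℝ) * (J k j - A k j))) ?_)
  -- The two goals are the bound of an entry and the nonnegativity of that bound, which follows from
  -- the same estimate.
  all_goals
    refine (abs_sub _ _).trans ?_
    rw [Rat.cast_add, Rat.cast_abs]
    refine add_le_add le_rfl ?_
    refine (Finset.abs_sum_le_sum_abs _ _).trans ?_
    push_cast
    rw [Finset.mul_sum]
    refine Finset.sum_le_sum fun k _ => ?_
    rw [abs_mul, mul_comm]
    gcongr
    exact hJ k j

namespace FourBody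

open PolyExpr

/-- The box in which the reduced system is studied. -/
noncomputable def parBox : Set (Fin 9 → ℝ) :=
  Metric.closedBall (fun i => (boxCenter i : ℝ)) (boxRadius : ℝ)

theorem boxRadius_pos : (0 : ℝ) < boxRadius := by norm_num [boxRadius]

theorem mem_parBox {ρ : Fin 9 → ℝ} :
    ρ ∈ parBox ↔ ∀ i, |ρ i - boxCenter i| ≤ boxRadius :=
  dist_pi_le_iff boxRadius_pos.le

/-- The reduced system. -/
noncomputable def redMap (ρ : Fin 9 → ℝ) : Fin 8 → ℝ := fun i => eval ρ (reduced i)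

/-- Jacobian matrix of the reduced system. -/
noncomputable def redJac (ρ : Fin 9 → ℝ) : Matrix (Fin 8) (Fin 9) ℝ :=
  Matrix.of fun i j => eval ρ (D j (reduced i))

/-- The real matrix `J` is close to `approxJac`. -/
def NearJac (J : Matrix (Fin 8) (Fin 9) ℝ) : Prop := ∀ i j, |J i j - approxJac i j| ≤ jacError

theorem nearJac_eval {ρ : Fin 9 → ℝ} (h : ρ ∈ parBox) (i : Fin 8) (j : Fin 9) :
    |eval ρ (D j (reduced i)) - approxJac i j| ≤ jacError := by
  have h1 := abs_eval_sub_le (c := boxCenter) (r := fun _ => boxRadius) (mem_parBox.1 h)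
    (D j (reduced i))
  have h2 : ((|(ball boxCenter (fun _ => boxRadius) (D j (reduced i))).1 - approxJac i j|
      + (ball boxCenter (fun _ => boxRadius) (D j (reduced i))).2 : ℚ) : ℝ) ≤ jacError := by
    exact_mod_cast ball_jac i j
  push_cast at h2
  exact (abs_sub_le _ _ _).trans (by linarith)

theorem nearJac_redJac {ρ : Fin 9 → ℝ} (h : ρ ∈ parBox) : NearJac (redJac ρ) := nearJac_eval h

/-- Mean value theorem for the reduced system. -/
theorem exists_nearJac {ρ σ : Fin 9 → ℝ} (hρ : ρ ∈ parBox) (hσ : σ ∈ parBox) :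
    ∃ J, NearJac J ∧ redMap ρ - redMap σ = J *ᵥ (ρ - σ) := by
  -- Every component has its own intermediate point, so the matrix need not be the Jacobian at any
  -- point. This is why `NearJac` speaks of arbitrary matrices.
  choose ξ hξ h using fun i : Fin 8 => exists_eval_sub_eq (reduced i) ρ σ
  refine ⟨Matrix.of fun i j => eval (ξ i) (D j (reduced i)), fun i j => ?_, ?_⟩
  · exact nearJac_eval ((convex_closedBall _ _).segment_subset hσ hρ (hξ i)) i j
  · ext i
    exact h i

theorem norm_sub_approxInv_le {J : Matrix (Fin 8) (Fin 9) ℝ} (hJ : NearJac J) (u : Fin 8 → ℝ) :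
    ‖u - approxInv.map (Rat.cast : ℚ → ℝ) *ᵥ (J.submatrix id Fin.castSucc *ᵥ u)‖ ≤
      1 / 50 * ‖u‖ := by
  have := norm_sub_approxInverse_le approxInv (approxJac.submatrix id Fin.castSucc)
    (J := J.submatrix id Fin.castSucc) (q := 1 / 50) (fun k j => hJ k j.castSucc) (by norm_num)
    approxInv_mul u
  push_cast at this
  exact this

theorem nearJac_symm_injective {J : Matrix (Fin 8) (Fin 9) ℝ} (hJ : NearJac J) {u : Fin 6 → ℝ}
    (h : J.submatrix symmRow symmCol *ᵥ u = 0) : u = 0 := by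
  have := norm_sub_approxInverse_le approxInvSymm
    (approxJac.submatrix symmRow symmCol)
    (J := J.submatrix symmRow symmCol) (q := 1 / 50)
    (fun k j => hJ _ _) (by norm_num) approxInvSymm_mul u
  rw [h, Matrix.mulVec_zero, sub_zero] at this
  push_cast at this
  exact norm_eq_zero.1 (by linarith [norm_nonneg u])

theorem mulVec_castSucc (J : Matrix (Fin 8) (Fin 9) ℝ) (u : Fin 9 → ℝ) (i : Fin 8) :
    (J *ᵥ u) i = (J.submatrix id Fin.castSucc *ᵥ fun j => u j.castSucc) i + J i 8 * u 8 := by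
  simp only [Matrix.mulVec, dotProduct]
  rw [Fin.sum_univ_castSucc]
  rfl

theorem abs_approxInv_mul_sub_le {J : Matrix (Fin 8) (Fin 9) ℝ} (hJ : NearJac J) (i : Fin 8) :
    |∑ k, (approxInv i k : ℝ) * J k 8 - ∑ k, (approxInv i k : ℝ) * approxJac k 8|
      ≤ jacError * ∑ k, |(approxInv i k : ℝ)| := by
  rw [← Finset.sum_sub_distrib, Finset.mul_sum]
  refine (Finset.abs_sum_le_sum_abs _ _).trans (Finset.sum_le_sum fun k _ => ?_)
  rw [← mul_sub, abs_mul, mul_comm]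
  exact mul_le_mul_of_nonneg_right (hJ k 8) (abs_nonneg _)

/-- A tangent vector of the solution set of the reduced system is determined by its
`T`-component, and its `m`-component is a positive multiple of it. -/
theorem nearJac_kernel {J : Matrix (Fin 8) (Fin 9) ℝ} (hJ : NearJac J) {u : Fin 9 → ℝ}
    (h : J *ᵥ u = 0) : (∀ i : Fin 8, |u i.castSucc| ≤ 70 * |u 8|) ∧
      |u 7 - 24 * u 8| ≤ 3 * |u 8| := by
  set v : Fin 8 → ℝ := fun j => u j.castSucc with hv
  have h1 : J.submatrix id Fin.castSucc *ᵥ v = fun i => -(J i 8 * u 8) := by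
    ext i
    have := congrFun h i
    rw [mulVec_castSucc, Pi.zero_apply] at this
    linarith
  have h2 := norm_sub_approxInv_le hJ v
  rw [h1] at h2
  have h3 : ∀ i, (v - approxInv.map (Rat.cast : ℚ → ℝ) *ᵥ fun i => -(J i 8 * u 8)) i =
      v i + (∑ k, (approxInv i k : ℝ) * J k 8) * u 8 := by
    intro i
    simp only [Pi.sub_apply, Matrix.mulVec, dotProduct, Matrix.map_apply, Finset.sum_mul,
      sub_eq_add_neg, ← Finset.sum_neg_distrib]
    congr 1
    exact Finset.sum_congr rfl fun k _ => by ring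
  have h4 : ∀ i, |v i + (∑ k, (approxInv i k : ℝ) * J k 8) * u 8| ≤ 1 / 50 * ‖v‖ := by
    intro i
    rw [← h3]
    exact (norm_le_pi_norm _ i).trans h2
  have h5 : ∀ i, |∑ k, (approxInv i k : ℝ) * J k 8| ≤ 65 := by
    intro i
    have := (Rat.cast_le (K := ℝ)).2 (approxInv_mul_last i)
    push_cast at this
    have h6 := abs_approxInv_mul_sub_le hJ i
    have h7 := abs_sub_abs_le_abs_sub (∑ k, (approxInv i k : ℝ) * J k 8)
      (∑ k, (approxInv i k : ℝ) * approxJac k 8)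
    linarith
  have h6 : |(∑ k, (approxInv 7 k : ℝ) * J k 8) + 24| ≤ 1 := by
    have := (Rat.cast_le (K := ℝ)).2 approxInv_mul_last_seven
    push_cast at this
    have h6 := abs_approxInv_mul_sub_le hJ 7
    have h7 := abs_add_le (∑ k, (approxInv 7 k : ℝ) * J k 8
      - ∑ k, (approxInv 7 k : ℝ) * approxJac k 8) (∑ k, (approxInv 7 k : ℝ) * approxJac k 8 + 24)
    rw [← add_assoc, sub_add_cancel] at h7
    linarith
  -- `65 / (1 - 1/50) < 67`. The errors in the mass component then add up to `1 + 67/50 < 3`.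
  have h7 : ‖v‖ ≤ 67 * |u 8| := by
    have : ‖v‖ ≤ 65 * |u 8| + 1 / 50 * ‖v‖ := by
      refine (pi_norm_le_iff_of_nonneg (by positivity)).2 fun i => ?_
      have a := h4 i
      have b := abs_sub_abs_le_abs_sub (v i) (-((∑ k, (approxInv i k : ℝ) * J k 8) * u 8))
      rw [sub_neg_eq_add, abs_neg, abs_mul] at b
      have c := mul_le_mul_of_nonneg_right (h5 i) (abs_nonneg (u 8))
      rw [Real.norm_eq_abs]
      linarith
    linarith [abs_nonneg (u 8), norm_nonneg v]
  refine ⟨fun i => ?_, ?_⟩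
  · have := (norm_le_pi_norm v i).trans h7
    rw [Real.norm_eq_abs] at this
    linarith [abs_nonneg (u 8)]
  · have a := h4 7
    have b := mul_le_mul_of_nonneg_right h6 (abs_nonneg (u 8))
    rw [← abs_mul] at b
    have c := abs_sub (v 7 + (∑ k, (approxInv 7 k : ℝ) * J k 8) * u 8)
      (((∑ k, (approxInv 7 k : ℝ) * J k 8) + 24) * u 8)
    have d : v 7 + (∑ k, (approxInv 7 k : ℝ) * J k 8) * u 8
      - ((∑ k, (approxInv 7 k : ℝ) * J k 8) + 24) * u 8 = u 7 - 24 * u 8 := by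
      have : v 7 = u 7 := rfl
      rw [this]; ring
    rw [d] at c
    linarith [abs_nonneg (u 8)]

/-- If the `m`-component vanishes, then `24 |u 8| ≤ 3 |u 8|`; so the zero curve can be parametrized
by `m` as well as by `T`. -/
theorem nearJac_kernel_eq_zero {J : Matrix (Fin 8) (Fin 9) ℝ} (hJ : NearJac J) {u : Fin 9 → ℝ}
    (h : J *ᵥ u = 0) (h' : u 7 = 0 ∨ u 8 = 0) : u = 0 := by
  obtain ⟨h1, h2⟩ := nearJac_kernel hJ h
  have h8 : u 8 = 0 := by
    rcases h' with h' | h'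
    · rw [h', zero_sub, abs_neg, abs_mul] at h2
      norm_num at h2
      exact abs_eq_zero.1 (by linarith [abs_nonneg (u 8)])
    · exact h'
  ext i
  refine Fin.lastCases h8 (fun i => ?_) i
  have := h1 i
  rw [h8, abs_zero, mul_zero] at this
  exact abs_eq_zero.1 (le_antisymm this (abs_nonneg _))

/-- In the box the reduced system has at most one zero for given `T`. -/
theorem redMap_injOn {ρ σ : Fin 9 → ℝ} (hρ : ρ ∈ parBox) (hσ : σ ∈ parBox) (h8 : ρ 8 = σ 8)
    (h : redMap ρ = redMap σ) : ρ = σ := by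
  obtain ⟨J, hJ, e⟩ := exists_nearJac hρ hσ
  rw [h, sub_self] at e
  exact sub_eq_zero.1 (nearJac_kernel_eq_zero hJ e.symm (Or.inr (by simp [h8])))

theorem boxCenter_mem : (fun i => (boxCenter i : ℝ)) ∈ parBox :=
  Metric.mem_closedBall_self boxRadius_pos.le

/-- `P J` is so close to the identity that it is nonsingular, hence so is its factor `P`. Thus a
fixed point of the Newton map is a genuine zero. -/
theorem approxInv_injective {u : Fin 8 → ℝ}
    (h : approxInv.map (Rat.cast : ℚ → ℝ) *ᵥ u = 0) : u = 0 := by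
  set P := approxInv.map (Rat.cast : ℚ → ℝ)
  have hJ := nearJac_redJac boxCenter_mem
  set J := (redJac fun i => (boxCenter i : ℝ)).submatrix id Fin.castSucc
  have h1 : (P * J).det ≠ 0 := by
    intro h0
    obtain ⟨v, hv, hv'⟩ := Matrix.exists_mulVec_eq_zero_iff.2 h0
    have h2 := norm_sub_approxInv_le hJ v
    rw [Matrix.mulVec_mulVec, hv', sub_zero] at h2
    exact hv (norm_eq_zero.1 (by linarith [norm_nonneg v]))
  by_contra hu
  rw [Matrix.det_mul, Matrix.exists_mulVec_eq_zero_iff.1 ⟨u, hu, h⟩, zero_mul] at h1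
  exact h1 rfl

/-- The simplified Newton map of the reduced system with `T = 0`. -/
noncomputable def newton (u : Fin 8 → ℝ) : Fin 8 → ℝ :=
  u - approxInv.map (Rat.cast : ℚ → ℝ) *ᵥ redMap (Fin.snoc (α := fun _ => ℝ) u 0)

theorem snoc_mem_parBox {u : Fin 8 → ℝ} (h : ∀ i, |u i - approxZero i.castSucc| ≤ 1 / 10 ^ 10) :
    Fin.snoc (α := fun _ => ℝ) u 0 ∈ parBox := by
  refine mem_parBox.2 fun i => ?_
  have h1 := (Rat.cast_le (K := ℝ)).2 (abs_approxZero_sub_boxCenter_le i)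
  push_cast at h1
  have h2 : |(Fin.snoc (α := fun _ => ℝ) u 0 : Fin 9 → ℝ) i - approxZero i| ≤ 1 / 10 ^ 10 := by
    refine Fin.lastCases ?_ (fun i => ?_) i
    · rw [Fin.snoc_last, show approxZero (Fin.last 8) = 0 from rfl]
      norm_num
    · rw [Fin.snoc_castSucc]
      exact h i
  refine (abs_sub_le _ _ _).trans ((add_le_add h2 h1).trans ?_)
  norm_num [boxRadius]

/-- By the mean value theorem the difference is `(1 - P J) (u - v)`; the column of `T` drops out
because both points have `T = 0`. -/
theorem norm_newton_sub_le {u v : Fin 8 → ℝ} (hu : Fin.snoc (α := fun _ => ℝ) u 0 ∈ parBox)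
    (hv : Fin.snoc (α := fun _ => ℝ) v 0 ∈ parBox) : ‖newton u - newton v‖ ≤ 1 / 50 * ‖u - v‖ := by
  obtain ⟨J, hJ, e⟩ := exists_nearJac hu hv
  have h1 := norm_sub_approxInv_le hJ (u - v)
  have h2 : J *ᵥ ((Fin.snoc (α := fun _ => ℝ) u 0 : Fin 9 → ℝ) - Fin.snoc (α := fun _ => ℝ) v 0) =
      J.submatrix id Fin.castSucc *ᵥ (u - v) := by
    ext i
    rw [mulVec_castSucc]
    have : ((Fin.snoc (α := fun _ => ℝ) u 0 : Fin 9 → ℝ) -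
        Fin.snoc (α := fun _ => ℝ) v 0) 8 = 0 := by
      change (Fin.snoc (α := fun _ => ℝ) u 0 : Fin 9 → ℝ) (Fin.last 8)
        - (Fin.snoc (α := fun _ => ℝ) v 0 : Fin 9 → ℝ) (Fin.last 8) = 0
      rw [Fin.snoc_last, Fin.snoc_last, sub_zero]
    rw [this, mul_zero, add_zero]
    congr 2
    ext j
    simp only [Pi.sub_apply, Fin.snoc_castSucc]
  rw [← h2, ← e] at h1
  convert h1 using 2
  simp only [newton, Matrix.mulVec_sub]
  abel

/-- Banach's fixed point theorem on a ball of radius `10⁻²⁶`: the ball is mapped into itself because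
`10⁻²⁶ / 50 + 10⁻²⁷ ≤ 10⁻²⁶`. -/
theorem exists_redMap_eq_zero :
    ∃ ρ : Fin 9 → ℝ, (∀ i, |ρ i - approxZero i| ≤ 1 / 10 ^ 26) ∧ ρ 8 = 0 ∧ redMap ρ = 0 := by
  set c : Fin 8 → ℝ := fun i => approxZero i.castSucc with hc
  set R : ℝ := 1 / 10 ^ 26 with hR
  have hR0 : 0 < R := by norm_num [hR]
  set s := Metric.closedBall c R with hs
  have hbox : ∀ u ∈ s, Fin.snoc (α := fun _ => ℝ) u 0 ∈ parBox := by
    intro u hu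
    refine snoc_mem_parBox fun i => ?_
    have := (dist_pi_le_iff hR0.le).1 hu i
    rw [Real.dist_eq] at this
    refine this.trans ?_
    norm_num [hR]
  have hcs : c ∈ s := Metric.mem_closedBall_self hR0.le
  have hcc : (Fin.snoc (α := fun _ => ℝ) c 0 : Fin 9 → ℝ) = fun i => (approxZero i : ℝ) := by
    ext i
    refine Fin.lastCases ?_ (fun i => ?_) i
    · rw [Fin.snoc_last, show approxZero (Fin.last 8) = 0 from rfl, Rat.cast_zero]
    · rw [Fin.snoc_castSucc]
  have h0 : ‖newton c - c‖ ≤ 1 / 10 ^ 27 := by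
    rw [newton, sub_sub_cancel_left, norm_neg]
    refine (pi_norm_le_iff_of_nonneg (by norm_num)).2 fun i => ?_
    rw [Real.norm_eq_abs, Matrix.mulVec, dotProduct]
    refine (Finset.abs_sum_le_sum_abs _ _).trans ?_
    have h1 : ∀ k, |redMap (Fin.snoc (α := fun _ => ℝ) c 0) k| ≤ 1 / 10 ^ 28 := by
      intro k
      rw [hcc]
      have h2 := abs_eval_sub_le (c := approxZero) (r := fun _ => 0)
        (ρ := fun i => (approxZero i : ℝ)) (fun i => by simp) (reduced k)
      have h3 := (Rat.cast_le (K := ℝ)).2 (ball_approxZero k)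
      push_cast at h3
      have h4 := abs_sub_abs_le_abs_sub (eval (fun i => (approxZero i : ℝ)) (reduced k))
        (ball approxZero (fun _ => 0) (reduced k)).1
      exact (by linarith : |eval (fun i => (approxZero i : ℝ)) (reduced k)| ≤ 1 / 10 ^ 28)
    have h2 := (Rat.cast_le (K := ℝ)).2 (approxInv_sum_le i)
    push_cast at h2
    calc _ ≤ ∑ k, |(approxInv i k : ℝ)| * (1 / 10 ^ 28) := by
          refine Finset.sum_le_sum fun k _ => ?_
          rw [abs_mul]
          exact mul_le_mul_of_nonneg_left (h1 k) (abs_nonneg _)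
      _ = (∑ k, |(approxInv i k : ℝ)|) * (1 / 10 ^ 28) := (Finset.sum_mul ..).symm
      _ ≤ 10 * (1 / 10 ^ 28) := by gcongr
      _ = 1 / 10 ^ 27 := by norm_num
  have hmaps : Set.MapsTo newton s s := by
    intro u hu
    have h1 := norm_newton_sub_le (hbox u hu) (hbox c hcs)
    have h2 : ‖u - c‖ ≤ R := by rwa [← dist_eq_norm]
    rw [hs, Metric.mem_closedBall, dist_eq_norm, ← sub_add_sub_cancel _ (newton c)]
    refine (norm_add_le _ _).trans ((add_le_add (h1.trans (mul_le_mul_of_nonneg_left h2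
      (by norm_num))) h0).trans ?_)
    norm_num [hR]
  have hcontr : ContractingWith (1 / 50) (hmaps.restrict newton s s) := by
    refine ⟨by rw [← NNReal.coe_lt_coe]; norm_num, LipschitzWith.of_dist_le_mul fun u v => ?_⟩
    rw [Subtype.dist_eq, Subtype.dist_eq, dist_eq_norm, dist_eq_norm]
    simpa using norm_newton_sub_le (hbox u u.2) (hbox v v.2)
  obtain ⟨u, hu, hfix, -⟩ := hcontr.exists_fixedPoint' Metric.isClosed_closedBall.isComplete hmaps
    hcs (edist_ne_top _ _)
  refine ⟨Fin.snoc (α := fun _ => ℝ) u 0, fun i => ?_, ?_, ?_⟩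
  · refine Fin.lastCases ?_ (fun i => ?_) i
    · rw [Fin.snoc_last, show approxZero (Fin.last 8) = 0 from rfl]
      norm_num
    · rw [Fin.snoc_castSucc]
      exact (dist_pi_le_iff hR0.le).1 hu i
  · exact Fin.snoc_last (α := fun _ => ℝ) _ _
  · apply approxInv_injective
    have : newton u = u := hfix
    rwa [newton, sub_eq_self] at this

/-! ### The Dziobek map in symmetric and antisymmetric coordinates -/

set_option maxHeartbeats 1000000 in
theorem cmDet_eq (x : Vec) : cmDet x =
    -2 * x 2 ^ 4 * x 7 ^ 2 - 2 * x 2 ^ 2 * x 3 ^ 2 * x 5 ^ 2 + 2 * x 2 ^ 2 * x 3 ^ 2 * x 6 ^ 2 +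
    2 * x 2 ^ 2 * x 3 ^ 2 * x 7 ^ 2 + 2 * x 2 ^ 2 * x 4 ^ 2 * x 5 ^ 2 - 2 * x 2 ^ 2 * x 4 ^ 2 *
    x 6 ^ 2 + 2 * x 2 ^ 2 * x 4 ^ 2 * x 7 ^ 2 + 2 * x 2 ^ 2 * x 5 ^ 2 * x 7 ^ 2 + 2 * x 2 ^ 2 *
    x 6 ^ 2 * x 7 ^ 2 - 2 * x 2 ^ 2 * x 7 ^ 4 - 2 * x 3 ^ 4 * x 6 ^ 2 + 2 * x 3 ^ 2 * x 4 ^ 2 *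
    x 5 ^ 2 + 2 * x 3 ^ 2 * x 4 ^ 2 * x 6 ^ 2 - 2 * x 3 ^ 2 * x 4 ^ 2 * x 7 ^ 2 + 2 * x 3 ^ 2 *
    x 5 ^ 2 * x 6 ^ 2 - 2 * x 3 ^ 2 * x 6 ^ 4 + 2 * x 3 ^ 2 * x 6 ^ 2 * x 7 ^ 2 - 2 * x 4 ^ 4 *
    x 5 ^ 2 - 2 * x 4 ^ 2 * x 5 ^ 4 + 2 * x 4 ^ 2 * x 5 ^ 2 * x 6 ^ 2 + 2 * x 4 ^ 2 * x 5 ^ 2 *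
    x 7 ^ 2 - 2 * x 5 ^ 2 * x 6 ^ 2 * x 7 ^ 2 := by
  rw [cmDet, Matrix.det_succ_row_zero]
  simp only [Fin.sum_univ_five]
  iterate 5 rw [Matrix.det_succ_row_zero]
  simp only [Fin.sum_univ_four, Matrix.det_fin_three]
  simp [cayleyMenger, Fin.succAbove]
  ring

/-- The Cayley-Menger determinant has this form in each single distance. -/
theorem deriv_biquadratic (A B C s : ℝ) :
    deriv (fun t => A * t ^ 4 + B * t ^ 2 + C) s = 2 * s * (2 * A * s ^ 2 + B) := by
  have h := (((hasDerivAt_pow 4 s).const_mul A).add ((hasDerivAt_pow 2 s).const_mul B)).add_const C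
  refine HasDerivAt.deriv (h.congr_deriv ?_)
  push_cast
  ring

theorem partialDeriv_cmDet_two (x : Vec) : partialDeriv cmDet 2 x = 2 * x 2 *
    (-4 * x 2 ^ 2 * x 7 ^ 2 - 2 * x 3 ^ 2 * x 5 ^ 2 + 2 * x 3 ^ 2 * x 6 ^ 2 + 2 * x 3 ^ 2 * x 7
     ^ 2 + 2 * x 4 ^ 2 * x 5 ^ 2 - 2 * x 4 ^ 2 * x 6 ^ 2 + 2 * x 4 ^ 2 * x 7 ^ 2 + 2 * x 5 ^ 2 *
     x 7 ^ 2 + 2 * x 6 ^ 2 * x 7 ^ 2 - 2 * x 7 ^ 4) := by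
  have h : (fun t => cmDet (Function.update x 2 t)) = fun t =>
      (-2 * x 7 ^ 2) * t ^ 4
      + (-2 * x 3 ^ 2 * x 5 ^ 2 + 2 * x 3 ^ 2 * x 6 ^ 2 + 2 * x 3 ^ 2 * x 7 ^ 2 + 2 * x 4 ^ 2 *
         x 5 ^ 2 - 2 * x 4 ^ 2 * x 6 ^ 2 + 2 * x 4 ^ 2 * x 7 ^ 2 + 2 * x 5 ^ 2 * x 7 ^ 2 + 2 * x
         6 ^ 2 * x 7 ^ 2 - 2 * x 7 ^ 4) * t ^ 2
      + (-2 * x 3 ^ 4 * x 6 ^ 2 + 2 * x 3 ^ 2 * x 4 ^ 2 * x 5 ^ 2 + 2 * x 3 ^ 2 * x 4 ^ 2 * x 6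
         ^ 2 - 2 * x 3 ^ 2 * x 4 ^ 2 * x 7 ^ 2 + 2 * x 3 ^ 2 * x 5 ^ 2 * x 6 ^ 2 - 2 * x 3 ^ 2 *
         x 6 ^ 4 + 2 * x 3 ^ 2 * x 6 ^ 2 * x 7 ^ 2 - 2 * x 4 ^ 4 * x 5 ^ 2 - 2 * x 4 ^ 2 * x 5 ^
         4 + 2 * x 4 ^ 2 * x 5 ^ 2 * x 6 ^ 2 + 2 * x 4 ^ 2 * x 5 ^ 2 * x 7 ^ 2 - 2 * x 5 ^ 2 * x
         6 ^ 2 * x 7 ^ 2) := by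
    funext t
    rw [cmDet_eq]
    simp [Function.update]
    ring
  rw [partialDeriv, h, deriv_biquadratic]
  ring

theorem partialDeriv_cmDet_three (x : Vec) : partialDeriv cmDet 3 x = 2 * x 3 *
    (-2 * x 2 ^ 2 * x 5 ^ 2 + 2 * x 2 ^ 2 * x 6 ^ 2 + 2 * x 2 ^ 2 * x 7 ^ 2 - 4 * x 3 ^ 2 * x 6
     ^ 2 + 2 * x 4 ^ 2 * x 5 ^ 2 + 2 * x 4 ^ 2 * x 6 ^ 2 - 2 * x 4 ^ 2 * x 7 ^ 2 + 2 * x 5 ^ 2 *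
     x 6 ^ 2 - 2 * x 6 ^ 4 + 2 * x 6 ^ 2 * x 7 ^ 2) := by
  have h : (fun t => cmDet (Function.update x 3 t)) = fun t =>
      (-2 * x 6 ^ 2) * t ^ 4
      + (-2 * x 2 ^ 2 * x 5 ^ 2 + 2 * x 2 ^ 2 * x 6 ^ 2 + 2 * x 2 ^ 2 * x 7 ^ 2 + 2 * x 4 ^ 2 *
         x 5 ^ 2 + 2 * x 4 ^ 2 * x 6 ^ 2 - 2 * x 4 ^ 2 * x 7 ^ 2 + 2 * x 5 ^ 2 * x 6 ^ 2 - 2 * x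
         6 ^ 4 + 2 * x 6 ^ 2 * x 7 ^ 2) * t ^ 2
      + (-2 * x 2 ^ 4 * x 7 ^ 2 + 2 * x 2 ^ 2 * x 4 ^ 2 * x 5 ^ 2 - 2 * x 2 ^ 2 * x 4 ^ 2 * x 6
         ^ 2 + 2 * x 2 ^ 2 * x 4 ^ 2 * x 7 ^ 2 + 2 * x 2 ^ 2 * x 5 ^ 2 * x 7 ^ 2 + 2 * x 2 ^ 2 *
         x 6 ^ 2 * x 7 ^ 2 - 2 * x 2 ^ 2 * x 7 ^ 4 - 2 * x 4 ^ 4 * x 5 ^ 2 - 2 * x 4 ^ 2 * x 5 ^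
         4 + 2 * x 4 ^ 2 * x 5 ^ 2 * x 6 ^ 2 + 2 * x 4 ^ 2 * x 5 ^ 2 * x 7 ^ 2 - 2 * x 5 ^ 2 * x
         6 ^ 2 * x 7 ^ 2) := by
    funext t
    rw [cmDet_eq]
    simp [Function.update]
    ring
  rw [partialDeriv, h, deriv_biquadratic]
  ring

theorem partialDeriv_cmDet_four (x : Vec) : partialDeriv cmDet 4 x = 2 * x 4 *
    (2 * x 2 ^ 2 * x 5 ^ 2 - 2 * x 2 ^ 2 * x 6 ^ 2 + 2 * x 2 ^ 2 * x 7 ^ 2 + 2 * x 3 ^ 2 * x 5 ^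
     2 + 2 * x 3 ^ 2 * x 6 ^ 2 - 2 * x 3 ^ 2 * x 7 ^ 2 - 4 * x 4 ^ 2 * x 5 ^ 2 - 2 * x 5 ^ 4 + 2
     * x 5 ^ 2 * x 6 ^ 2 + 2 * x 5 ^ 2 * x 7 ^ 2) := by
  have h : (fun t => cmDet (Function.update x 4 t)) = fun t =>
      (-2 * x 5 ^ 2) * t ^ 4
      + (2 * x 2 ^ 2 * x 5 ^ 2 - 2 * x 2 ^ 2 * x 6 ^ 2 + 2 * x 2 ^ 2 * x 7 ^ 2 + 2 * x 3 ^ 2 * x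
         5 ^ 2 + 2 * x 3 ^ 2 * x 6 ^ 2 - 2 * x 3 ^ 2 * x 7 ^ 2 - 2 * x 5 ^ 4 + 2 * x 5 ^ 2 * x 6
         ^ 2 + 2 * x 5 ^ 2 * x 7 ^ 2) * t ^ 2
      + (-2 * x 2 ^ 4 * x 7 ^ 2 - 2 * x 2 ^ 2 * x 3 ^ 2 * x 5 ^ 2 + 2 * x 2 ^ 2 * x 3 ^ 2 * x 6
         ^ 2 + 2 * x 2 ^ 2 * x 3 ^ 2 * x 7 ^ 2 + 2 * x 2 ^ 2 * x 5 ^ 2 * x 7 ^ 2 + 2 * x 2 ^ 2 *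
         x 6 ^ 2 * x 7 ^ 2 - 2 * x 2 ^ 2 * x 7 ^ 4 - 2 * x 3 ^ 4 * x 6 ^ 2 + 2 * x 3 ^ 2 * x 5 ^
         2 * x 6 ^ 2 - 2 * x 3 ^ 2 * x 6 ^ 4 + 2 * x 3 ^ 2 * x 6 ^ 2 * x 7 ^ 2 - 2 * x 5 ^ 2 * x
         6 ^ 2 * x 7 ^ 2) := by
    funext t
    rw [cmDet_eq]
    simp [Function.update]
    ring
  rw [partialDeriv, h, deriv_biquadratic]
  ring

theorem partialDeriv_cmDet_five (x : Vec) : partialDeriv cmDet 5 x = 2 * x 5 *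
    (-2 * x 2 ^ 2 * x 3 ^ 2 + 2 * x 2 ^ 2 * x 4 ^ 2 + 2 * x 2 ^ 2 * x 7 ^ 2 + 2 * x 3 ^ 2 * x 4
     ^ 2 + 2 * x 3 ^ 2 * x 6 ^ 2 - 2 * x 4 ^ 4 - 4 * x 4 ^ 2 * x 5 ^ 2 + 2 * x 4 ^ 2 * x 6 ^ 2 +
     2 * x 4 ^ 2 * x 7 ^ 2 - 2 * x 6 ^ 2 * x 7 ^ 2) := by
  have h : (fun t => cmDet (Function.update x 5 t)) = fun t =>
      (-2 * x 4 ^ 2) * t ^ 4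
      + (-2 * x 2 ^ 2 * x 3 ^ 2 + 2 * x 2 ^ 2 * x 4 ^ 2 + 2 * x 2 ^ 2 * x 7 ^ 2 + 2 * x 3 ^ 2 *
         x 4 ^ 2 + 2 * x 3 ^ 2 * x 6 ^ 2 - 2 * x 4 ^ 4 + 2 * x 4 ^ 2 * x 6 ^ 2 + 2 * x 4 ^ 2 * x
         7 ^ 2 - 2 * x 6 ^ 2 * x 7 ^ 2) * t ^ 2
      + (-2 * x 2 ^ 4 * x 7 ^ 2 + 2 * x 2 ^ 2 * x 3 ^ 2 * x 6 ^ 2 + 2 * x 2 ^ 2 * x 3 ^ 2 * x 7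
         ^ 2 - 2 * x 2 ^ 2 * x 4 ^ 2 * x 6 ^ 2 + 2 * x 2 ^ 2 * x 4 ^ 2 * x 7 ^ 2 + 2 * x 2 ^ 2 *
         x 6 ^ 2 * x 7 ^ 2 - 2 * x 2 ^ 2 * x 7 ^ 4 - 2 * x 3 ^ 4 * x 6 ^ 2 + 2 * x 3 ^ 2 * x 4 ^
         2 * x 6 ^ 2 - 2 * x 3 ^ 2 * x 4 ^ 2 * x 7 ^ 2 - 2 * x 3 ^ 2 * x 6 ^ 4 + 2 * x 3 ^ 2 * x
         6 ^ 2 * x 7 ^ 2) := by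
    funext t
    rw [cmDet_eq]
    simp [Function.update]
    ring
  rw [partialDeriv, h, deriv_biquadratic]
  ring

theorem partialDeriv_cmDet_six (x : Vec) : partialDeriv cmDet 6 x = 2 * x 6 *
    (2 * x 2 ^ 2 * x 3 ^ 2 - 2 * x 2 ^ 2 * x 4 ^ 2 + 2 * x 2 ^ 2 * x 7 ^ 2 - 2 * x 3 ^ 4 + 2 * x
     3 ^ 2 * x 4 ^ 2 + 2 * x 3 ^ 2 * x 5 ^ 2 - 4 * x 3 ^ 2 * x 6 ^ 2 + 2 * x 3 ^ 2 * x 7 ^ 2 + 2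
     * x 4 ^ 2 * x 5 ^ 2 - 2 * x 5 ^ 2 * x 7 ^ 2) := by
  have h : (fun t => cmDet (Function.update x 6 t)) = fun t =>
      (-2 * x 3 ^ 2) * t ^ 4
      + (2 * x 2 ^ 2 * x 3 ^ 2 - 2 * x 2 ^ 2 * x 4 ^ 2 + 2 * x 2 ^ 2 * x 7 ^ 2 - 2 * x 3 ^ 4 + 2
         * x 3 ^ 2 * x 4 ^ 2 + 2 * x 3 ^ 2 * x 5 ^ 2 + 2 * x 3 ^ 2 * x 7 ^ 2 + 2 * x 4 ^ 2 * x 5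
         ^ 2 - 2 * x 5 ^ 2 * x 7 ^ 2) * t ^ 2
      + (-2 * x 2 ^ 4 * x 7 ^ 2 - 2 * x 2 ^ 2 * x 3 ^ 2 * x 5 ^ 2 + 2 * x 2 ^ 2 * x 3 ^ 2 * x 7
         ^ 2 + 2 * x 2 ^ 2 * x 4 ^ 2 * x 5 ^ 2 + 2 * x 2 ^ 2 * x 4 ^ 2 * x 7 ^ 2 + 2 * x 2 ^ 2 *
         x 5 ^ 2 * x 7 ^ 2 - 2 * x 2 ^ 2 * x 7 ^ 4 + 2 * x 3 ^ 2 * x 4 ^ 2 * x 5 ^ 2 - 2 * x 3 ^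
         2 * x 4 ^ 2 * x 7 ^ 2 - 2 * x 4 ^ 4 * x 5 ^ 2 - 2 * x 4 ^ 2 * x 5 ^ 4 + 2 * x 4 ^ 2 * x
         5 ^ 2 * x 7 ^ 2) := by
    funext t
    rw [cmDet_eq]
    simp [Function.update]
    ring
  rw [partialDeriv, h, deriv_biquadratic]
  ring

theorem partialDeriv_cmDet_seven (x : Vec) : partialDeriv cmDet 7 x = 2 * x 7 *
    (-2 * x 2 ^ 4 + 2 * x 2 ^ 2 * x 3 ^ 2 + 2 * x 2 ^ 2 * x 4 ^ 2 + 2 * x 2 ^ 2 * x 5 ^ 2 + 2 *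
     x 2 ^ 2 * x 6 ^ 2 - 4 * x 2 ^ 2 * x 7 ^ 2 - 2 * x 3 ^ 2 * x 4 ^ 2 + 2 * x 3 ^ 2 * x 6 ^ 2 +
     2 * x 4 ^ 2 * x 5 ^ 2 - 2 * x 5 ^ 2 * x 6 ^ 2) := by
  have h : (fun t => cmDet (Function.update x 7 t)) = fun t =>
      (-2 * x 2 ^ 2) * t ^ 4
      + (-2 * x 2 ^ 4 + 2 * x 2 ^ 2 * x 3 ^ 2 + 2 * x 2 ^ 2 * x 4 ^ 2 + 2 * x 2 ^ 2 * x 5 ^ 2 +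
         2 * x 2 ^ 2 * x 6 ^ 2 - 2 * x 3 ^ 2 * x 4 ^ 2 + 2 * x 3 ^ 2 * x 6 ^ 2 + 2 * x 4 ^ 2 * x
         5 ^ 2 - 2 * x 5 ^ 2 * x 6 ^ 2) * t ^ 2
      + (-2 * x 2 ^ 2 * x 3 ^ 2 * x 5 ^ 2 + 2 * x 2 ^ 2 * x 3 ^ 2 * x 6 ^ 2 + 2 * x 2 ^ 2 * x 4
         ^ 2 * x 5 ^ 2 - 2 * x 2 ^ 2 * x 4 ^ 2 * x 6 ^ 2 - 2 * x 3 ^ 4 * x 6 ^ 2 + 2 * x 3 ^ 2 *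
         x 4 ^ 2 * x 5 ^ 2 + 2 * x 3 ^ 2 * x 4 ^ 2 * x 6 ^ 2 + 2 * x 3 ^ 2 * x 5 ^ 2 * x 6 ^ 2 -
         2 * x 3 ^ 2 * x 6 ^ 4 - 2 * x 4 ^ 4 * x 5 ^ 2 - 2 * x 4 ^ 2 * x 5 ^ 4 + 2 * x 4 ^ 2 * x
         5 ^ 2 * x 6 ^ 2) := by
    funext t
    rw [cmDet_eq]
    simp [Function.update]
    ring
  rw [partialDeriv, h, deriv_biquadratic]
  ring

theorem dziobek_apply (x : Vec) (m : ℝ) : dziobek x m = ![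
    x 2 ^ 2 + x 3 ^ 2 + m * x 4 ^ 2 + x 5 ^ 2 + m * x 6 ^ 2 + m * x 7 ^ 2 - (3 + m),
    cmDet x,
    -(3 + m) + 2 * x 0 * x 2 ^ 3 + x 1 * (3 + m) * x 2 ^ 2 * partialDeriv cmDet 2 x,
    -(3 + m) + 2 * x 0 * x 3 ^ 3 + x 1 * (3 + m) * x 3 ^ 2 * partialDeriv cmDet 3 x,
    -(3 + m) * m + 2 * x 0 * m * x 4 ^ 3 + x 1 * (3 + m) * x 4 ^ 2 * partialDeriv cmDet 4 x,
    -(3 + m) + 2 * x 0 * x 5 ^ 3 + x 1 * (3 + m) * x 5 ^ 2 * partialDeriv cmDet 5 x,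
    -(3 + m) * m + 2 * x 0 * m * x 6 ^ 3 + x 1 * (3 + m) * x 6 ^ 2 * partialDeriv cmDet 6 x,
    -(3 + m) * m + 2 * x 0 * m * x 7 ^ 3 + x 1 * (3 + m) * x 7 ^ 2 * partialDeriv cmDet 7 x] := by
  ext k
  fin_cases k <;>
    simp [dziobek, pairMass, show Finset.Ici (2 : Fin 8) = {2, 3, 4, 5, 6, 7} by decide]
  ring

/-- The configuration with symmetric part `(λ₀, μ, c, a, b, d)` and antisymmetric part `(α, t)`. -/
noncomputable def config (ξ : Fin 9 → ℝ) : Vec :=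
  ![ξ 0, ξ 1, ξ 2, ξ 3 - ξ 6, ξ 4 - ξ 8, ξ 3 + ξ 6, ξ 4 + ξ 8, ξ 5]

/-- The vector with symmetric part `e` and antisymmetric part `(α, t)`. -/
def assemble (e : Fin 6 → ℝ) (α t : ℝ) : Vec :=
  ![e 0, e 1, e 2, e 3 - α, e 4 - t, e 3 + α, e 4 + t, e 5]

/-- The parity splitting. The expressions `even`, `oddAA`, ... contain the variables 6 and 8 only
through `p, q, r`, so they serve both here, where these variables are `α` and `t`, and in `reduced`,
where they are `β` and `T`. -/
theorem dziobek_config (ξ : Fin 9 → ℝ) :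
    dziobek (config ξ) (ξ 7) =
      assemble (fun i => eval ξ (even (var 6 ^ 2) (var 6 * var 8) (var 8 ^ 2) i))
        (ξ 6 * eval ξ (oddAA (var 6 ^ 2) (var 6 * var 8) (var 8 ^ 2))
          + ξ 8 * eval ξ (oddAB (var 6 ^ 2) (var 8 ^ 2)))
        (ξ 6 * eval ξ (oddBA (var 6 ^ 2) (var 8 ^ 2))
          + ξ 8 * eval ξ (oddBB (var 6 ^ 2) (var 6 * var 8) (var 8 ^ 2))) := by
  rw [dziobek_apply]
  simp only [partialDeriv_cmDet_two, partialDeriv_cmDet_three, partialDeriv_cmDet_four,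
    partialDeriv_cmDet_five, partialDeriv_cmDet_six, partialDeriv_cmDet_seven, cmDet_eq]
  ext k
  fin_cases k <;>
  · simp [config, assemble, even, oddAA, oddAB, oddBA, oddBB, cubeA, cubeA', cubeB, cubeB', cmAA,
      cmAB, cmBB, cmA, cmB, cmC, cmD, cmEven, sqA, sqB, totalMass]
    ring

/-- The configuration with parameters `(λ₀, μ, c, a, b, d, β)` and antisymmetric part
`(β t, t)`. -/
noncomputable def toVec (ρ : Fin 9 → ℝ) (t : ℝ) : Vec :=
  ![ρ 0, ρ 1, ρ 2, ρ 3 - ρ 6 * t, ρ 4 - t, ρ 3 + ρ 6 * t, ρ 4 + t, ρ 5]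

/-- Symmetric and antisymmetric part of `toVec ρ t`. -/
noncomputable def toSplit (ρ : Fin 9 → ℝ) (t : ℝ) : Fin 9 → ℝ :=
  ![ρ 0, ρ 1, ρ 2, ρ 3, ρ 4, ρ 5, ρ 6 * t, ρ 7, t]

theorem redMap_symmRow {ρ : Fin 9 → ℝ} {t : ℝ} (h : ρ 8 = t ^ 2) (i : Fin 6) :
    redMap ρ (symmRow i) =
      eval (toSplit ρ t) (even (var 6 ^ 2) (var 6 * var 8) (var 8 ^ 2) i) := by
  fin_cases i <;>
  · simp [-mul_eq_mul_left_iff, -mul_eq_mul_right_iff, -add_right_inj, -add_left_inj,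
      -sub_left_inj, -sub_right_inj, toSplit, redMap, reduced, symmRow, even, cubeA, cubeA', cubeB,
      cubeB', cmAA, cmAB, cmBB, cmA, cmB, cmC, cmD, cmEven, sqA, sqB, totalMass, h]
    try ring

theorem redMap_six {ρ : Fin 9 → ℝ} {t : ℝ} (h : ρ 8 = t ^ 2) :
    redMap ρ 6 = ρ 6 * eval (toSplit ρ t) (oddAA (var 6 ^ 2) (var 6 * var 8) (var 8 ^ 2))
      + eval (toSplit ρ t) (oddAB (var 6 ^ 2) (var 8 ^ 2)) := by
  simp [-mul_eq_mul_left_iff, -mul_eq_mul_right_iff, -add_right_inj, -add_left_inj, toSplit,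
    redMap, reduced, oddAA, oddAB, cubeA, cubeA', cmAA, cmAB, cmA, sqA, sqB, totalMass, h]
  ring

theorem redMap_seven {ρ : Fin 9 → ℝ} {t : ℝ} (h : ρ 8 = t ^ 2) :
    redMap ρ 7 = ρ 6 * eval (toSplit ρ t) (oddBA (var 6 ^ 2) (var 8 ^ 2))
      + eval (toSplit ρ t) (oddBB (var 6 ^ 2) (var 6 * var 8) (var 8 ^ 2)) := by
  simp [-mul_eq_mul_left_iff, -mul_eq_mul_right_iff, -add_right_inj, -add_left_inj, toSplit,
    redMap, reduced, oddBA, oddBB, cubeB, cubeB', cmAB, cmBB, cmB, sqA, sqB, totalMass, h]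
  ring

/-- The link between the two systems. For `t ≠ 0` the Dziobek equations are equivalent to `redMap ρ
= 0`; for `t = 0` they say only that the six symmetric components vanish, and `β` is free. -/
theorem dziobek_toVec {ρ : Fin 9 → ℝ} {t : ℝ} (h : ρ 8 = t ^ 2) :
    dziobek (toVec ρ t) (ρ 7) =
      assemble (fun i => redMap ρ (symmRow i)) (t * redMap ρ 6) (t * redMap ρ 7) := by
  have e := dziobek_config (toSplit ρ t)
  rw [show config (toSplit ρ t) = toVec ρ t from rfl, show toSplit ρ t 7 = ρ 7 from rfl,
    show toSplit ρ t 6 = ρ 6 * t from rfl, show toSplit ρ t 8 = t from rfl] at e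
  simp only [e, redMap_symmRow h, redMap_six h, redMap_seven h]
  congr 1 <;> ring

theorem toVec_eq (ρ : Fin 9 → ℝ) (t : ℝ) :
    toVec ρ t = assemble (fun i => ρ (symmCol i)) (ρ 6 * t) t := rfl

theorem assemble_eq_zero {e : Fin 6 → ℝ} {α t : ℝ} :
    assemble e α t = 0 ↔ e = 0 ∧ α = 0 ∧ t = 0 := by
  constructor
  · intro h
    have h' := fun k => congrFun h k
    have h3 := h' 3
    have h4 := h' 4
    have h5 := h' 5
    have h6 := h' 6
    simp only [assemble, Matrix.cons_val, Pi.zero_apply] at h3 h4 h5 h6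
    refine ⟨?_, by linarith, by linarith⟩
    ext i
    fin_cases i
    · exact h' 0
    · exact h' 1
    · exact h' 2
    · exact (by linarith : e 3 = 0)
    · exact (by linarith : e 4 = 0)
    · exact h' 7
  · rintro ⟨rfl, rfl, rfl⟩
    ext k
    fin_cases k <;> simp [assemble]

theorem assemble_inj {e e' : Fin 6 → ℝ} {α α' t t' : ℝ} :
    assemble e α t = assemble e' α' t' ↔ e = e' ∧ α = α' ∧ t = t' := by
  have h : assemble e α t - assemble e' α' t' = assemble (e - e') (α - α') (t - t') := by
    ext k
    fin_cases k <;> simp [assemble] <;> ring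
  rw [← sub_eq_zero, h, assemble_eq_zero, sub_eq_zero, sub_eq_zero, sub_eq_zero]

theorem exists_assemble_eq (x : Vec) : ∃ e α t, x = assemble e α t := by
  refine ⟨![x 0, x 1, x 2, (x 3 + x 5) / 2, (x 4 + x 6) / 2, x 7], (x 5 - x 3) / 2,
    (x 6 - x 4) / 2, ?_⟩
  ext k
  fin_cases k <;> simp [assemble] <;> ring

theorem assemble_smul (c : ℝ) (e : Fin 6 → ℝ) (α t : ℝ) :
    assemble (c • e) (c * α) (c * t) = c • assemble e α t := by
  ext k
  fin_cases k <;> simp [assemble] <;> ring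

theorem assemble_dotProduct (α t α' t' : ℝ) (e e' : Fin 6 → ℝ) :
    assemble e α t ⬝ᵥ assemble e' α' t' =
      e 0 * e' 0 + e 1 * e' 1 + e 2 * e' 2 + 2 * (e 3 * e' 3) + 2 * (e 4 * e' 4) + e 5 * e' 5
        + 2 * (α * α') + 2 * (t * t') := by
  simp [assemble, dotProduct, Fin.sum_univ_eight]
  ring

theorem hasDerivAt_assemble {e : ℝ → Fin 6 → ℝ} {α t : ℝ → ℝ} {e' : Fin 6 → ℝ} {α' t' s : ℝ}
    (he : ∀ i, HasDerivAt (fun s => e s i) (e' i) s) (hα : HasDerivAt α α' s)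
    (ht : HasDerivAt t t' s) :
    HasDerivAt (fun s => assemble (e s) (α s) (t s)) (assemble e' α' t') s := by
  rw [hasDerivAt_pi]
  intro k
  fin_cases k
  · exact he 0
  · exact he 1
  · exact he 2
  · exact (he 3).sub hα
  · exact (he 4).sub ht
  · exact (he 3).add hα
  · exact (he 4).add ht
  · exact he 5

theorem contDiff_assemble {E : Type*} [NormedAddCommGroup E] [NormedSpace ℝ E] {n : WithTop ℕ∞}
    {e : E → Fin 6 → ℝ} {α t : E → ℝ} {s : E}
    (he : ∀ i, ContDiffAt ℝ n (fun s => e s i) s) (hα : ContDiffAt ℝ n α s)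
    (ht : ContDiffAt ℝ n t s) :
    ContDiffAt ℝ n (fun s => assemble (e s) (α s) (t s)) s := by
  rw [contDiffAt_pi]
  intro k
  fin_cases k
  · exact he 0
  · exact he 1
  · exact he 2
  · exact (he 3).sub hα
  · exact (he 4).sub ht
  · exact (he 3).add hα
  · exact (he 4).add ht
  · exact he 5

/-- The symmetric and antisymmetric parts of a configuration, and the mass. -/
noncomputable def split (x : Vec) (m : ℝ) : Fin 9 → ℝ :=
  ![x 0, x 1, x 2, (x 3 + x 5) / 2, (x 4 + x 6) / 2, x 7, (x 5 - x 3) / 2, m, (x 6 - x 4) / 2]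

theorem config_split (x : Vec) (m : ℝ) : config (split x m) = x := by
  ext k
  fin_cases k <;> simp [config, split] <;> ring

theorem contDiff_split : ContDiff ℝ ω (fun p : Vec × ℝ => split p.1 p.2) := by
  rw [contDiff_pi]
  intro i
  have h : ∀ k, ContDiff ℝ ω (fun p : Vec × ℝ => p.1 k) := fun k =>
    (contDiff_apply ℝ ℝ k).comp contDiff_fst
  fin_cases i
  · exact h 0
  · exact h 1
  · exact h 2
  · exact ((h 3).add (h 5)).div_const 2
  · exact ((h 4).add (h 6)).div_const 2
  · exact h 7
  · exact ((h 5).sub (h 3)).div_const 2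
  · exact contDiff_snd
  · exact ((h 6).sub (h 4)).div_const 2

/-- The Dziobek map is defined through `deriv`, so its smoothness is taken from the polynomial
formula in the coordinates `split`. -/
theorem contDiff_dziobek : ContDiff ℝ ω (fun p : Vec × ℝ => dziobek p.1 p.2) := by
  have e : (fun p : Vec × ℝ => dziobek p.1 p.2) =
      fun p : Vec × ℝ => dziobek (config (split p.1 p.2)) (split p.1 p.2 7) := by
    funext p
    rw [config_split]
    rfl
  have h : ∀ f : PolyExpr 9, ContDiff ℝ ω (fun p : Vec × ℝ => eval (split p.1 p.2) f) :=
    fun f => (contDiff_eval f).comp contDiff_split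
  have hv : ∀ i, ContDiff ℝ ω (fun p : Vec × ℝ => split p.1 p.2 i) := fun i => h (var i)
  rw [e]
  simp only [dziobek_config]
  rw [contDiff_iff_contDiffAt]
  intro p
  exact contDiff_assemble (fun i => (h _).contDiffAt)
    (((hv 6).mul (h _)).add ((hv 8).mul (h _))).contDiffAt
    (((hv 6).mul (h _)).add ((hv 8).mul (h _))).contDiffAt

theorem contDiff_dziobek_left (m : ℝ) : ContDiff ℝ ω (fun z => dziobek z m) :=
  contDiff_dziobek.comp₂ contDiff_id contDiff_const

theorem differentiable_dziobek_left (m : ℝ) : Differentiable ℝ (fun z => dziobek z m) :=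
  (contDiff_dziobek_left m).differentiable (by simp)

theorem jacobian_mulVec (x : Vec) (m : ℝ) (n : Vec) :
    jacobian x m *ᵥ n = fderiv ℝ (fun z => dziobek z m) x n := by
  rw [jacobian, ← Matrix.toLin'_apply, Matrix.toLin'_toMatrix']
  rfl

/-- The derivative of the Dziobek map in terms of the reduced system. -/
theorem fderiv_dziobek_toVec {ρ σ : Fin 9 → ℝ} {t t' : ℝ} (h : ρ 8 = t ^ 2) (h7 : σ 7 = 0)
    (h8 : σ 8 = 2 * t * t') :
    fderiv ℝ (fun z => dziobek z (ρ 7)) (toVec ρ t)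
        (assemble (fun i => σ (symmCol i)) (σ 6 * t + ρ 6 * t') t') =
      assemble (fun i => (redJac ρ *ᵥ σ) (symmRow i))
        (t' * redMap ρ 6 + t * (redJac ρ *ᵥ σ) 6) (t' * redMap ρ 7 + t * (redJac ρ *ᵥ σ) 7) := by
  -- The curve has direction `σ`, but its last coordinate is exactly the square of `t + s t'`, so
  -- that `dziobek_toVec` holds along all of it. The condition `σ 7 = 0` keeps the mass fixed.
  set γ : ℝ → Fin 9 → ℝ := fun s => Function.update (fun i => ρ i + s * σ i) 8 ((t + s * t') ^ 2)
    with hγ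
  have lin : ∀ a b : ℝ, HasDerivAt (fun s : ℝ => a + s * b) b 0 := fun a b => by
    simpa using ((hasDerivAt_id (0 : ℝ)).mul_const b).const_add a
  have hγi : ∀ i, i ≠ 8 → (fun s => γ s i) = fun s => ρ i + s * σ i := fun i hi => by
    funext s
    simp [hγ, hi]
  have hγ0 : γ 0 = ρ := by
    ext i
    by_cases hi : i = 8
    · subst hi; simp [hγ, h]
    · simp [hγ, hi]
  have hγ' : ∀ i, HasDerivAt (fun s => γ s i) (σ i) 0 := by
    intro i
    by_cases hi : i = 8
    · subst hi
      have : (fun s => γ s 8) = fun s => (t + s * t') ^ 2 := by funext s; simp [hγ]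
      rw [this, h8]
      simpa using (lin t t').fun_pow 2
    · rw [hγi i hi]
      exact lin _ _
  have hred : ∀ i, HasDerivAt (fun s => redMap (γ s) i) ((redJac ρ *ᵥ σ) i) 0 := by
    intro i
    have := hasDerivAt_eval (reduced i) hγ'
    rw [hγ0] at this
    exact this
  have h1 : HasDerivAt (fun s => toVec (γ s) (t + s * t'))
      (assemble (fun i => σ (symmCol i)) (σ 6 * t + ρ 6 * t') t') 0 := by
    refine hasDerivAt_assemble (e := fun s i => γ s (symmCol i)) (fun i => hγ' _) ?_ (lin t t')
    have := (hγ' 6).fun_mul (lin t t')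
    simpa [hγ0] using this
  have h2 : HasDerivAt (fun s => dziobek (toVec (γ s) (t + s * t')) (ρ 7))
      (assemble (fun i => (redJac ρ *ᵥ σ) (symmRow i))
        (t' * redMap ρ 6 + t * (redJac ρ *ᵥ σ) 6) (t' * redMap ρ 7 + t * (redJac ρ *ᵥ σ) 7)) 0 := by
    have e : (fun s => dziobek (toVec (γ s) (t + s * t')) (ρ 7)) = fun s =>
        assemble (fun i => redMap (γ s) (symmRow i)) ((t + s * t') * redMap (γ s) 6)
          ((t + s * t') * redMap (γ s) 7) := by
      funext s
      have h7' : γ s 7 = ρ 7 := by simp [hγ, h7]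
      rw [← h7']
      exact dziobek_toVec (by simp [hγ])
    rw [e]
    refine hasDerivAt_assemble (fun i => hred _) ?_ ?_
    · simpa [hγ0] using (lin t t').fun_mul (hred 6)
    · simpa [hγ0] using (lin t t').fun_mul (hred 7)
  have h3 := ((differentiable_dziobek_left (ρ 7)) (toVec (γ 0) (t + 0 * t'))).hasFDerivAt
  have h4 := h3.comp_hasDerivAt 0 h1
  have h5 := h4.unique h2
  simpa [hγ0] using h5

/-! ### Solutions and singular solutions near the bifurcation -/

/-- Neighbourhood of the bifurcating configuration. -/
noncomputable def vecBox : Set Vec :=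
  Metric.ball (toVec (fun i => (boxCenter i : ℝ)) 0) configRadius

/-- Neighbourhood of the bifurcation value of the mass. -/
noncomputable def massBox : Set ℝ := Metric.ball (boxCenter 7 : ℝ) configRadius

theorem configRadius_pos : (0 : ℝ) < configRadius := by norm_num [configRadius]

theorem mem_vecBox {x : Vec} : x ∈ vecBox ↔
    ∀ k, |x k - toVec (fun i => (boxCenter i : ℝ)) 0 k| < configRadius :=
  dist_pi_lt_iff configRadius_pos

theorem abs_split_sub_le {x : Vec} {m : ℝ} (hx : x ∈ vecBox) (hm : m ∈ massBox) (i : Fin 9) :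
    |split x m i - configCenter i| ≤ configRadius := by
  have h := fun k => abs_lt.1 (mem_vecBox.1 hx k)
  have h3 := h 3
  have h4 := h 4
  have h5 := h 5
  have h6 := h 6
  simp only [toVec, Matrix.cons_val, mul_zero, sub_zero, add_zero] at h3 h4 h5 h6
  have hz : (boxCenter 8 : ℝ) = 0 := by rw [show boxCenter 8 = 0 from rfl, Rat.cast_zero]
  fin_cases i
  · exact (mem_vecBox.1 hx 0).le
  · exact (mem_vecBox.1 hx 1).le
  · exact (mem_vecBox.1 hx 2).le
  · change |(x 3 + x 5) / 2 - (boxCenter 3 : ℝ)| ≤ _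
    exact abs_le.2 ⟨by linarith [h3.1, h5.1], by linarith [h3.2, h5.2]⟩
  · change |(x 4 + x 6) / 2 - (boxCenter 4 : ℝ)| ≤ _
    exact abs_le.2 ⟨by linarith [h4.1, h6.1], by linarith [h4.2, h6.2]⟩
  · exact (mem_vecBox.1 hx 7).le
  · change |(x 5 - x 3) / 2 - ((0 : ℚ) : ℝ)| ≤ _
    rw [Rat.cast_zero]
    exact abs_le.2 ⟨by linarith [h3.2, h5.1], by linarith [h3.1, h5.2]⟩
  · exact (Metric.mem_ball.1 hm).le
  · change |(x 6 - x 4) / 2 - (boxCenter 8 : ℝ)| ≤ _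
    rw [hz]
    exact abs_le.2 ⟨by linarith [h4.2, h6.1], by linarith [h4.1, h6.2]⟩

theorem oddAA_ge {ξ : Fin 9 → ℝ} (h : ∀ i, |ξ i - configCenter i| ≤ configRadius) :
    12 ≤ eval ξ (oddAA (var 6 ^ 2) (var 6 * var 8) (var 8 ^ 2)) := by
  have h1 := abs_eval_sub_le (r := fun _ => configRadius) h
    (oddAA (var 6 ^ 2) (var 6 * var 8) (var 8 ^ 2))
  have h2 := (Rat.cast_le (K := ℝ)).2 ball_oddAA
  push_cast at h2
  linarith [(abs_le.1 h1).1]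

theorem abs_oddAB_le {ξ : Fin 9 → ℝ} (h : ∀ i, |ξ i - configCenter i| ≤ configRadius) :
    |(boxCenter 6 : ℝ) * eval ξ (oddAA (var 6 ^ 2) (var 6 * var 8) (var 8 ^ 2))
      + eval ξ (oddAB (var 6 ^ 2) (var 8 ^ 2))| ≤ boxRadius := by
  have h1 := abs_eval_sub_le (r := fun _ => configRadius) h
    (const (boxCenter 6) * oddAA (var 6 ^ 2) (var 6 * var 8) (var 8 ^ 2)
          + oddAB (var 6 ^ 2) (var 8 ^ 2))
  have h2 := (Rat.cast_le (K := ℝ)).2 ball_oddAB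
  push_cast at h2
  rw [eval_add, eval_mul, eval_const] at h1
  have h3 := abs_sub_abs_le_abs_sub ((boxCenter 6 : ℝ) *
      eval ξ (oddAA (var 6 ^ 2) (var 6 * var 8) (var 8 ^ 2))
      + eval ξ (oddAB (var 6 ^ 2) (var 8 ^ 2))) (ball configCenter (fun _ => configRadius)
        (const (boxCenter 6) * oddAA (var 6 ^ 2) (var 6 * var 8) (var 8 ^ 2)
          + oddAB (var 6 ^ 2) (var 8 ^ 2))).1
  linarith

/-- With `A` and `B` the values of `oddAA` and `oddAB` and `β₀` the central value, `β₀ A + B = (β₀ -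
β) A`. The left side is at most `boxRadius` and `A ≥ 12`. -/
theorem abs_sub_boxCenter_le {ξ : Fin 9 → ℝ} (h : ∀ i, |ξ i - configCenter i| ≤ configRadius)
    {β : ℝ} (hβ : β * eval ξ (oddAA (var 6 ^ 2) (var 6 * var 8) (var 8 ^ 2))
      + eval ξ (oddAB (var 6 ^ 2) (var 8 ^ 2)) = 0) : |β - boxCenter 6| ≤ boxRadius := by
  have h1 := oddAA_ge h
  have h2 := abs_oddAB_le h
  set A := eval ξ (oddAA (var 6 ^ 2) (var 6 * var 8) (var 8 ^ 2))
  set B := eval ξ (oddAB (var 6 ^ 2) (var 8 ^ 2))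
  have h3 : (boxCenter 6 : ℝ) * A + B = -((β - boxCenter 6) * A) := by linear_combination hβ
  rw [h3, abs_neg, abs_mul, abs_of_pos (by linarith : 0 < A)] at h2
  nlinarith [abs_nonneg (β - boxCenter 6)]

theorem mem_parBox_of_split {ξ ρ : Fin 9 → ℝ}
    (h : ∀ i, |ξ i - configCenter i| ≤ configRadius)
    (h1 : ∀ i : Fin 9, i ≠ 6 → i ≠ 8 → ρ i = ξ i) (h6 : |ρ 6 - boxCenter 6| ≤ boxRadius)
    (h8 : ρ 8 = ξ 8 ^ 2) : ρ ∈ parBox := by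
  have hr : (configRadius : ℝ) ≤ boxRadius := by norm_num [configRadius, boxRadius]
  refine mem_parBox.2 fun i => ?_
  by_cases hi : i = 6
  · rw [hi]; exact h6
  by_cases hi' : i = 8
  · subst hi'
    have h0 := h 8
    have e : (configCenter 8 : ℝ) = 0 := by
      rw [show configCenter 8 = 0 from rfl, Rat.cast_zero]
    have e' : (boxCenter 8 : ℝ) = 0 := by rw [show boxCenter 8 = 0 from rfl, Rat.cast_zero]
    rw [e, sub_zero] at h0
    rw [h8, e', sub_zero, abs_pow]
    have : (configRadius : ℝ) ≤ 1 := by norm_num [configRadius]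
    nlinarith [abs_nonneg (ξ 8)]
  · rw [h1 i hi hi']
    have h0 := h i
    rw [configCenter, Function.update_of_ne hi] at h0
    exact h0.trans hr

/-- Every solution near the bifurcation comes from a solution of the reduced system, or, if it is
symmetric, from a solution of its symmetric components. -/
theorem exists_param {x : Vec} {m : ℝ} (hx : x ∈ vecBox) (hm : m ∈ massBox)
    (h : dziobek x m = 0) :
    ∃ ρ ∈ parBox, ρ 7 = m ∧ ρ 8 = ((x 6 - x 4) / 2) ^ 2 ∧ x = toVec ρ ((x 6 - x 4) / 2) ∧
      (∀ i, redMap ρ (symmRow i) = 0) ∧ ((x 6 - x 4) / 2 ≠ 0 → redMap ρ = 0) := by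
  have hξ := abs_split_sub_le hx hm
  set ξ := split x m with hξd
  set t := (x 6 - x 4) / 2 with ht
  have hcfg : config ξ = x := config_split x m
  have e := dziobek_config ξ
  rw [hcfg, show ξ 7 = m from rfl, h, eq_comm, assemble_eq_zero] at e
  obtain ⟨-, e1, -⟩ := e
  have hA := oddAA_ge hξ
  have hAB := @abs_sub_boxCenter_le ξ hξ
  rw [show ξ 8 = t from rfl] at e1
  set A := eval ξ (oddAA (var 6 ^ 2) (var 6 * var 8) (var 8 ^ 2))
  set B := eval ξ (oddAB (var 6 ^ 2) (var 8 ^ 2))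
  -- If `t = 0`, the antisymmetric equation forces `α = 0` and any `β` serves, for instance the
  -- central one. Otherwise `β = α / t` is the root that was just enclosed.
  obtain ⟨β, hβ, hβt⟩ : ∃ β : ℝ, |β - boxCenter 6| ≤ boxRadius ∧ ξ 6 = β * t := by
    by_cases h0 : t = 0
    · refine ⟨boxCenter 6, by simpa using boxRadius_pos.le, ?_⟩
      rw [h0, zero_mul, add_zero] at e1
      rw [h0, mul_zero]
      exact (mul_eq_zero.1 e1).resolve_right (by linarith)
    · refine ⟨ξ 6 / t, hAB ?_, (div_mul_cancel₀ _ h0).symm⟩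
      field_simp
      linarith
  set ρ : Fin 9 → ℝ := Function.update (Function.update ξ 6 β) 8 (t ^ 2) with hρ
  have hne : ∀ i : Fin 9, i ≠ 6 → i ≠ 8 → ρ i = ξ i := fun i h6 h8 => by simp [hρ, h6, h8]
  have h6 : ρ 6 = β := by simp [hρ]
  have h8 : ρ 8 = t ^ 2 := by simp [hρ]
  have hx' : x = toVec ρ t := by
    rw [← hcfg]
    simp only [config, toVec, h6, hβt, show ξ 8 = t from rfl]
    rw [hne 0 (by decide) (by decide), hne 1 (by decide) (by decide),
      hne 2 (by decide) (by decide), hne 3 (by decide) (by decide),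
      hne 4 (by decide) (by decide), hne 5 (by decide) (by decide)]
  have h7 : ρ 7 = m := hne 7 (by decide) (by decide)
  have hz := dziobek_toVec h8
  rw [← hx', h7, h, eq_comm, assemble_eq_zero] at hz
  obtain ⟨z1, z2, z3⟩ := hz
  refine ⟨ρ, mem_parBox_of_split hξ hne (by rw [h6]; exact hβ) h8, h7, h8, hx',
    fun i => congrFun z1 i, fun ht0 => ?_⟩
  ext i
  refine Fin.lastCases ?_ (fun i => Fin.lastCases ?_ (fun i => ?_) i) i
  · exact (mul_eq_zero.1 z3).resolve_left ht0
  · exact (mul_eq_zero.1 z2).resolve_left ht0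
  · exact congrFun z1 i

/-- Symmetric tangent vectors. -/
def symmExt (e : Fin 6 → ℝ) : Fin 9 → ℝ := ![e 0, e 1, e 2, e 3, e 4, e 5, 0, 0, 0]

theorem mulVec_symmExt (J : Matrix (Fin 8) (Fin 9) ℝ) (e : Fin 6 → ℝ) :
    (fun i => (J *ᵥ symmExt e) (symmRow i)) = J.submatrix symmRow symmCol *ᵥ e := by
  ext i
  simp only [Matrix.mulVec, dotProduct, Fin.sum_univ_castSucc, symmExt]
  simp [symmCol, symmRow]

theorem toVec_update_zero (ρ : Fin 9 → ℝ) (β : ℝ) :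
    toVec (Function.update ρ 6 β) 0 = toVec ρ 0 := by
  simp [toVec]

theorem redMap_update_six {ρ : Fin 9 → ℝ} (h : ρ 8 = 0) (β : ℝ) :
    redMap (Function.update ρ 6 β) 6 =
      β * eval (toSplit ρ 0) (oddAA (var 6 ^ 2) (var 6 * var 8) (var 8 ^ 2))
      + eval (toSplit ρ 0) (oddAB (var 6 ^ 2) (var 8 ^ 2)) := by
  rw [redMap_six (t := 0) (by simpa using h)]
  simp [toSplit]

theorem redMap_update_seven {ρ : Fin 9 → ℝ} (h : ρ 8 = 0) (β : ℝ) :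
    redMap (Function.update ρ 6 β) 7 =
      β * eval (toSplit ρ 0) (oddBA (var 6 ^ 2) (var 8 ^ 2))
      + eval (toSplit ρ 0) (oddBB (var 6 ^ 2) (var 6 * var 8) (var 8 ^ 2)) := by
  rw [redMap_seven (t := 0) (by simpa using h)]
  simp [toSplit]

theorem redMap_update_symmRow {ρ : Fin 9 → ℝ} (h : ρ 8 = 0) (β : ℝ) (i : Fin 6) :
    redMap (Function.update ρ 6 β) (symmRow i) = redMap ρ (symmRow i) := by
  rw [redMap_symmRow (t := 0) (by simpa using h), redMap_symmRow (t := 0) (by simpa using h)]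
  simp [toSplit]

/-- The derivative of the Dziobek map at a symmetric configuration. -/
theorem fderiv_dziobek_symm {ρ : Fin 9 → ℝ} (h : ρ 8 = 0) (e : Fin 6 → ℝ) (α t : ℝ) :
    fderiv ℝ (fun z => dziobek z (ρ 7)) (toVec ρ 0) (assemble e α t) =
      assemble ((redJac ρ).submatrix symmRow symmCol *ᵥ e)
        (α * eval (toSplit ρ 0) (oddAA (var 6 ^ 2) (var 6 * var 8) (var 8 ^ 2))
          + t * eval (toSplit ρ 0) (oddAB (var 6 ^ 2) (var 8 ^ 2)))
        (α * eval (toSplit ρ 0) (oddBA (var 6 ^ 2) (var 8 ^ 2))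
          + t * eval (toSplit ρ 0) (oddBB (var 6 ^ 2) (var 6 * var 8) (var 8 ^ 2))) := by
  set L := fderiv ℝ (fun z => dziobek z (ρ 7)) (toVec ρ 0)
  have h1 : L (assemble e 0 0) = assemble ((redJac ρ).submatrix symmRow symmCol *ᵥ e) 0 0 := by
    have := fderiv_dziobek_toVec (ρ := ρ) (σ := symmExt e) (t := 0) (t' := 0) (by simpa using h)
      rfl (by simp [symmExt])
    rw [mulVec_symmExt] at this
    simp only [mul_zero, zero_mul, add_zero] at this
    exact this
  -- At `t = 0` the configuration does not depend on `β`, so the derivative formula can be used with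
  -- every `β`. The values 0 and 1 span the antisymmetric directions.
  have h2 : ∀ β, L (assemble 0 β 1) = assemble 0
      (β * eval (toSplit ρ 0) (oddAA (var 6 ^ 2) (var 6 * var 8) (var 8 ^ 2))
          + eval (toSplit ρ 0) (oddAB (var 6 ^ 2) (var 8 ^ 2)))
      (β * eval (toSplit ρ 0) (oddBA (var 6 ^ 2) (var 8 ^ 2))
          + eval (toSplit ρ 0) (oddBB (var 6 ^ 2) (var 6 * var 8) (var 8 ^ 2))) := by
    intro β
    have := fderiv_dziobek_toVec (ρ := Function.update ρ 6 β) (σ := 0) (t := 0) (t' := 1)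
      (by simpa using h) rfl (by simp)
    rw [redMap_update_six h, redMap_update_seven h, toVec_update_zero] at this
    simp only [Matrix.mulVec_zero, Pi.zero_apply, mul_zero, add_zero, zero_add, mul_one,
      one_mul, Function.update_self] at this
    exact this
  have h3 : assemble e α t =
      assemble e 0 0 + (t • assemble 0 0 1 + α • (assemble 0 1 1 - assemble 0 0 1)) := by
    ext k
    fin_cases k <;> simp [assemble, sub_eq_add_neg]
  rw [h3, map_add, map_add, map_smul, map_smul, map_sub, h1, h2, h2]
  ext k
  fin_cases k <;> simp [assemble] <;> ring

theorem abs_toSplit_sub_le {ρ : Fin 9 → ℝ} (hx : toVec ρ 0 ∈ vecBox)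
    (hm : ρ 7 ∈ massBox) (i : Fin 9) : |toSplit ρ 0 i - configCenter i| ≤ configRadius := by
  have := abs_split_sub_le hx hm i
  convert this using 3
  fin_cases i <;> simp [toSplit, split, toVec]

/-- A singular solution near the bifurcation comes from a zero of the reduced system with
`T = 0`. -/
theorem IsSingularSolution.exists_param {x : Vec} {m : ℝ} (hx : x ∈ vecBox) (hm : m ∈ massBox)
    (h : IsSingularSolution x m) :
    ∃ ρ ∈ parBox, ρ 7 = m ∧ ρ 8 = 0 ∧ x = toVec ρ 0 ∧ redMap ρ = 0 := by
  obtain ⟨ρ, hρ, h7, h8, hx', hs, hred⟩ := FourBody.exists_param hx hm h.1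
  obtain ⟨n, hn, hJn⟩ := Matrix.exists_mulVec_eq_zero_iff.2 h.2
  obtain ⟨e, α, t', rfl⟩ := exists_assemble_eq n
  rw [jacobian_mulVec] at hJn
  set t := (x 6 - x 4) / 2
  -- For a symmetric solution, injectivity of the symmetric block makes the kernel vector
  -- antisymmetric. Its component `t'` is nonzero because `oddAA` is, and `β = α / t'` solves the
  -- two divided equations at `T = 0`.
  by_cases ht : t = 0
  · rw [ht] at hx' h8
    have h8' : ρ 8 = 0 := by simpa using h8
    rw [hx', ← h7, fderiv_dziobek_symm h8', assemble_eq_zero] at hJn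
    obtain ⟨j1, j2, j3⟩ := hJn
    have he : e = 0 := nearJac_symm_injective (nearJac_redJac hρ) j1
    have hξ := abs_toSplit_sub_le (hx' ▸ hx) (h7 ▸ hm)
    have hA := oddAA_ge hξ
    have ht' : t' ≠ 0 := by
      rintro rfl
      rw [zero_mul, add_zero] at j2
      have := (mul_eq_zero.1 j2).resolve_right (by linarith)
      exact hn (assemble_eq_zero.2 ⟨he, this, rfl⟩)
    have b6 : α / t' * eval (toSplit ρ 0) (oddAA (var 6 ^ 2) (var 6 * var 8) (var 8 ^ 2))
        + eval (toSplit ρ 0) (oddAB (var 6 ^ 2) (var 8 ^ 2)) = 0 := by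
      field_simp
      linarith
    have b7 : α / t' * eval (toSplit ρ 0) (oddBA (var 6 ^ 2) (var 8 ^ 2))
        + eval (toSplit ρ 0) (oddBB (var 6 ^ 2) (var 6 * var 8) (var 8 ^ 2)) = 0 := by
      field_simp
      linarith
    refine ⟨Function.update ρ 6 (α / t'), ?_, by simpa using h7, by simpa using h8',
      by rw [toVec_update_zero]; exact hx', ?_⟩
    · refine mem_parBox.2 fun i => ?_
      by_cases hi : i = 6
      · subst hi
        rw [Function.update_self]
        exact abs_sub_boxCenter_le hξ b6
      · rw [Function.update_of_ne hi]
        exact mem_parBox.1 hρ i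
    · ext i
      refine Fin.lastCases ?_ (fun i => Fin.lastCases ?_ (fun i => ?_) i) i
      · exact (redMap_update_seven h8' _).trans b7
      · exact (redMap_update_six h8' _).trans b6
      · exact (redMap_update_symmRow h8' _ i).trans (hs i)
  -- For `t ≠ 0` the kernel vector lifts to a kernel vector `σ` of the reduced Jacobian with
  -- vanishing `m`-component, since the derivative is taken at fixed mass. Such a vector is zero.
  · exfalso
    have hz := hred ht
    set σ : Fin 9 → ℝ := ![e 0, e 1, e 2, e 3, e 4, e 5, (α - ρ 6 * t') / t, 0, 2 * t * t'] with hσ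
    have h0 := fderiv_dziobek_toVec (ρ := ρ) (σ := σ) (t' := t') h8 rfl rfl
    have h1 : assemble (fun i => σ (symmCol i)) (σ 6 * t + ρ 6 * t') t' = assemble e α t' := by
      congr 1
      · ext i
        fin_cases i <;> rfl
      · change (α - ρ 6 * t') / t * t + ρ 6 * t' = α
        field_simp
        ring
    rw [h1, ← hx', h7, hJn, hz, eq_comm, assemble_eq_zero] at h0
    simp only [Pi.zero_apply, mul_zero, zero_add] at h0
    obtain ⟨z1, z2, z3⟩ := h0
    have hker : redJac ρ *ᵥ σ = 0 := by
      ext i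
      refine Fin.lastCases ?_ (fun i => Fin.lastCases ?_ (fun i => ?_) i) i
      · exact (mul_eq_zero.1 z3).resolve_left ht
      · exact (mul_eq_zero.1 z2).resolve_left ht
      · exact congrFun z1 i
    have hσ0 := nearJac_kernel_eq_zero (nearJac_redJac hρ) hker (Or.inl rfl)
    apply hn
    rw [← h1, assemble_eq_zero]
    have ht' : t' = 0 := by
      have : 2 * t * t' = 0 := congrFun hσ0 8
      simpa [ht] using this
    refine ⟨?_, ?_, ht'⟩
    · ext i
      exact congrFun hσ0 _
    · rw [hσ0, ht']; simp

end FourBody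

/-! ### Kernel vectors and the pitchfork conditions -/

theorem PolyExpr.hasDerivAt_eval_update {n : ℕ} (e : PolyExpr n) (ρ : Fin n → ℝ) (i : Fin n)
    (s : ℝ) : HasDerivAt (fun s => eval (Function.update ρ i s) e)
      (eval (Function.update ρ i s) (D i e)) s := by
  have h := hasDerivAt_eval e (γ := fun s => Function.update ρ i s) (γ' := Pi.single i 1) (s := s)
    (hasDerivAt_pi.1 (hasDerivAt_update ρ i s))
  simpa [Pi.single_apply] using h

/-- On the diagonal, higher derivatives are ordinary derivatives along a straight line. -/
theorem dotProduct_iteratedFDeriv {k l : ℕ} {f : (Fin k → ℝ) → Fin l → ℝ} (hf : ContDiff ℝ ω f)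
    (n : ℕ) (x v : Fin k → ℝ) (w : Fin l → ℝ) :
    w ⬝ᵥ iteratedFDeriv ℝ n f x (fun _ => v) =
      iteratedDeriv n (fun t : ℝ => w ⬝ᵥ f (x + t • v)) 0 := by
  set L : (Fin l → ℝ) →L[ℝ] ℝ := ∑ i, w i • ContinuousLinearMap.proj i with hL
  have hLw : ∀ z, L z = w ⬝ᵥ z := fun z => by simp [hL, dotProduct]
  set g : ℝ →L[ℝ] (Fin k → ℝ) := ContinuousLinearMap.toSpanSingleton ℝ v
  have hf' : ContDiff ℝ ω (fun z => f (x + z)) := hf.comp (contDiff_const.add contDiff_id)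
  have e : (fun t : ℝ => w ⬝ᵥ f (x + t • v)) = L ∘ ((fun z => f (x + z)) ∘ g) := by
    funext t
    rw [Function.comp_apply, hLw]
    rfl
  rw [e, iteratedDeriv_eq_iteratedFDeriv,
    L.iteratedFDeriv_comp_left (n := ω) (hf'.comp g.contDiff).contDiffAt le_top,
    g.iteratedFDeriv_comp_right (n := ω) hf' 0 le_top]
  simp [hLw, iteratedFDeriv_comp_add_left, g]

/-- `t g(t²) = g(0) t + g'(0) t³ + ...` has no quadratic term. The formula is stated for all `t` so
that it can be differentiated once more. -/
theorem iteratedDeriv_two_mul_comp_sq {g g₁ g₂ : ℝ → ℝ} (h : ∀ s, HasDerivAt g (g₁ s) s)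
    (h₁ : ∀ s, HasDerivAt g₁ (g₂ s) s) :
    iteratedDeriv 2 (fun t => t * g (t ^ 2)) =
      fun t => 6 * t * g₁ (t ^ 2) + 4 * t ^ 3 * g₂ (t ^ 2) := by
  have hsq : ∀ t : ℝ, HasDerivAt (fun t : ℝ => t ^ 2) (2 * t) t := fun t => by
    simpa using hasDerivAt_pow 2 t
  have e1 : deriv (fun t => t * g (t ^ 2)) = fun t => g (t ^ 2) + 2 * t ^ 2 * g₁ (t ^ 2) := by
    funext t
    refine (((hasDerivAt_id t).fun_mul ((h (t ^ 2)).comp t (hsq t))).congr_deriv ?_).deriv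
    simp only [id_eq, Function.comp_apply]
    ring
  rw [iteratedDeriv_succ, iteratedDeriv_one, e1]
  funext t
  refine ((((h (t ^ 2)).comp t (hsq t)).fun_add (((hsq t).const_mul 2).fun_mul
    ((h₁ (t ^ 2)).comp t (hsq t)))).congr_deriv ?_).deriv
  simp only [Function.comp_apply]
  ring

theorem iteratedDeriv_three_mul_comp_sq {g g₁ g₂ g₃ : ℝ → ℝ} (h : ∀ s, HasDerivAt g (g₁ s) s)
    (h₁ : ∀ s, HasDerivAt g₁ (g₂ s) s) (h₂ : ∀ s, HasDerivAt g₂ (g₃ s) s) :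
    iteratedDeriv 3 (fun t => t * g (t ^ 2)) 0 = 6 * g₁ 0 := by
  have hsq : ∀ t : ℝ, HasDerivAt (fun t : ℝ => t ^ 2) (2 * t) t := fun t => by
    simpa using hasDerivAt_pow 2 t
  rw [iteratedDeriv_succ, iteratedDeriv_two_mul_comp_sq h h₁]
  refine ((((hasDerivAt_id (0 : ℝ)).const_mul 6).fun_mul ((h₁ (0 ^ 2)).comp 0 (hsq 0))).fun_add
    ((((hasDerivAt_pow 3 (0 : ℝ))).const_mul 4).fun_mul ((h₂ (0 ^ 2)).comp 0 (hsq 0)))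
      |>.congr_deriv ?_).deriv
  simp

namespace FourBody

open PolyExpr

theorem Phi_g3_assemble (e : Fin 6 → ℝ) (α t : ℝ) :
    Phi .g3 (assemble e α t) = assemble e (-α) (-t) := by
  ext k
  fin_cases k <;> simp [Phi, assemble, sub_eq_add_neg]

/-- Coefficient in the left kernel vector. -/
noncomputable def leftCoeff (ρ : Fin 9 → ℝ) : ℝ :=
  -eval (toSplit ρ 0) (oddBA (var 6 ^ 2) (var 8 ^ 2))
    / eval (toSplit ρ 0) (oddAA (var 6 ^ 2) (var 6 * var 8) (var 8 ^ 2))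

/-- At `T = 0` component 6 of the reduced system is affine in `β` with this slope, so the bounds of
the reduced Jacobian apply to it. -/
theorem oddAA_eq_redJac {ρ : Fin 9 → ℝ} (h : ρ 8 = 0) :
    eval (toSplit ρ 0) (oddAA (var 6 ^ 2) (var 6 * var 8) (var 8 ^ 2)) = redJac ρ 6 6 := by
  have h1 := hasDerivAt_eval_update (reduced 6) ρ 6 (ρ 6)
  have e : (fun s => eval (Function.update ρ 6 s) (reduced 6)) = fun s =>
      s * eval (toSplit ρ 0) (oddAA (var 6 ^ 2) (var 6 * var 8) (var 8 ^ 2))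
      + eval (toSplit ρ 0) (oddAB (var 6 ^ 2) (var 8 ^ 2)) := funext (redMap_update_six h)
  rw [e, Function.update_eq_self] at h1
  have := (((hasDerivAt_id (ρ 6)).mul_const _).add_const _).unique h1
  rw [one_mul] at this
  exact this

theorem oddBA_eq_redJac {ρ : Fin 9 → ℝ} (h : ρ 8 = 0) :
    eval (toSplit ρ 0) (oddBA (var 6 ^ 2) (var 8 ^ 2)) = redJac ρ 7 6 := by
  have h1 := hasDerivAt_eval_update (reduced 7) ρ 6 (ρ 6)
  have e : (fun s => eval (Function.update ρ 6 s) (reduced 7)) = fun s =>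
      s * eval (toSplit ρ 0) (oddBA (var 6 ^ 2) (var 8 ^ 2))
      + eval (toSplit ρ 0) (oddBB (var 6 ^ 2) (var 6 * var 8) (var 8 ^ 2)) :=
    funext (redMap_update_seven h)
  rw [e, Function.update_eq_self] at h1
  have := (((hasDerivAt_id (ρ 6)).mul_const _).add_const _).unique h1
  rw [one_mul] at this
  exact this

theorem redJac_bounds {ρ : Fin 9 → ℝ} (hρ : ρ ∈ parBox) :
    |redJac ρ 6 6 - 12.7555| ≤ 1 / 10 ^ 4 ∧ |redJac ρ 7 6 - 13.244| ≤ 1 / 10 ^ 4 ∧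
    |redJac ρ 6 7 - 0.7083| ≤ 1 / 10 ^ 4 ∧ |redJac ρ 7 7 - 18.2077| ≤ 1 / 10 ^ 4 ∧
    |redJac ρ 6 8 - 58.5214| ≤ 1 / 10 ^ 4 ∧ |redJac ρ 7 8 + 158.9564| ≤ 1 / 10 ^ 4 := by
  have h := nearJac_redJac hρ
  have h66 : approxJac 6 6 = 12.7555 := rfl
  have h76 : approxJac 7 6 = 13.244 := rfl
  have h67 : approxJac 6 7 = 0.7083 := rfl
  have h77 : approxJac 7 7 = 18.2077 := rfl
  have h68 : approxJac 6 8 = 58.5214 := rfl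
  have h78 : approxJac 7 8 = -158.9564 := rfl
  have he : jacError = 1 / 10 ^ 4 := rfl
  have g66 := h 6 6
  have g76 := h 7 6
  have g67 := h 6 7
  have g77 := h 7 7
  have g68 := h 6 8
  have g78 := h 7 8
  rw [h66, he] at g66
  rw [h76, he] at g76
  rw [h67, he] at g67
  rw [h77, he] at g77
  rw [h68, he] at g68
  rw [h78, he] at g78
  norm_num at g66 g76 g67 g77 g68 g78 ⊢
  exact ⟨g66, g76, g67, g77, g68, g78⟩

theorem leftCoeff_eq {ρ : Fin 9 → ℝ} (h8 : ρ 8 = 0) :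
    leftCoeff ρ = -redJac ρ 7 6 / redJac ρ 6 6 := by
  rw [leftCoeff, oddAA_eq_redJac h8, oddBA_eq_redJac h8]

theorem leftCoeff_bounds {ρ : Fin 9 → ℝ} (hρ : ρ ∈ parBox) (h8 : ρ 8 = 0) :
    -1.04 ≤ leftCoeff ρ ∧ leftCoeff ρ ≤ -1.03 := by
  obtain ⟨h1, h2, -⟩ := redJac_bounds hρ
  rw [abs_le] at h1 h2
  have h0 : 0 < redJac ρ 6 6 := by norm_num at h1; linarith
  rw [leftCoeff_eq h8, le_div_iff₀ h0, div_le_iff₀ h0]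
  norm_num at h1 h2 ⊢
  constructor <;> linarith

/-- The expression is half of `wᵀ DF_m v`. -/
theorem mixed_pos {ρ : Fin 9 → ℝ} (hρ : ρ ∈ parBox) (h8 : ρ 8 = 0) :
    0 < leftCoeff ρ * redJac ρ 6 7 + redJac ρ 7 7 := by
  obtain ⟨-, -, h1, h2, -⟩ := redJac_bounds hρ
  obtain ⟨h3, h4⟩ := leftCoeff_bounds hρ h8
  rw [abs_le] at h1 h2
  norm_num at h1 h2 h3 h4
  nlinarith

/-- The expression is one twelfth of `wᵀ D³F(v,v,v)`: a factor 6 from the third derivative of `t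
g(t²)`, and 2 because antisymmetric parts count twice in the dot product. -/
theorem third_neg {ρ : Fin 9 → ℝ} (hρ : ρ ∈ parBox) (h8 : ρ 8 = 0) :
    leftCoeff ρ * redJac ρ 6 8 + redJac ρ 7 8 < 0 := by
  obtain ⟨-, -, -, -, h1, h2⟩ := redJac_bounds hρ
  obtain ⟨h3, h4⟩ := leftCoeff_bounds hρ h8
  rw [abs_le] at h1 h2
  norm_num at h1 h2 h3 h4
  nlinarith

/-- A zero of the reduced system with `T = 0`. -/
structure IsBase (ρ : Fin 9 → ℝ) : Prop where
  nhds : parBox ∈ nhds ρ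
  vec : toVec ρ 0 ∈ vecBox
  mass : ρ 7 ∈ massBox
  last : ρ 8 = 0
  zero : redMap ρ = 0

/-- The right kernel vector. -/
noncomputable def rightKer (ρ : Fin 9 → ℝ) : Vec := assemble 0 (ρ 6) 1

/-- The left kernel vector. -/
noncomputable def leftKer (ρ : Fin 9 → ℝ) : Vec := assemble 0 (leftCoeff ρ) 1

namespace IsBase

variable {ρ : Fin 9 → ℝ}

theorem mem (b : IsBase ρ) : ρ ∈ parBox := mem_of_mem_nhds b.nhds

theorem oddAA_pos (b : IsBase ρ) :
    0 < eval (toSplit ρ 0) (oddAA (var 6 ^ 2) (var 6 * var 8) (var 8 ^ 2)) :=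
  lt_of_lt_of_le (by norm_num) (oddAA_ge (abs_toSplit_sub_le b.vec b.mass))

theorem six (b : IsBase ρ) :
    ρ 6 * eval (toSplit ρ 0) (oddAA (var 6 ^ 2) (var 6 * var 8) (var 8 ^ 2))
    + eval (toSplit ρ 0) (oddAB (var 6 ^ 2) (var 8 ^ 2)) = 0 := by
  rw [← redMap_six (by simpa using b.last), b.zero, Pi.zero_apply]

theorem seven (b : IsBase ρ) : ρ 6 * eval (toSplit ρ 0) (oddBA (var 6 ^ 2) (var 8 ^ 2))
    + eval (toSplit ρ 0) (oddBB (var 6 ^ 2) (var 6 * var 8) (var 8 ^ 2)) = 0 := by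
  rw [← redMap_seven (by simpa using b.last), b.zero, Pi.zero_apply]

theorem isZero (b : IsBase ρ) : dziobek (toVec ρ 0) (ρ 7) = 0 := by
  rw [dziobek_toVec (by simpa using b.last), b.zero, assemble_eq_zero]
  simp
  rfl

theorem ker (b : IsBase ρ) : LinearMap.ker (jacobian (toVec ρ 0) (ρ 7)).mulVecLin =
    Submodule.span ℝ {rightKer ρ} := by
  ext n
  rw [LinearMap.mem_ker, Matrix.mulVecLin_apply, jacobian_mulVec, Submodule.mem_span_singleton]
  obtain ⟨e, α, t, rfl⟩ := exists_assemble_eq n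
  rw [fderiv_dziobek_symm b.last, assemble_eq_zero]
  have hA := b.oddAA_pos
  have h6 := b.six
  have h7 := b.seven
  constructor
  · rintro ⟨h1, h2, -⟩
    have he : e = 0 := nearJac_symm_injective (nearJac_redJac b.mem) h1
    have hα : (α - t * ρ 6) * eval (toSplit ρ 0)
        (oddAA (var 6 ^ 2) (var 6 * var 8) (var 8 ^ 2)) = 0 := by
      linear_combination h2 - t * h6
    have hα' : α = t * ρ 6 := sub_eq_zero.1 ((mul_eq_zero.1 hα).resolve_right hA.ne')
    refine ⟨t, ?_⟩
    rw [rightKer, ← assemble_smul, he, hα', smul_zero, mul_one]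
  · rintro ⟨c, hc⟩
    rw [rightKer, ← assemble_smul, smul_zero, mul_one] at hc
    obtain ⟨rfl, rfl, rfl⟩ := assemble_inj.1 hc
    rw [Matrix.mulVec_zero]
    refine ⟨rfl, ?_, ?_⟩
    · linear_combination c * h6
    · linear_combination c * h7

theorem coker (b : IsBase ρ) : LinearMap.ker (jacobian (toVec ρ 0) (ρ 7)).transpose.mulVecLin =
    Submodule.span ℝ {leftKer ρ} := by
  have hA := b.oddAA_pos
  have h6 := b.six
  have h7 := b.seven
  have hω : leftCoeff ρ * eval (toSplit ρ 0) (oddAA (var 6 ^ 2) (var 6 * var 8) (var 8 ^ 2))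
      + eval (toSplit ρ 0) (oddBA (var 6 ^ 2) (var 8 ^ 2)) = 0 := by
    rw [leftCoeff, div_mul_cancel₀ _ hA.ne']
    ring
  have key : ∀ u : Vec, (jacobian (toVec ρ 0) (ρ 7)).transpose *ᵥ u = 0 ↔
      ∀ e α t, u ⬝ᵥ fderiv ℝ (fun z => dziobek z (ρ 7)) (toVec ρ 0) (assemble e α t) = 0 := by
    intro u
    constructor
    · intro h e α t
      rw [← jacobian_mulVec, Matrix.dotProduct_mulVec, ← Matrix.mulVec_transpose, h,
        zero_dotProduct]
    · intro h
      refine dotProduct_eq_zero _ fun n => ?_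
      obtain ⟨e, α, t, rfl⟩ := exists_assemble_eq n
      rw [Matrix.mulVec_transpose, ← Matrix.dotProduct_mulVec, jacobian_mulVec]
      exact h e α t
  ext u
  rw [LinearMap.mem_ker, Matrix.mulVecLin_apply, key, Submodule.mem_span_singleton]
  constructor
  · obtain ⟨e, α, t, rfl⟩ := exists_assemble_eq u
    intro h
    simp only [fderiv_dziobek_symm b.last, assemble_dotProduct] at h
    -- The symmetric part of a left kernel vector annihilates the range of the symmetric block,
    -- which is everything.
    have hsurj : Function.Surjective ((redJac ρ).submatrix symmRow symmCol).mulVec := by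
      rw [Matrix.mulVec_surjective_iff_isUnit, ← Matrix.mulVec_injective_iff_isUnit]
      intro a a' haa
      refine sub_eq_zero.1 (nearJac_symm_injective (nearJac_redJac b.mem) ?_)
      rw [Matrix.mulVec_sub]
      exact sub_eq_zero.2 haa
    have he : e = 0 := by
      ext i
      obtain ⟨a, ha⟩ := hsurj (Pi.single i 1)
      have := h a 0 0
      change ((redJac ρ).submatrix symmRow symmCol) *ᵥ a = _ at ha
      rw [ha] at this
      fin_cases i <;> simpa using this
    have hα : (α - t * leftCoeff ρ) *
        eval (toSplit ρ 0) (oddAA (var 6 ^ 2) (var 6 * var 8) (var 8 ^ 2)) = 0 := by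
      have := h 0 1 0
      rw [he] at this
      simp only [Pi.zero_apply, zero_mul] at this
      linear_combination (1 / 2) * this - t * hω
    refine ⟨t, ?_⟩
    rw [leftKer, ← assemble_smul, he, smul_zero, mul_one,
      sub_eq_zero.1 ((mul_eq_zero.1 hα).resolve_right hA.ne')]
  · rintro ⟨c, rfl⟩ e α t
    rw [leftKer, fderiv_dziobek_symm b.last, smul_dotProduct, assemble_dotProduct, smul_eq_mul]
    simp only [Pi.zero_apply, zero_mul]
    -- The antisymmetric `2 × 2` block has rank one: by `h6` and `h7` its second column is `-β`
    -- times the first, and `(leftCoeff ρ, 1)` annihilates the first by `hω`.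
    linear_combination 2 * c * (α - t * ρ 6) * hω + 2 * c * t * leftCoeff ρ * h6 + 2 * c * t * h7

theorem pitchforkConditions (b : IsBase ρ) :
    PitchforkConditions .g3 (toVec ρ 0) (ρ 7) (rightKer ρ) (leftKer ρ) := by
  have hne : ∀ α, assemble 0 α 1 ≠ 0 := fun α h => one_ne_zero (assemble_eq_zero.1 h).2.2
  have hup : ∀ s i, i ≠ 7 → Function.update ρ 7 s i = ρ i := fun s i hi =>
    Function.update_of_ne hi _ _
  have hvec : ∀ s t, toVec (Function.update ρ 7 s) t = toVec ρ t := fun s t => by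
    simp [toVec]
  -- The straight line in direction `v` keeps `β` and the symmetric unknowns fixed and has `T = s²`;
  -- hence the form `s g(s²)` in `hline`.
  have hcurve : ∀ s, toVec ρ 0 + s • rightKer ρ = toVec (Function.update ρ 8 (s ^ 2)) s := by
    intro s
    ext k
    fin_cases k <;> simp [toVec, rightKer, assemble, sub_eq_add_neg, mul_comm]
  have hline : ∀ s, leftKer ρ ⬝ᵥ dziobek (toVec ρ 0 + s • rightKer ρ) (ρ 7) =
      s * (2 * (leftCoeff ρ * redMap (Function.update ρ 8 (s ^ 2)) 6
        + redMap (Function.update ρ 8 (s ^ 2)) 7)) := by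
    intro s
    have := dziobek_toVec (ρ := Function.update ρ 8 (s ^ 2)) (t := s) (by simp)
    rw [Function.update_of_ne (by decide)] at this
    rw [hcurve, this, leftKer, assemble_dotProduct]
    simp only [Pi.zero_apply]
    ring
  have hder : ∀ f f' : PolyExpr 9, ∀ s, HasDerivAt
      (fun s => 2 * (leftCoeff ρ * eval (Function.update ρ 8 s) f
        + eval (Function.update ρ 8 s) f'))
      (2 * (leftCoeff ρ * eval (Function.update ρ 8 s) (D 8 f)
        + eval (Function.update ρ 8 s) (D 8 f'))) s := fun f f' s =>
    (((hasDerivAt_eval_update f ρ 8 s).const_mul _).fun_add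
      (hasDerivAt_eval_update f' ρ 8 s)).const_mul 2
  refine ⟨hne _, hne _, b.ker, b.coker, ?_, ?_, ?_, ?_, ?_, ?_⟩
  · rw [toVec_eq, Phi_g3_assemble]
    simp
  · rw [rightKer, Phi_g3_assemble, ← neg_one_smul ℝ (assemble 0 (ρ 6) 1), ← assemble_smul]
    simp
  -- At a symmetric configuration the map has no antisymmetric part for any mass, while `w` is
  -- antisymmetric.
  · have h1 : (fun μ => dziobek (toVec ρ 0) μ) = fun μ =>
        assemble (fun i => redMap (Function.update ρ 7 μ) (symmRow i)) 0 0 := by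
      funext μ
      have := dziobek_toVec (ρ := Function.update ρ 7 μ) (t := 0) (by simp [b.last])
      rw [hvec, Function.update_self] at this
      simpa using this
    have h2 := hasDerivAt_assemble (s := ρ 7)
      (fun i => hasDerivAt_eval_update (reduced (symmRow i)) ρ 7 (ρ 7))
      (hasDerivAt_const (ρ 7) (0 : ℝ)) (hasDerivAt_const (ρ 7) (0 : ℝ))
    have h3 : deriv (fun μ => dziobek (toVec ρ 0) μ) (ρ 7) =
        assemble (fun i => eval (Function.update ρ 7 (ρ 7)) (D 7 (reduced (symmRow i)))) 0 0 := by
      rw [h1]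
      exact h2.deriv
    rw [h3, leftKer, assemble_dotProduct]
    simp
  · have h1 : (fun μ => fderiv ℝ (fun z => dziobek z μ) (toVec ρ 0) (rightKer ρ)) = fun μ =>
        assemble 0 (redMap (Function.update ρ 7 μ) 6) (redMap (Function.update ρ 7 μ) 7) := by
      funext μ
      have := fderiv_dziobek_toVec (ρ := Function.update ρ 7 μ) (σ := 0) (t := 0) (t' := 1)
        (by simp [b.last]) rfl (by simp)
      rw [hvec, Function.update_self, hup _ 6 (by decide)] at this
      simp only [Matrix.mulVec_zero, Pi.zero_apply, mul_zero, zero_add, mul_one,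
        one_mul, add_zero] at this
      exact this
    have h2 := hasDerivAt_assemble (s := ρ 7) (e := fun _ => 0) (e' := 0)
      (fun i => hasDerivAt_const (ρ 7) (0 : ℝ))
      (hasDerivAt_eval_update (reduced 6) ρ 7 (ρ 7))
      (hasDerivAt_eval_update (reduced 7) ρ 7 (ρ 7))
    have h3 : deriv (fun μ => fderiv ℝ (fun z => dziobek z μ) (toVec ρ 0) (rightKer ρ)) (ρ 7) =
        assemble 0 (eval (Function.update ρ 7 (ρ 7)) (D 7 (reduced 6)))
          (eval (Function.update ρ 7 (ρ 7)) (D 7 (reduced 7))) := by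
      rw [h1]
      exact h2.deriv
    rw [h3, leftKer, assemble_dotProduct, Function.update_eq_self]
    have := mixed_pos b.mem b.last
    simp only [redJac, Matrix.of_apply] at this
    simp only [Pi.zero_apply, mul_zero, add_zero, zero_add, one_mul]
    linarith
  · rw [show (![rightKer ρ, rightKer ρ] : Fin 2 → Vec) = fun _ => rightKer ρ by
      ext i; fin_cases i <;> rfl, dotProduct_iteratedFDeriv (contDiff_dziobek_left _)]
    simp only [hline]
    have := congrFun (iteratedDeriv_two_mul_comp_sq (hder (reduced 6) (reduced 7))
      (hder (D 8 (reduced 6)) (D 8 (reduced 7)))) 0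
    refine this.trans ?_
    simp
  · rw [show (![rightKer ρ, rightKer ρ, rightKer ρ] : Fin 3 → Vec) = fun _ => rightKer ρ by
      ext i; fin_cases i <;> rfl, dotProduct_iteratedFDeriv (contDiff_dziobek_left _)]
    simp only [hline]
    have := iteratedDeriv_three_mul_comp_sq (hder (reduced 6) (reduced 7))
      (hder (D 8 (reduced 6)) (D 8 (reduced 7)))
      (hder (D 8 (D 8 (reduced 6))) (D 8 (D 8 (reduced 7))))
    refine lt_of_eq_of_lt this ?_
    rw [show Function.update ρ 8 (0 : ℝ) = ρ by rw [← b.last, Function.update_eq_self]]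
    have := third_neg b.mem b.last
    simp only [redJac, Matrix.of_apply] at this
    linarith

end IsBase

end FourBody

/-! ### The two solution branches -/

/-- A polynomial system with invertible Jacobian matrix can be solved along a line of right-hand
sides. -/
theorem PolyExpr.exists_curve {n : ℕ} (f : Fin n → PolyExpr n) (p : Fin n → ℝ)
    (h : ∀ u : Fin n → ℝ, (∀ i, ∑ j, eval p (D j (f i)) * u j = 0) → u = 0) (e : Fin n → ℝ) :
    ∃ γ : ℝ → Fin n → ℝ, γ 0 = p ∧ ContDiffAt ℝ ω γ 0 ∧
      ∀ᶠ s in 𝓝 0, ∀ i, eval (γ s) (f i) = eval p (f i) + s * e i := by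
  set Ψ : (Fin n → ℝ) → Fin n → ℝ := fun ρ i => eval ρ (f i) with hΨd
  have hΨ : ContDiff ℝ ω Ψ := contDiff_pi.2 fun i => contDiff_eval (f i)
  set L := fderiv ℝ Ψ p
  have hL : HasFDerivAt Ψ L p := (hΨ.differentiable (by simp) p).hasFDerivAt
  have hLu : ∀ u i, L u i = ∑ j, eval p (D j (f i)) * u j := by
    intro u i
    have hγ : ∀ j, HasDerivAt (fun s : ℝ => (p + s • u) j) (u j) 0 := fun j => by
      simpa using ((hasDerivAt_id (0 : ℝ)).mul_const (u j)).const_add (p j)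
    have h1 := hasDerivAt_eval (f i) hγ
    have h2 : HasFDerivAt Ψ L (p + (0 : ℝ) • u) := by simpa using hL
    have h3 := hasDerivAt_pi.1 (h2.comp_hasDerivAt 0 (hasDerivAt_pi.2 hγ)) i
    have h4 := h3.unique h1
    simpa using h4
  have hinj : Function.Injective (L : (Fin n → ℝ) →ₗ[ℝ] (Fin n → ℝ)) := by
    rw [← LinearMap.ker_eq_bot, LinearMap.ker_eq_bot']
    intro u hu
    exact h u fun i => by rw [← hLu]; exact congrFun hu i
  set L' := (LinearEquiv.ofInjectiveEndo _ hinj).toContinuousLinearEquiv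
  have hL' : HasFDerivAt Ψ (L' : (Fin n → ℝ) →L[ℝ] (Fin n → ℝ)) p := by
    convert hL using 1
    ext u i
    rfl
  have hω : (ω : WithTop ℕ∞) ≠ 0 := by simp
  set g := hΨ.contDiffAt.localInverse hL' hω
  have hline : ContDiff ℝ ω (fun s : ℝ => Ψ p + s • e) := contDiff_const.add
    (contDiff_id.smul contDiff_const)
  have h0 : Ψ p + (0 : ℝ) • e = Ψ p := by simp
  refine ⟨fun s => g (Ψ p + s • e), ?_, ?_, ?_⟩
  · change g (Ψ p + (0 : ℝ) • e) = p
    rw [h0]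
    exact hΨ.contDiffAt.localInverse_apply_image hL' hω
  · have h1 : ContDiffAt ℝ ω g (Ψ p + (0 : ℝ) • e) := by
      rw [h0]
      exact hΨ.contDiffAt.to_localInverse hL' hω
    exact h1.comp (0 : ℝ) hline.contDiffAt
  · have h1 := (hΨ.contDiffAt.hasStrictFDerivAt' hL' hω).eventually_right_inverse
    have h2 : Filter.Tendsto (fun s : ℝ => Ψ p + s • e) (𝓝 0) (𝓝 (Ψ p)) := by
      have := hline.continuous.tendsto 0
      rwa [h0] at this
    filter_upwards [h2.eventually h1] with s hs i
    have h3 : Ψ (g (Ψ p + s • e)) i = Ψ p i + s * e i := congrFun hs i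
    exact h3

namespace FourBody

open PolyExpr

variable {ρ : Fin 9 → ℝ}

/-- The equation for `T` is adjoined to the reduced system and its right-hand side is varied. The
tangent vector at 0 has `T`-component 1, so its `m`-component is within 3 of 24. -/
theorem IsBase.exists_branch (b : IsBase ρ) :
    ∃ γ : ℝ → Fin 9 → ℝ, γ 0 = ρ ∧ ContDiffAt ℝ ω γ 0 ∧
      (∀ᶠ T in 𝓝 0, redMap (γ T) = 0 ∧ γ T 8 = T) ∧ 0 < deriv (fun T => γ T 7) 0 := by
  have hsum : ∀ u : Fin 9 → ℝ, ∑ j, eval ρ (D j (var 8)) * u j = u 8 := fun u => by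
    rw [Finset.sum_eq_single 8] <;> simp +contextual [D, eq_comm]
  obtain ⟨γ, h0, hγ, he⟩ := exists_curve (Fin.snoc (α := fun _ => PolyExpr 9) reduced (var 8)) ρ
    (fun u hu => by
      have h8 := hu (Fin.last 8)
      rw [Fin.snoc_last, hsum] at h8
      refine nearJac_kernel_eq_zero (nearJac_redJac b.mem) ?_ (Or.inr h8)
      ext i
      have := hu i.castSucc
      rw [Fin.snoc_castSucc] at this
      exact this) (Pi.single 8 1)
  have hev : ∀ᶠ T in 𝓝 0, redMap (γ T) = 0 ∧ γ T 8 = T := by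
    filter_upwards [he] with T hT
    constructor
    · ext i
      have h1 := hT i.castSucc
      rw [Fin.snoc_castSucc] at h1
      refine h1.trans ?_
      have h2 : eval ρ (reduced i) = 0 := congrFun b.zero i
      rw [h2, Pi.single_eq_of_ne (show i.castSucc ≠ (8 : Fin 9) from (Fin.castSucc_lt_last i).ne)]
      simp
    · have h1 := hT (Fin.last 8)
      rw [Fin.snoc_last, eval_var, eval_var, b.last] at h1
      rw [h1]
      simp [show (Fin.last 8 : Fin 9) = 8 from rfl]
  refine ⟨γ, h0, hγ, hev, ?_⟩
  have hd : ∀ i, HasDerivAt (fun T => γ T i) (deriv (fun T => γ T i) 0) 0 := fun i =>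
    (hasDerivAt_pi.1 (hγ.differentiableAt (by simp)).hasDerivAt i).differentiableAt.hasDerivAt
  set u : Fin 9 → ℝ := fun i => deriv (fun T => γ T i) 0 with hu
  have hker : redJac ρ *ᵥ u = 0 := by
    ext i
    have h1 := hasDerivAt_eval (reduced i) hd
    rw [h0] at h1
    have h2 : (fun T => eval (γ T) (reduced i)) =ᶠ[𝓝 0] fun _ => (0 : ℝ) := by
      filter_upwards [hev] with T hT
      exact congrFun hT.1 i
    exact (h1.congr_of_eventuallyEq h2.symm).unique (hasDerivAt_const (0 : ℝ) (0 : ℝ))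
  have h8 : u 8 = 1 := by
    have h2 : (fun T => γ T 8) =ᶠ[𝓝 0] id := by
      filter_upwards [hev] with T hT
      exact hT.2
    rw [hu]
    exact h2.deriv_eq.trans (deriv_id 0)
  have h7 := (nearJac_kernel (nearJac_redJac b.mem) hker).2
  rw [h8] at h7
  norm_num at h7
  have := (abs_le.1 h7).1
  exact (by linarith : 0 < u 7)

/-- The symmetric components of the reduced system, completed by the parameters `β, m, T`. -/
def symmSystem (i : Fin 9) : PolyExpr 9 :=
  if h : i.val < 6 then reduced (symmRow ⟨i, h⟩) else var i

theorem symmSystem_symmCol (i : Fin 6) : symmSystem (symmCol i) = reduced (symmRow i) :=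
  dif_pos i.isLt

theorem symmSystem_of_le {i : Fin 9} (h : 6 ≤ i.val) : symmSystem i = var i :=
  dif_neg (not_lt.2 h)

theorem symmCol_ne (i : Fin 6) {j : Fin 9} (h : 6 ≤ j.val) : symmCol i ≠ j := by
  rintro rfl
  exact absurd i.isLt (not_lt.2 h)

theorem eq_symmExt {u : Fin 9 → ℝ} (h6 : u 6 = 0) (h7 : u 7 = 0) (h8 : u 8 = 0) :
    u = symmExt fun i => u (symmCol i) := by
  ext i
  fin_cases i
  exacts [rfl, rfl, rfl, rfl, rfl, rfl, h6, h7, h8]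

theorem symmExt_zero : symmExt 0 = 0 := by
  ext i
  fin_cases i <;> rfl

/-- Here the mass is the parameter and `β` and `T` are held fixed, so the Jacobian reduces to the
symmetric block. -/
theorem IsBase.exists_symmBranch (b : IsBase ρ) :
    ∃ γ : ℝ → Fin 9 → ℝ, γ 0 = ρ ∧ ContDiffAt ℝ ω γ 0 ∧
      ∀ᶠ s in 𝓝 0, (∀ i, redMap (γ s) (symmRow i) = 0) ∧ γ s 7 = ρ 7 + s ∧ γ s 8 = 0 := by
  have hsum : ∀ (i : Fin 9) (u : Fin 9 → ℝ), ∑ j, eval ρ (D j (var i)) * u j = u i := fun i u => by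
    rw [Finset.sum_eq_single i] <;> simp +contextual [D, eq_comm]
  obtain ⟨γ, h0, hγ, he⟩ := exists_curve symmSystem ρ
    (fun u hu => by
      have hu' : ∀ i : Fin 9, 6 ≤ i.val → u i = 0 := fun i hi => by
        have := hu i
        rwa [symmSystem_of_le hi, hsum] at this
      have hext := eq_symmExt (hu' 6 (by decide)) (hu' 7 (by decide)) (hu' 8 (by decide))
      have hz : (fun i => u (symmCol i)) = 0 := by
        refine nearJac_symm_injective (nearJac_redJac b.mem) ?_
        rw [← mulVec_symmExt, ← hext]
        ext i
        have := hu (symmCol i)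
        rw [symmSystem_symmCol] at this
        exact this
      rw [hext, hz, symmExt_zero]) (Pi.single 7 1)
  refine ⟨γ, h0, hγ, ?_⟩
  filter_upwards [he] with s hs
  refine ⟨fun i => ?_, ?_, ?_⟩
  · have h1 := hs (symmCol i)
    have h2 : eval ρ (reduced (symmRow i)) = 0 := congrFun b.zero _
    rw [symmSystem_symmCol, h2, Pi.single_eq_of_ne (symmCol_ne i (by decide)), mul_zero,
      add_zero] at h1
    exact h1
  · have h1 := hs 7
    rw [symmSystem_of_le (by decide)] at h1
    simpa using h1
  · have h1 := hs 8
    rw [symmSystem_of_le (by decide)] at h1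
    simpa [b.last] using h1

/-- Symmetric solutions near the bifurcation are determined by the mass. -/
theorem toVec_eq_of_symm {σ : Fin 9 → ℝ} (hρ : ρ ∈ parBox) (hσ : σ ∈ parBox) (h7 : ρ 7 = σ 7)
    (h8 : ρ 8 = 0) (h8' : σ 8 = 0) (hz : ∀ i, redMap ρ (symmRow i) = 0)
    (hz' : ∀ i, redMap σ (symmRow i) = 0) : toVec ρ 0 = toVec σ 0 := by
  -- For `T = 0` the configuration and the symmetric equations do not involve `β`; equating it makes
  -- the difference a purely symmetric vector.
  set ρ' := Function.update ρ 6 (σ 6) with hρ'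
  have hmem : ρ' ∈ parBox := by
    refine mem_parBox.2 fun i => ?_
    by_cases hi : i = 6
    · subst hi
      rw [hρ', Function.update_self]
      exact mem_parBox.1 hσ 6
    · rw [hρ', Function.update_of_ne hi]
      exact mem_parBox.1 hρ i
  obtain ⟨J, hJ, e⟩ := exists_nearJac hmem hσ
  have hext : ρ' - σ = symmExt fun i => (ρ' - σ) (symmCol i) :=
    eq_symmExt (by simp [hρ']) (by simp [hρ', h7]) (by simp [hρ', h8, h8'])
  have h0 : (fun i => (ρ' - σ) (symmCol i)) = 0 := by
    refine nearJac_symm_injective hJ ?_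
    rw [← mulVec_symmExt, ← hext, ← e]
    ext i
    rw [Pi.sub_apply, hρ', redMap_update_symmRow h8, hz, hz', sub_zero]
    rfl
  have h1 : ρ' = σ := by
    rw [← sub_eq_zero, hext, h0, symmExt_zero]
  rw [← toVec_update_zero ρ (σ 6), ← hρ', h1]

end FourBody

/-! ### Planar realization with body 3 inside -/

/-- A point with positive barycentric coordinates is in the interior of the triangle with vertices
`(0, 0)`, `(c, 0)` and `(p, h)`. -/
theorem mem_interior_triangle {c p h X Y : ℝ} (hc : 0 < c) (hh : 0 < h) (hY : 0 < Y)
    (h1 : Y * p < X * h) (h0 : Y * (c - p) < (c - X) * h) {s : Set (EuclideanSpace ℝ (Fin 2))}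
    (s0 : !₂[0, 0] ∈ s) (s1 : !₂[c, 0] ∈ s) (s2 : !₂[p, h] ∈ s) :
    !₂[X, Y] ∈ interior (convexHull ℝ s) := by
  rw [mem_interior]
  refine ⟨{z | 0 < z 1 ∧ z 1 * p < z 0 * h ∧ z 1 * (c - p) < (c - z 0) * h}, ?_, ?_, ?_⟩
  · rintro z ⟨z1, z2, z3⟩
    have hz : z = ∑ i : Fin 3, (![((c - z 0) * h - z 1 * (c - p)) / (c * h),
        (z 0 * h - z 1 * p) / (c * h), z 1 / h] : Fin 3 → ℝ) i •
        (![!₂[0, 0], !₂[c, 0], !₂[p, h]] : Fin 3 → EuclideanSpace ℝ (Fin 2)) i := by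
      ext j
      fin_cases j
      · simp [Fin.sum_univ_three]
        field_simp
        ring
      · simp [Fin.sum_univ_three]
        field_simp
    rw [hz]
    refine (convex_convexHull ℝ s).sum_mem (fun i _ => ?_) ?_ (fun i _ => ?_)
    · have hch := mul_pos hc hh
      fin_cases i
      · exact div_nonneg (by linarith) hch.le
      · exact div_nonneg (by linarith) hch.le
      · exact div_nonneg z1.le hh.le
    · simp [Fin.sum_univ_three]
      field_simp
      ring
    · refine subset_convexHull ℝ s ?_
      fin_cases i
      exacts [s0, s1, s2]
  · have c0 : Continuous fun z : EuclideanSpace ℝ (Fin 2) => z 0 := by fun_prop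
    have c1 : Continuous fun z : EuclideanSpace ℝ (Fin 2) => z 1 := by fun_prop
    refine (isOpen_lt continuous_const c1).and ((isOpen_lt ?_ ?_).and (isOpen_lt ?_ ?_)) <;>
      fun_prop
  · exact ⟨by simpa using hY, by simpa using h1, by simpa using h0⟩

theorem EuclideanSpace.dist_fin_two (a b a' b' : ℝ) :
    dist (!₂[a, b] : EuclideanSpace ℝ (Fin 2)) !₂[a', b'] = √((a - a') ^ 2 + (b - b') ^ 2) := by
  simp [EuclideanSpace.dist_eq, Real.dist_eq, sq_abs]

theorem sq_bounds {x l u : ℝ} (hl : 0 ≤ l) (h1 : l < x) (h2 : x < u) :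
    l ^ 2 < x ^ 2 ∧ x ^ 2 < u ^ 2 :=
  ⟨pow_lt_pow_left₀ h1 hl two_ne_zero, pow_lt_pow_left₀ h2 (hl.trans h1.le) two_ne_zero⟩

namespace FourBody

/-- Bodies 1 and 2 are put at `(0, 0)` and `(c, 0)`, bodies 3 and 4 above that axis at `(p, y)` and
`(p', y')`. Five distances hold by construction; the sixth follows from the vanishing Cayley-Menger
determinant. Crude bounds of the coordinates then place body 3 inside. -/
theorem bodyInside_of_mem_vecBox {x : Vec} (hx : x ∈ vecBox) (h : cmDet x = 0) :
    BodyInside 2 x := by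
  have hb := fun k => abs_lt.1 (mem_vecBox.1 hx k)
  have h2 := hb 2
  have h3 := hb 3
  have h4 := hb 4
  have h5 := hb 5
  have h6 := hb 6
  have h7 := hb 7
  simp only [toVec, Matrix.cons_val, mul_zero, sub_zero, add_zero,
    show boxCenter 2 = 1.0134749516061 from rfl, show boxCenter 3 = 0.5762129952718 from rfl,
    show boxCenter 4 = 0.9951533019209 from rfl, show boxCenter 5 = 0.5821772578754 from rfl,
    show configRadius = 1 / 10 ^ 12 from rfl] at h2 h3 h4 h5 h6 h7
  norm_num at h2 h3 h4 h5 h6 h7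
  rw [cmDet_eq] at h
  obtain ⟨l2, u2⟩ : 1.0134 < x 2 ∧ x 2 < 1.0135 := by norm_num; constructor <;> linarith
  obtain ⟨l3, u3⟩ : 0.5762 < x 3 ∧ x 3 < 0.5763 := by norm_num; constructor <;> linarith
  obtain ⟨l4, u4⟩ : 0.9951 < x 4 ∧ x 4 < 0.9952 := by norm_num; constructor <;> linarith
  obtain ⟨l5, u5⟩ : 0.5762 < x 5 ∧ x 5 < 0.5763 := by norm_num; constructor <;> linarith
  obtain ⟨l6, u6⟩ : 0.9951 < x 6 ∧ x 6 < 0.9952 := by norm_num; constructor <;> linarith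
  obtain ⟨l7, u7⟩ : 0.5821 < x 7 ∧ x 7 < 0.5822 := by norm_num; constructor <;> linarith
  clear h2 h3 h4 h5 h6 h7 hb
  have s2 := sq_bounds (by norm_num) l2 u2
  have s3 := sq_bounds (by norm_num) l3 u3
  have s4 := sq_bounds (by norm_num) l4 u4
  have s5 := sq_bounds (by norm_num) l5 u5
  have s6 := sq_bounds (by norm_num) l6 u6
  have s7 := sq_bounds (by norm_num) l7 u7
  norm_num at l2 u2 l3 u3 l4 u4 l5 u5 l6 u6 l7 u7 s2 s3 s4 s5 s6 s7
  have hc : 0 < x 2 := by linarith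
  have hc' : x 2 ≠ 0 := hc.ne'
  set p := (x 2 ^ 2 + x 3 ^ 2 - x 5 ^ 2) / (2 * x 2) with hp
  set p' := (x 2 ^ 2 + x 4 ^ 2 - x 6 ^ 2) / (2 * x 2) with hp'
  have ep : 2 * x 2 * p = x 2 ^ 2 + x 3 ^ 2 - x 5 ^ 2 := by rw [hp]; field_simp
  have ep' : 2 * x 2 * p' = x 2 ^ 2 + x 4 ^ 2 - x 6 ^ 2 := by rw [hp']; field_simp
  have hcc : 0 < 2 * x 2 := by linarith
  obtain ⟨lp, up⟩ : 0.506 < p ∧ p < 0.508 := by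
    rw [hp, lt_div_iff₀ hcc, div_lt_iff₀ hcc]
    norm_num
    constructor <;> linarith
  obtain ⟨lp', up'⟩ : 0.506 < p' ∧ p' < 0.508 := by
    rw [hp', lt_div_iff₀ hcc, div_lt_iff₀ hcc]
    norm_num
    constructor <;> linarith
  have sp := sq_bounds (by norm_num) lp up
  have sp' := sq_bounds (by norm_num) lp' up'
  have spp : p * p' < 0.508 * 0.508 := mul_lt_mul'' up up' (by linarith) (by linarith)
  norm_num at lp up lp' up' sp sp' spp
  have hq : 0 < x 3 ^ 2 - p ^ 2 := by linarith
  have hq' : 0 < x 4 ^ 2 - p' ^ 2 := by linarith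
  set y := √(x 3 ^ 2 - p ^ 2) with hy
  set y' := √(x 4 ^ 2 - p' ^ 2) with hy'
  have ey : y ^ 2 = x 3 ^ 2 - p ^ 2 := Real.sq_sqrt hq.le
  have ey' : y' ^ 2 = x 4 ^ 2 - p' ^ 2 := Real.sq_sqrt hq'.le
  have y0 : 0 < y := Real.sqrt_pos.2 hq
  have y0' : 0 < y' := Real.sqrt_pos.2 hq'
  have by1 : y < 0.3 := lt_of_pow_lt_pow_left₀ 2 (by norm_num) (by rw [ey]; norm_num; linarith)
  have by2 : 0.8 < y' := lt_of_pow_lt_pow_left₀ 2 y0'.le (by rw [ey']; norm_num; linarith)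
  have hN : 0 < x 3 ^ 2 + x 4 ^ 2 - x 7 ^ 2 - 2 * p * p' := by linarith
  -- The determinant gives this identity only up to sign; positivity of the left side selects the
  -- realization with bodies 3 and 4 on the same side of the axis.
  have hNy : x 3 ^ 2 + x 4 ^ 2 - x 7 ^ 2 - 2 * p * p' = 2 * y * y' := by
    have e : (x 3 ^ 2 + x 4 ^ 2 - x 7 ^ 2 - 2 * p * p') ^ 2 = (2 * y * y') ^ 2 := by
      rw [mul_pow, mul_pow, ey, ey', hp, hp']
      field_simp
      linear_combination (-2 * x 2 ^ 2) * h
    exact (pow_left_inj₀ hN.le (by positivity) two_ne_zero).1 e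
  refine ⟨![!₂[0, 0], !₂[x 2, 0], !₂[p, y], !₂[p', y']], ?_, ?_, ?_, ?_, ?_, ?_, ?_⟩
  · change dist (!₂[0, 0] : EuclideanSpace ℝ (Fin 2)) !₂[x 2, 0] = x 2
    rw [EuclideanSpace.dist_fin_two, Real.sqrt_eq_iff_eq_sq (by positivity) hc.le]
    ring
  · change dist (!₂[0, 0] : EuclideanSpace ℝ (Fin 2)) !₂[p, y] = x 3
    rw [EuclideanSpace.dist_fin_two, Real.sqrt_eq_iff_eq_sq (by positivity) (by linarith)]
    linear_combination ey
  · change dist (!₂[0, 0] : EuclideanSpace ℝ (Fin 2)) !₂[p', y'] = x 4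
    rw [EuclideanSpace.dist_fin_two, Real.sqrt_eq_iff_eq_sq (by positivity) (by linarith)]
    linear_combination ey'
  · change dist (!₂[x 2, 0] : EuclideanSpace ℝ (Fin 2)) !₂[p, y] = x 5
    rw [EuclideanSpace.dist_fin_two, Real.sqrt_eq_iff_eq_sq (by positivity) (by linarith)]
    linear_combination ey - ep
  · change dist (!₂[x 2, 0] : EuclideanSpace ℝ (Fin 2)) !₂[p', y'] = x 6
    rw [EuclideanSpace.dist_fin_two, Real.sqrt_eq_iff_eq_sq (by positivity) (by linarith)]
    linear_combination ey' - ep'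
  · change dist (!₂[p, y] : EuclideanSpace ℝ (Fin 2)) !₂[p', y'] = x 7
    rw [EuclideanSpace.dist_fin_two, Real.sqrt_eq_iff_eq_sq (by positivity) (by linarith)]
    linear_combination ey + ey' + hNy
  · refine mem_interior_triangle hc y0' y0 ?_ ?_ ⟨0, by decide, rfl⟩ ⟨1, by decide, rfl⟩
      ⟨3, by decide, rfl⟩
    · have a1 : y * p' < 0.3 * 0.508 := mul_lt_mul'' by1 (by norm_num; linarith) y0.le (by linarith)
      have a2 : 0.506 * 0.8 < p * y' := mul_lt_mul'' (by norm_num; linarith) by2 (by norm_num)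
        (by norm_num)
      norm_num at a1 a2
      linarith
    · have a1 : y * (x 2 - p') < 0.3 * 0.508 :=
        mul_lt_mul'' by1 (by norm_num; linarith) y0.le (by linarith)
      have a2 : 0.505 * 0.8 < (x 2 - p) * y' := mul_lt_mul'' (by norm_num; linarith) by2
        (by norm_num) (by norm_num)
      norm_num at a1 a2
      linarith

/-! ### The supercritical pitchfork -/

open PolyExpr

variable {ρ : Fin 9 → ℝ}

theorem isOpen_vecBox : IsOpen vecBox := Metric.isOpen_ball

theorem coords_ne_of_mem_vecBox {x : Vec} (hx : x ∈ vecBox) : x 2 ≠ x 3 ∧ x 2 ≠ x 5 := by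
  have hb := fun k => abs_lt.1 (mem_vecBox.1 hx k)
  have h2 := hb 2
  have h3 := hb 3
  have h5 := hb 5
  simp only [toVec, Matrix.cons_val, mul_zero, sub_zero, add_zero,
    show boxCenter 2 = 1.0134749516061 from rfl, show boxCenter 3 = 0.5762129952718 from rfl,
    show configRadius = 1 / 10 ^ 12 from rfl] at h2 h3 h5
  norm_num at h2 h3 h5
  constructor
  · intro h
    linarith
  · intro h
    linarith

/-- Every group element other than `e` and `g3` replaces `r₁₂` by `r₁₃` or `r₂₃`, and these differ
from it throughout the box. -/
theorem isotropy_of_mem_vecBox {x : Vec} (hx : x ∈ vecBox) :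
    isotropy x = if Phi .g3 x = x then {D6.e, D6.g3} else {D6.e} := by
  obtain ⟨h3, h5⟩ := coords_ne_of_mem_vecBox hx
  have n1 : Phi .g1 x ≠ x := fun h => h3 (congrFun h 2).symm
  have n2 : Phi .g2 x ≠ x := fun h => h5 (congrFun h 2).symm
  have n4 : Phi .g4 x ≠ x := fun h => h3 (congrFun h 2).symm
  have n5 : Phi .g5 x ≠ x := fun h => h5 (congrFun h 2).symm
  have ne : Phi .e x = x := rfl
  split_ifs with h <;> ext g <;> cases g <;> simp [isotropy, *]

theorem Phi_g3_toVec (σ : Fin 9 → ℝ) (t : ℝ) : Phi .g3 (toVec σ t) = toVec σ (-t) := by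
  rw [toVec_eq, Phi_g3_assemble, toVec_eq, mul_neg]

theorem toVec_six_sub_four (σ : Fin 9 → ℝ) (t : ℝ) :
    (toVec σ t 6 - toVec σ t 4) / 2 = t := by
  simp [toVec]

theorem contDiffAt_toVec {n : WithTop ℕ∞} {γ : ℝ → Fin 9 → ℝ} {t : ℝ → ℝ} {s : ℝ}
    (hγ : ContDiffAt ℝ n γ s) (ht : ContDiffAt ℝ n t s) :
    ContDiffAt ℝ n (fun s => toVec (γ s) (t s)) s := by
  have h := contDiffAt_pi.1 hγ
  exact contDiff_assemble (e := fun s i => γ s (symmCol i)) (fun i => h _) ((h 6).mul ht) ht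

theorem IsBase.symmetryBreakingPitchfork (b : IsBase ρ) :
    SymmetryBreakingPitchfork .g3 2 (toVec ρ 0) (ρ 7) (rightKer ρ) := by
  obtain ⟨γ, γ0, γs, γe, γd⟩ := b.exists_branch
  obtain ⟨η, η0, ηs, ηe⟩ := b.exists_symmBranch
  set f : ℝ → ℝ := fun T => γ T 7 with hf
  have f0 : f 0 = ρ 7 := by rw [hf]; exact congrFun γ0 7
  have fs : ContDiffAt ℝ ω f 0 := contDiffAt_pi.1 γs 7
  -- a neighbourhood of `T = 0` on which the branch is well behaved
  have hT : ∀ᶠ T in 𝓝 (0 : ℝ), ContDiffAt ℝ ω γ T ∧ redMap (γ T) = 0 ∧ γ T 8 = T ∧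
      γ T ∈ parBox ∧ 0 < deriv f T := by
    -- Analyticity at a point passes to a neighbourhood, unlike `ContDiffAt` of order `∞`.
    have h1 := γs.eventually (by simp)
    have h2 : ∀ᶠ T in 𝓝 (0 : ℝ), γ T ∈ parBox :=
      γs.continuousAt.eventually (by rw [γ0]; exact b.nhds)
    have h3 : ∀ᶠ T in 𝓝 (0 : ℝ), 0 < deriv f T :=
      fs.analyticAt.deriv.continuousAt.eventually (lt_mem_nhds γd)
    filter_upwards [h1, γe, h2, h3] with T a1 a2 a3 a4
    exact ⟨a1, a2.1, a2.2, a3, a4⟩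
  obtain ⟨r, hr, hTr⟩ := Metric.eventually_nhds_iff.1 hT
  have hsq : Continuous fun t : ℝ => t ^ 2 := by fun_prop
  have ht : ∀ᶠ t in 𝓝 (0 : ℝ), t ^ 2 < r ∧ toVec (γ (t ^ 2)) t ∈ vecBox := by
    have h0 : Filter.Tendsto (fun t : ℝ => t ^ 2) (𝓝 0) (𝓝 0) := by simpa using hsq.tendsto 0
    refine Filter.Eventually.and (h0.eventually_lt_const hr) ?_
    have h1 : ContDiffAt ℝ ω (fun t : ℝ => γ (t ^ 2)) 0 :=
      ContDiffAt.comp (0 : ℝ) (g := γ) (by simpa using γs) (contDiff_id.pow 2).contDiffAt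
    refine (contDiffAt_toVec h1 contDiffAt_id).continuousAt.eventually ?_
    exact isOpen_vecBox.mem_nhds (by simpa [γ0] using b.vec)
  obtain ⟨δ, hδ, htδ⟩ := Metric.eventually_nhds_iff.1 ht
  have good : ∀ t, |t| < δ → ContDiffAt ℝ ω γ (t ^ 2) ∧ redMap (γ (t ^ 2)) = 0 ∧
      γ (t ^ 2) 8 = t ^ 2 ∧ γ (t ^ 2) ∈ parBox ∧ 0 < deriv f (t ^ 2) := by
    intro t h
    have h1 := (htδ (y := t) (by simpa using h)).1
    exact hTr (by rw [Real.dist_eq, sub_zero, abs_of_nonneg (sq_nonneg t)]; exact h1)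
  have hvec : ∀ t, |t| < δ → toVec (γ (t ^ 2)) t ∈ vecBox := fun t h =>
    (htδ (y := t) (by simpa using h)).2
  have hIco : ∀ t, |t| < δ → t ^ 2 ∈ Set.Ico 0 (δ ^ 2) := fun t h =>
    ⟨sq_nonneg t, by rw [← sq_abs]; exact pow_lt_pow_left₀ h (abs_nonneg t) two_ne_zero⟩
  have hgood : ∀ T ∈ Set.Ico 0 (δ ^ 2), ContDiffAt ℝ ω γ T ∧ 0 < deriv f T := by
    rintro T ⟨hT0, hT1⟩
    have h1 : |√T| < δ := by
      rw [abs_of_nonneg (Real.sqrt_nonneg T), Real.sqrt_lt' hδ]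
      exact hT1
    have h2 := good _ h1
    rw [Real.sq_sqrt hT0] at h2
    exact ⟨h2.1, h2.2.2.2.2⟩
  have hcont : ContinuousOn f (Set.Ico 0 (δ ^ 2)) := fun T h =>
    (contDiffAt_pi.1 (hgood T h).1 7).continuousAt.continuousWithinAt
  have hmono : StrictMonoOn f (Set.Ico 0 (δ ^ 2)) :=
    strictMonoOn_of_deriv_pos (convex_Ico _ _) hcont fun T h => (hgood T (interior_subset h)).2
  have hpos : ∀ t, t ≠ 0 → |t| < δ → ρ 7 < f (t ^ 2) := fun t h0 h => by
    rw [← f0]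
    exact hmono ⟨le_rfl, by positivity⟩ (hIco t h) (by positivity)
  -- a neighbourhood of the bifurcation value on which the symmetric branch is well behaved
  have hs : ∀ᶠ s in 𝓝 (0 : ℝ), ContDiffAt ℝ ω η s ∧ ((∀ i, redMap (η s) (symmRow i) = 0) ∧
      η s 7 = ρ 7 + s ∧ η s 8 = 0) ∧ η s ∈ parBox ∧ toVec (η s) 0 ∈ vecBox ∧
      ρ 7 + s ∈ massBox := by
    have h1 := ηs.eventually (by simp)
    have h2 : ∀ᶠ s in 𝓝 (0 : ℝ), η s ∈ parBox :=
      ηs.continuousAt.eventually (by rw [η0]; exact b.nhds)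
    have h3 : ∀ᶠ s in 𝓝 (0 : ℝ), toVec (η s) 0 ∈ vecBox :=
      (contDiffAt_toVec ηs contDiffAt_const).continuousAt.eventually
        (isOpen_vecBox.mem_nhds (by simpa [η0] using b.vec))
    have h4 : ∀ᶠ s in 𝓝 (0 : ℝ), ρ 7 + s ∈ massBox :=
      (continuous_const.add continuous_id).continuousAt.eventually
        (Metric.isOpen_ball.mem_nhds (by
          change ρ 7 + 0 ∈ massBox
          rw [add_zero]
          exact b.mass))
    filter_upwards [h1, ηe, h2, h3, h4] with s a1 a2 a3 a4 a5
    exact ⟨a1, a2, a3, a4, a5⟩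
  obtain ⟨ε₀, hε₀, hsε⟩ := Metric.eventually_nhds_iff.1 hs
  have hhalf : (δ / 2) ^ 2 ∈ Set.Ico 0 (δ ^ 2) := hIco _ (by rw [abs_of_pos] <;> linarith)
  have hfhalf : ρ 7 < f ((δ / 2) ^ 2) := hpos _ (by linarith) (by rw [abs_of_pos] <;> linarith)
  -- The second bound lets the intermediate value theorem reach every mass in the upper half of the
  -- interval already with `T ≤ (δ / 2) ^ 2`.
  set ε := min ε₀ (f ((δ / 2) ^ 2) - ρ 7) with hε
  set s : ℝ → Vec := fun μ => toVec (η (μ - ρ 7)) 0 with hsd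
  set y : ℝ → Vec := fun t => toVec (γ (t ^ 2)) t with hyd
  set τ : ℝ → ℝ := fun t => f (t ^ 2) with hτd
  -- The second condition confines every asymmetric zero to the range of `t` on which the branch `γ
  -- (t ^ 2)` is controlled.
  set W : Set Vec := vecBox ∩ {x | |(x 6 - x 4) / 2| < δ} with hW
  have sgood : ∀ μ ∈ Set.Ioo (ρ 7 - ε) (ρ 7 + ε), ContDiffAt ℝ ω η (μ - ρ 7) ∧
      (∀ i, redMap (η (μ - ρ 7)) (symmRow i) = 0) ∧ η (μ - ρ 7) 7 = μ ∧ η (μ - ρ 7) 8 = 0 ∧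
      η (μ - ρ 7) ∈ parBox ∧ s μ ∈ vecBox ∧ μ ∈ massBox := by
    rintro μ ⟨h1, h2⟩
    have h3 : ε ≤ ε₀ := min_le_left _ _
    obtain ⟨a1, ⟨a2, a3, a4⟩, a5, a6, a7⟩ := hsε (y := μ - ρ 7)
      (by rw [Real.dist_eq, sub_zero, abs_lt]; constructor <;> linarith)
    rw [add_sub_cancel] at a3 a7
    exact ⟨a1, a2, a3, a4, a5, a6, a7⟩
  have ysub : ∀ t, (y t 6 - y t 4) / 2 = t := fun t => toVec_six_sub_four _ _
  have ssub : ∀ μ, (s μ 6 - s μ 4) / 2 = 0 := fun μ => toVec_six_sub_four _ _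
  have sW : ∀ μ ∈ Set.Ioo (ρ 7 - ε) (ρ 7 + ε), s μ ∈ W := fun μ hμ =>
    ⟨(sgood μ hμ).2.2.2.2.2.1, by
      change |(s μ 6 - s μ 4) / 2| < δ
      rw [ssub, abs_zero]
      exact hδ⟩
  have szero : ∀ μ ∈ Set.Ioo (ρ 7 - ε) (ρ 7 + ε), dziobek (s μ) μ = 0 := by
    intro μ hμ
    obtain ⟨-, a2, a3, a4, -⟩ := sgood μ hμ
    have h := dziobek_toVec (ρ := η (μ - ρ 7)) (t := 0) (by simpa using a4)
    rw [a3] at h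
    rw [hsd]
    refine h.trans (assemble_eq_zero.2 ⟨funext a2, by simp, by simp⟩)
  have yW : ∀ t, |t| < δ → y t ∈ W := fun t h => ⟨hvec t h, by
    change |(y t 6 - y t 4) / 2| < δ
    rwa [ysub]⟩
  have yzero : ∀ t, |t| < δ → dziobek (y t) (τ t) = 0 := by
    intro t h
    obtain ⟨-, a1, a2, -⟩ := good t h
    refine (dziobek_toVec a2).trans (assemble_eq_zero.2 ?_)
    rw [a1]
    exact ⟨rfl, by simp, by simp⟩
  -- The completeness statement. Asymmetric zeros lie on the branch because the reduced system has
  -- at most one zero in the box for each `T`; symmetric ones are determined by the mass.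
  have solutions : ∀ μ ∈ Set.Ioo (ρ 7 - ε) (ρ 7 + ε), ∀ x ∈ W, dziobek x μ = 0 →
      x = s μ ∨ ∃ t, t ≠ 0 ∧ |t| < δ ∧ x = y t ∧ τ t = μ := by
    rintro μ hμ x ⟨hx1, hx2⟩ hx
    obtain ⟨-, a2, a3, a4, a5, -, a7⟩ := sgood μ hμ
    obtain ⟨σ, hσ, h7, h8, hxσ, hz, hz'⟩ := exists_param hx1 a7 hx
    set t := (x 6 - x 4) / 2
    by_cases h0 : t = 0
    · left
      rw [h0] at hxσ h8
      rw [hxσ]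
      exact toVec_eq_of_symm hσ a5 (h7.trans a3.symm) (by simpa using h8) a4 hz a2
    · right
      obtain ⟨-, b1, b2, b3, -⟩ := good t hx2
      have hσγ : σ = γ (t ^ 2) := redMap_injOn hσ b3 (h8.trans b2.symm) ((hz' h0).trans b1.symm)
      refine ⟨t, h0, hx2, ?_, ?_⟩
      · rw [hxσ, hσγ]
      · rw [hτd, hf, ← h7, hσγ]
  have hε0 : 0 < ε := lt_min hε₀ (by linarith)
  have habs : ∀ t ∈ Set.Ioo (-δ) δ, |t| < δ := fun t h => abs_lt.2 h
  have ycd : ∀ t, |t| < δ → ContDiffAt ℝ ω (fun t : ℝ => γ (t ^ 2)) t := fun t h =>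
    ContDiffAt.comp t (g := γ) (good t h).1 (contDiff_id.pow 2).contDiffAt
  have hδ0 : |(0 : ℝ)| < δ := by simpa using hδ
  have hsqd : ∀ t : ℝ, HasDerivAt (fun t : ℝ => t ^ 2) (2 * t) t := fun t => by
    simpa using hasDerivAt_pow 2 t
  -- `γ (t ^ 2)` is stationary at 0, so only the explicit factor `t` in `toVec` contributes to the
  -- tangent, which is therefore `(0; β, 1) = v`.
  have γd0 : ∀ i, HasDerivAt (fun t : ℝ => γ (t ^ 2) i) 0 0 := fun i => by
    have h1 : HasDerivAt (fun T => γ T i) (deriv (fun T => γ T i) 0) ((0 : ℝ) ^ 2) := by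
      have := (contDiffAt_pi.1 γs i).differentiableAt (by simp)
      simpa using this.hasDerivAt
    exact (HasDerivAt.comp (h := fun t : ℝ => t ^ 2) (0 : ℝ) h1 (hsqd 0)).congr_deriv (by simp)
  have yd : HasDerivAt y (rightKer ρ) 0 := by
    refine hasDerivAt_assemble (e := fun t i => γ (t ^ 2) (symmCol i)) (e' := 0)
      (fun i => γd0 _) ?_ (hasDerivAt_id 0)
    have := (γd0 6).fun_mul (hasDerivAt_id (0 : ℝ))
    simpa [γ0] using this
  have τd : ∀ t, |t| < δ → HasDerivAt τ (deriv f (t ^ 2) * (2 * t)) t := fun t h =>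
    HasDerivAt.comp (h₂ := f) (h := fun t : ℝ => t ^ 2) t
      ((contDiffAt_pi.1 (good t h).1 7).differentiableAt (by simp)).hasDerivAt (hsqd t)
  have τd2 : HasDerivAt (deriv τ) (2 * deriv f 0) 0 := by
    have h1 : deriv τ =ᶠ[𝓝 0] fun t => deriv f (t ^ 2) * (2 * t) := by
      filter_upwards [Metric.ball_mem_nhds (0 : ℝ) hδ] with t h
      exact (τd t (by simpa using h)).deriv
    have h2 : HasDerivAt (fun t : ℝ => deriv f (t ^ 2)) (deriv (deriv f) 0 * (2 * 0)) 0 := by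
      have h3 : HasDerivAt (deriv f) (deriv (deriv f) 0) ((0 : ℝ) ^ 2) := by
        simpa using fs.analyticAt.deriv.differentiableAt.hasDerivAt
      exact HasDerivAt.comp (h := fun t : ℝ => t ^ 2) (0 : ℝ) h3 (hsqd 0)
    have h3 := h2.fun_mul ((hasDerivAt_id (0 : ℝ)).const_mul 2)
    refine (h3.congr_of_eventuallyEq h1).congr_deriv ?_
    simp [mul_comm]
  refine ⟨W, ε, δ, s, y, τ, ⟨?_, ?_, hε0, hδ, ?_, ?_, ?_, ?_, ?_, ?_, ?_, ?_, ?_, ?_, ?_, ?_⟩,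
    yd.deriv, ?_, ?_, ?_, ?_⟩
  · refine isOpen_vecBox.inter (isOpen_lt ?_ continuous_const)
    fun_prop
  · have := yW 0 hδ0
    simpa [hyd, γ0] using this
  · intro μ hμ
    refine ContDiffAt.contDiffWithinAt (ContDiffAt.of_le (n := ω) ?_ le_top)
    exact contDiffAt_toVec (ContDiffAt.comp μ (g := η) (sgood μ hμ).1
      (contDiff_id.sub contDiff_const).contDiffAt) contDiffAt_const
  · simp [hsd, η0]
  · intro t h
    refine ContDiffAt.contDiffWithinAt (ContDiffAt.of_le (n := ω) ?_ le_top)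
    exact contDiffAt_toVec (ycd t (habs t h)) contDiffAt_id
  · intro t h
    exact ContDiffAt.contDiffWithinAt (ContDiffAt.of_le (n := ω)
      (contDiffAt_pi.1 (ycd t (habs t h)) 7) le_top)
  · simp [hyd, γ0]
  · simp [hτd, f0]
  · rw [yd.deriv]
    exact b.pitchforkConditions.v_ne
  · simpa using (τd 0 hδ0).deriv
  · rw [τd2.deriv]
    exact mul_pos two_pos γd
  · exact fun t h => ⟨yW t (habs t h), yzero t (habs t h)⟩
  · intro μ hμ
    have hμ' : μ ∈ Set.Ioo (ρ 7 - ε) (ρ 7 + ε) := ⟨hμ.1, by linarith [hμ.2]⟩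
    ext x
    constructor
    · rintro ⟨hx1, hx2⟩
      rcases solutions μ hμ' x hx1 hx2 with h | ⟨t, h0, ht1, -, h2⟩
      · exact h
      · have := hpos t h0 ht1
        exact absurd hμ.2 (by rw [← h2]; exact not_le.2 this)
    · rintro rfl
      exact ⟨sW μ hμ', szero μ hμ'⟩
  · intro μ hμ
    have hμ' : μ ∈ Set.Ioo (ρ 7 - ε) (ρ 7 + ε) := ⟨by linarith [hμ.1], hμ.2⟩
    obtain ⟨T, ⟨hT0, hT1⟩, hTμ⟩ := intermediate_value_Icc (sq_nonneg (δ / 2))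
      (hcont.mono fun T h => ⟨h.1, lt_of_le_of_lt h.2 hhalf.2⟩)
      (show μ ∈ Set.Icc (f 0) (f ((δ / 2) ^ 2)) from ⟨by rw [f0]; exact hμ.1.le, by
        have := hμ.2
        have h2 : ε ≤ f ((δ / 2) ^ 2) - ρ 7 := min_le_right _ _
        linarith⟩)
    have hTpos : 0 < T := by
      refine lt_of_le_of_ne hT0 fun h => ?_
      rw [← h, f0] at hTμ
      exact hμ.1.ne hTμ
    have hr0 : 0 < √T := Real.sqrt_pos.2 hTpos
    have hTlt : T < δ ^ 2 := lt_of_le_of_lt hT1 hhalf.2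
    have hr1 : √T < δ := by rwa [Real.sqrt_lt' hδ]
    have hrsq : √T ^ 2 = T := Real.sq_sqrt hT0
    have hrsq' : (-√T) ^ 2 = T := by rw [neg_sq, hrsq]
    have a1 : |√T| < δ := by rwa [abs_of_pos hr0]
    have a2 : |-√T| < δ := by rwa [abs_neg]
    have hτ1 : τ (-√T) = μ := by rw [hτd]; change f ((-√T) ^ 2) = μ; rw [hrsq', hTμ]
    have hτ2 : τ √T = μ := by rw [hτd]; change f (√T ^ 2) = μ; rw [hrsq, hTμ]
    have hset : {x ∈ W | dziobek x μ = 0} = {s μ, y (-√T), y √T} := by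
      ext x
      constructor
      · rintro ⟨hx1, hx2⟩
        rcases solutions μ hμ' x hx1 hx2 with h | ⟨t, h0, ht1, h1, h2⟩
        · exact Or.inl h
        · right
          -- The mass is strictly increasing in `T`, so it determines `t` up to sign.
          have h3 : t ^ 2 = T := hmono.injOn (hIco t ht1) ⟨hT0, hTlt⟩ (h2.trans hTμ.symm)
          have h4 : t = √T ∨ t = -√T := sq_eq_sq_iff_eq_or_eq_neg.1 (h3.trans hrsq.symm)
          rcases h4 with h4 | h4
          · exact Or.inr (by rw [h1, h4]; rfl)
          · exact Or.inl (by rw [h1, h4])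
      · rintro (rfl | rfl | rfl)
        · exact ⟨sW μ hμ', szero μ hμ'⟩
        · exact ⟨yW _ a2, by rw [← hτ1]; exact yzero _ a2⟩
        · exact ⟨yW _ a1, by rw [← hτ2]; exact yzero _ a1⟩
    refine ⟨-√T, ⟨by linarith, by linarith⟩, √T, ⟨hr0, hr1⟩, hτ1, hτ2, hset, ?_⟩
    rw [Set.ncard_eq_three]
    refine ⟨_, _, _, ?_, ?_, ?_, hset⟩
    · intro h
      have := ssub μ
      rw [h, ysub] at this
      linarith
    · intro h
      have := ssub μ
      rw [h, ysub] at this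
      linarith
    · intro h
      have := ysub (-√T)
      rw [h, ysub] at this
      linarith
  · intro μ hμ
    rw [isotropy_of_mem_vecBox (sW μ hμ).1, if_pos]
    rw [hsd]
    simp only [Phi_g3_toVec, neg_zero]
  · intro t h h0
    rw [isotropy_of_mem_vecBox (hvec t (habs t h)), if_neg]
    intro h1
    rw [Phi_g3_toVec] at h1
    have h2 := toVec_six_sub_four (γ (t ^ 2)) (-t)
    rw [h1, toVec_six_sub_four] at h2
    exact h0 (by linarith)
  · intro t h
    refine ⟨?_, ?_⟩
    · rw [hyd]
      change Phi .g3 (toVec (γ (t ^ 2)) t) = toVec (γ ((-t) ^ 2)) (-t)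
      rw [Phi_g3_toVec, neg_sq]
    · rw [hτd]
      change f ((-t) ^ 2) = f (t ^ 2)
      rw [neg_sq]
  · intro μ hμ z hz h
    exact bodyInside_of_mem_vecBox hz.1 (by
      have := congrFun h 1
      simpa [dziobek] using this)

end FourBody

/-! ### Transport by relabelling the bodies -/

theorem Matrix.ker_submatrix_eq_span {n : Type*} [Fintype n] {A : Matrix n n ℝ} {v : n → ℝ}
    (σ : Equiv.Perm n) (h : LinearMap.ker A.mulVecLin = Submodule.span ℝ {v}) :
    LinearMap.ker (A.submatrix σ σ).mulVecLin = Submodule.span ℝ {v ∘ σ} := by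
  ext u
  have h1 : A *ᵥ (u ∘ σ.symm) = 0 ↔ ∃ a : ℝ, a • v = u ∘ σ.symm := by
    rw [← Submodule.mem_span_singleton, ← h]
    rfl
  rw [LinearMap.mem_ker, Matrix.mulVecLin_apply, Matrix.submatrix_mulVec_equiv,
    Submodule.mem_span_singleton]
  constructor
  · intro h2
    obtain ⟨a, ha⟩ := h1.1 (funext fun i => by simpa using congrFun h2 (σ.symm i))
    exact ⟨a, funext fun i => by simpa using congrFun ha (σ i)⟩
  · rintro ⟨a, rfl⟩
    rw [h1.2 ⟨a, funext fun i => by simp⟩]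
    rfl

namespace FourBody

/-- Relabelling of the unknowns by a permutation. -/
noncomputable def relabel (σ : Equiv.Perm (Fin 8)) : Vec ≃L[ℝ] Vec :=
  (LinearEquiv.funCongrLeft ℝ ℝ σ).toContinuousLinearEquiv

theorem relabel_apply (σ : Equiv.Perm (Fin 8)) (z : Vec) : relabel σ z = z ∘ σ := rfl

/-- Permutation matrices are orthogonal, so left kernel vectors are transported in the same way as
right ones. -/
theorem relabel_dotProduct (σ : Equiv.Perm (Fin 8)) (w z : Vec) :
    relabel σ w ⬝ᵥ relabel σ z = w ⬝ᵥ z := by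
  exact Equiv.sum_comp σ fun i => w i * z i

theorem partialDeriv_relabel {σ : Equiv.Perm (Fin 8)} {f : Vec → ℝ}
    (h : ∀ z, f (relabel σ z) = f z) (k : Fin 8) (z : Vec) :
    partialDeriv f k (relabel σ z) = partialDeriv f (σ k) z := by
  have h1 : ∀ t, Function.update (relabel σ z) k t = relabel σ (Function.update z (σ k) t) := by
    intro t
    ext i
    by_cases hi : i = k
    · subst hi
      simp [relabel_apply]
    · simp [relabel_apply, hi]
  simp only [partialDeriv, h1, h]
  rfl

/-- Equivariance needs only that the permutation fixes the two multipliers and preserves the mass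
products and the Cayley-Menger determinant. -/
theorem dziobek_relabel {σ : Equiv.Perm (Fin 8)} (h0 : σ 0 = 0) (h1 : σ 1 = 1)
    (h2 : ∀ i, 2 ≤ i ↔ 2 ≤ σ i) (hp : ∀ m i, pairMass m (σ i) = pairMass m i)
    (hS : ∀ z, cmDet (relabel σ z) = cmDet z) (z : Vec) (m : ℝ) :
    dziobek (relabel σ z) m = relabel σ (dziobek z m) := by
  ext k
  have e0 : σ k = 0 ↔ k = 0 := by rw [← h0, σ.injective.eq_iff, h0]
  have e1 : σ k = 1 ↔ k = 1 := by rw [← h1, σ.injective.eq_iff, h1]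
  have hs : ∑ l ∈ Finset.Ici (2 : Fin 8), pairMass m l * relabel σ z l ^ 2 =
      ∑ l ∈ Finset.Ici (2 : Fin 8), pairMass m l * z l ^ 2 := by
    refine Finset.sum_equiv σ (fun i => by simpa using h2 i) fun i _ => ?_
    rw [hp]
    rfl
  have r0 : relabel σ z 0 = z 0 := congrArg z h0
  have r1 : relabel σ z 1 = z 1 := congrArg z h1
  rw [relabel_apply σ (dziobek z m), Function.comp_apply]
  simp only [dziobek, hs, hS, partialDeriv_relabel hS, e0, e1, hp, r0, r1]
  rfl

/-- The permutation `σ` of the unknowns is a symmetry of the Dziobek equations that conjugates the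
action of the dihedral group by `c`, and takes configurations with the body `k` inside to
configurations with the body `k'` inside. -/
structure IsSymmetry (σ : Equiv.Perm (Fin 8)) (c : D6 ≃ D6) (k k' : Fin 4) : Prop where
  equivariant : ∀ z m, dziobek (relabel σ z) m = relabel σ (dziobek z m)
  conj : ∀ g z, Phi (c g) (relabel σ z) = relabel σ (Phi g z)
  conj_e : c .e = .e
  bodyInside : ∀ z, BodyInside k z → BodyInside k' (relabel σ z)

namespace IsSymmetry

variable {σ : Equiv.Perm (Fin 8)} {c : D6 ≃ D6} {k k' : Fin 4} {x v w : Vec} {m : ℝ} {g : D6}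

theorem fderiv (hσ : IsSymmetry σ c k k') (x : Vec) (m : ℝ) (u : Vec) :
    fderiv ℝ (fun z => dziobek z m) (relabel σ x) (relabel σ u) =
      relabel σ (fderiv ℝ (fun z => dziobek z m) x u) := by
  have h : (fun z => dziobek z m) ∘ relabel σ = relabel σ ∘ fun z => dziobek z m :=
    funext fun z => hσ.equivariant z m
  have h1 := congrArg (fun f => _root_.fderiv ℝ f x u) h
  simp only [(relabel σ).comp_fderiv] at h1
  rw [fderiv_comp x (differentiable_dziobek_left m _) (relabel σ).differentiableAt,
    (relabel σ).fderiv] at h1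
  exact h1

theorem jacobian (hσ : IsSymmetry σ c k k') (x : Vec) (m : ℝ) :
    jacobian (relabel σ x) m = (FourBody.jacobian x m).submatrix σ σ := by
  refine Matrix.mulVec_injective (funext fun u => ?_)
  obtain ⟨u, rfl⟩ := (relabel σ).surjective u
  rw [jacobian_mulVec, hσ.fderiv, ← jacobian_mulVec, Matrix.submatrix_mulVec_equiv, relabel_apply,
    relabel_apply]
  congr 2
  funext i
  simp

theorem deriv_relabel (σ : Equiv.Perm (Fin 8)) (f : ℝ → Vec) (s : ℝ) :
    deriv (fun t => relabel σ (f t)) s = relabel σ (deriv f s) := by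
  exact congrArg (fun L : ℝ →L[ℝ] Vec => L 1) ((relabel σ).comp_fderiv (f := f) (x := s))

theorem iteratedFDeriv (hσ : IsSymmetry σ c k k') (n : ℕ) (x v w : Vec) (m : ℝ) :
    relabel σ w ⬝ᵥ iteratedFDeriv ℝ n (fun z => dziobek z m) (relabel σ x) (fun _ => relabel σ v) =
      w ⬝ᵥ _root_.iteratedFDeriv ℝ n (fun z => dziobek z m) x (fun _ => v) := by
  rw [dotProduct_iteratedFDeriv (contDiff_dziobek_left m),
    dotProduct_iteratedFDeriv (contDiff_dziobek_left m)]
  congr 1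
  funext t
  rw [← map_smul, ← map_add, hσ.equivariant, relabel_dotProduct]

theorem pitchforkConditions (hσ : IsSymmetry σ c k k') (h : PitchforkConditions g x m v w) :
    PitchforkConditions (c g) (relabel σ x) m (relabel σ v) (relabel σ w) where
  v_ne := by simpa using h.v_ne
  w_ne := by simpa using h.w_ne
  ker := by
    rw [hσ.jacobian]
    exact Matrix.ker_submatrix_eq_span σ h.ker
  coker := by
    rw [hσ.jacobian, Matrix.transpose_submatrix]
    exact Matrix.ker_submatrix_eq_span σ h.coker
  fix := by rw [hσ.conj, h.fix]
  anti := by rw [hσ.conj, h.anti, map_neg]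
  first := by
    simp only [hσ.equivariant]
    rw [deriv_relabel, relabel_dotProduct, h.first]
  mixed := by
    simp only [hσ.fderiv]
    rw [deriv_relabel, relabel_dotProduct]
    exact h.mixed
  second := by
    have h1 : ∀ u : Vec, ![u, u] = fun _ => u := fun u => by ext i; fin_cases i <;> rfl
    have := h.second
    rw [h1] at this ⊢
    rw [hσ.iteratedFDeriv, this]
  third := by
    have h1 : ∀ u : Vec, ![u, u, u] = fun _ => u := fun u => by ext i; fin_cases i <;> rfl
    have := h.third
    rw [h1] at this ⊢
    rwa [hσ.iteratedFDeriv]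

theorem isotropy (hσ : IsSymmetry σ c k k') (x : Vec) :
    isotropy (relabel σ x) = c '' FourBody.isotropy x := by
  ext a
  obtain ⟨a, rfl⟩ := c.surjective a
  rw [c.injective.mem_set_image]
  change Phi _ _ = _ ↔ Phi _ _ = _
  rw [hσ.conj, (relabel σ).injective.eq_iff]

theorem zeros (hσ : IsSymmetry σ c k k') (W : Set Vec) (μ : ℝ) :
    {z ∈ relabel σ '' W | dziobek z μ = 0} = relabel σ '' {z ∈ W | dziobek z μ = 0} := by
  ext z
  obtain ⟨z, rfl⟩ := (relabel σ).surjective z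
  simp [(relabel σ).injective.mem_set_image, hσ.equivariant]

/-- The neighbourhood and both branches are replaced by their images; the mass function `τ` and the
constants `ε`, `δ` stay the same. -/
theorem symmetryBreakingPitchfork (hσ : IsSymmetry σ c k k')
    (h : SymmetryBreakingPitchfork g k x m v) :
    SymmetryBreakingPitchfork (c g) k' (relabel σ x) m (relabel σ v) := by
  obtain ⟨W, ε, δ, s, y, τ, h, hv, hs, hy, hR, hb⟩ := h
  refine ⟨relabel σ '' W, ε, δ, fun μ => relabel σ (s μ), fun t => relabel σ (y t), τ, ?_, ?_, ?_,
    ?_, ?_, ?_⟩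
  · exact {
      isOpen := (relabel σ).toHomeomorph.isOpenMap _ h.isOpen
      mem := Set.mem_image_of_mem _ h.mem
      ε_pos := h.ε_pos
      δ_pos := h.δ_pos
      s_smooth := (relabel σ).contDiff.comp_contDiffOn h.s_smooth
      s_base := by rw [h.s_base]
      y_smooth := (relabel σ).contDiff.comp_contDiffOn h.y_smooth
      τ_smooth := h.τ_smooth
      y_base := by rw [h.y_base]
      τ_base := h.τ_base
      y_tangent := by
        rw [deriv_relabel]
        simpa using h.y_tangent
      τ_tangent := h.τ_tangent
      τ_bend := h.τ_bend
      y_zero := fun t ht => ⟨Set.mem_image_of_mem _ (h.y_zero t ht).1, by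
        rw [hσ.equivariant, (h.y_zero t ht).2, map_zero]⟩
      below := fun μ hμ => by rw [hσ.zeros, h.below μ hμ, Set.image_singleton]
      above := fun μ hμ => by
        obtain ⟨t₁, ht₁, t₂, ht₂, h1, h2, h3, h4⟩ := h.above μ hμ
        refine ⟨t₁, ht₁, t₂, ht₂, h1, h2, ?_, ?_⟩
        · rw [hσ.zeros, h3, Set.image_insert_eq, Set.image_insert_eq, Set.image_singleton]
        · rw [hσ.zeros, Set.ncard_image_of_injective _ (relabel σ).injective, h4] }
  · rw [deriv_relabel, hv]
  · intro μ hμ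
    rw [hσ.isotropy, hs μ hμ, Set.image_pair, hσ.conj_e]
  · intro t ht h0
    rw [hσ.isotropy, hy t ht h0, Set.image_singleton, hσ.conj_e]
  · intro t ht
    exact ⟨by rw [hσ.conj, (hR t ht).1], (hR t ht).2⟩
  · rintro μ hμ _ ⟨z, hz, rfl⟩ h0
    rw [hσ.equivariant, map_eq_zero_iff _ (relabel σ).injective] at h0
    exact hσ.bodyInside z (hb μ hμ z hz h0)

end IsSymmetry

/-- The permutation of the unknowns by which the transposition of the bodies 2 and 3 acts. -/
def unknownPerm₁ : Equiv.Perm (Fin 8) := Equiv.swap 2 3 * Equiv.swap 6 7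

/-- The permutation of the unknowns by which the transposition of the bodies 1 and 3 acts. -/
def unknownPerm₂ : Equiv.Perm (Fin 8) := Equiv.swap 2 5 * Equiv.swap 4 7

theorem relabel_unknownPerm₁ (z : Vec) : relabel unknownPerm₁ z = Phi .g1 z := by
  ext i
  fin_cases i <;> rfl

theorem relabel_unknownPerm₂ (z : Vec) : relabel unknownPerm₂ z = Phi .g2 z := by
  ext i
  fin_cases i <;> rfl

/-- Conjugation by `g1`. -/
def conj₁ : D6 → D6
  | .e => .e | .g1 => .g1 | .g2 => .g3 | .g3 => .g2 | .g4 => .g5 | .g5 => .g4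

/-- Conjugation by `g2`. -/
def conj₂ : D6 → D6
  | .e => .e | .g1 => .g3 | .g2 => .g2 | .g3 => .g1 | .g4 => .g5 | .g5 => .g4

theorem conj₁_involutive : Function.Involutive conj₁ := by rintro ⟨⟩ <;> rfl

theorem conj₂_involutive : Function.Involutive conj₂ := by rintro ⟨⟩ <;> rfl

theorem image_swap_compl {α : Type*} (q : Fin 4 → α) (i j : Fin 4) :
    (fun l => q (Equiv.swap i j l)) '' {j}ᶜ = q '' {i}ᶜ := by
  rw [show (fun l => q (Equiv.swap i j l)) = q ∘ Equiv.swap i j from rfl, Set.image_comp,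
    Set.image_compl_eq (Equiv.bijective _), Set.image_singleton, Equiv.swap_apply_right]

theorem cmDet_unknownPerm₁ (z : Vec) : cmDet (relabel unknownPerm₁ z) = cmDet z := by
  rw [relabel_unknownPerm₁, cmDet_eq, cmDet_eq]
  simp only [Phi, Matrix.cons_val]
  ring

theorem pairMass_unknownPerm₁ (m : ℝ) (i : Fin 8) :
    pairMass m (unknownPerm₁ i) = pairMass m i := by
  have h : relabel unknownPerm₁ (pairMass m) = pairMass m := by
    rw [relabel_unknownPerm₁]
    simp [Phi, pairMass]
  exact congrFun h i

/-- Bodies are numbered from 0 in `Fin 4`: exchanging bodies 2 and 3 moves the inner position from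
index 2 to index 1 and conjugates `g3` into `g2`. -/
theorem isSymmetry₁ : IsSymmetry unknownPerm₁ (conj₁_involutive.toPerm conj₁) 2 1 where
  equivariant := dziobek_relabel rfl rfl (by decide) pairMass_unknownPerm₁ cmDet_unknownPerm₁
  conj g z := by
    rw [relabel_unknownPerm₁, relabel_unknownPerm₁, Function.Involutive.coe_toPerm]
    cases g <;> simp [Phi, conj₁]
  conj_e := rfl
  bodyInside z := by
    rintro ⟨q, h1, h2, h3, h4, h5, h6, h7⟩
    rw [relabel_unknownPerm₁]
    refine ⟨fun l => q (Equiv.swap 2 1 l), ?_⟩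
    rw [image_swap_compl]
    simp only [show Equiv.swap (2 : Fin 4) 1 0 = 0 by decide, Equiv.swap_apply_left,
      Equiv.swap_apply_right, show Equiv.swap (2 : Fin 4) 1 3 = 3 by decide, Phi, Matrix.cons_val]
    exact ⟨h2, h1, h3, by rw [dist_comm, h4], h6, h5, h7⟩

theorem cmDet_unknownPerm₂ (z : Vec) : cmDet (relabel unknownPerm₂ z) = cmDet z := by
  rw [relabel_unknownPerm₂, cmDet_eq, cmDet_eq]
  simp only [Phi, Matrix.cons_val]
  ring

theorem pairMass_unknownPerm₂ (m : ℝ) (i : Fin 8) :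
    pairMass m (unknownPerm₂ i) = pairMass m i := by
  have h : relabel unknownPerm₂ (pairMass m) = pairMass m := by
    rw [relabel_unknownPerm₂]
    simp [Phi, pairMass]
  exact congrFun h i

theorem isSymmetry₂ : IsSymmetry unknownPerm₂ (conj₂_involutive.toPerm conj₂) 2 0 where
  equivariant := dziobek_relabel rfl rfl (by decide) pairMass_unknownPerm₂ cmDet_unknownPerm₂
  conj g z := by
    rw [relabel_unknownPerm₂, relabel_unknownPerm₂, Function.Involutive.coe_toPerm]
    cases g <;> simp [Phi, conj₂]
  conj_e := rfl
  bodyInside z := by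
    rintro ⟨q, h1, h2, h3, h4, h5, h6, h7⟩
    rw [relabel_unknownPerm₂]
    refine ⟨fun l => q (Equiv.swap 2 0 l), ?_⟩
    rw [image_swap_compl]
    simp only [show Equiv.swap (2 : Fin 4) 0 1 = 1 by decide, Equiv.swap_apply_left,
      Equiv.swap_apply_right, show Equiv.swap (2 : Fin 4) 0 3 = 3 by decide, Phi, Matrix.cons_val]
    exact ⟨by rw [dist_comm, h4], by rw [dist_comm, h2], h6, by rw [dist_comm, h1], h5, h3, h7⟩

/-! ### The printed box and the main theorem -/

theorem abs_sub_boxCenter_lt {ρ : Fin 9 → ℝ} (h : ∀ i, |ρ i - approxZero i| ≤ 1 / 10 ^ 26)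
    (i : Fin 9) : |ρ i - boxCenter i| < configRadius := by
  have h1 : |(approxZero i : ℝ) - boxCenter i| ≤ 1 / 10 ^ 13 := by
    have := (Rat.cast_le (K := ℝ)).2 (abs_approxZero_sub_boxCenter_le i)
    push_cast at this
    exact this
  refine (abs_sub_le _ (approxZero i : ℝ) _).trans_lt ((add_le_add (h i) h1).trans_lt ?_)
  norm_num [configRadius]

theorem isBase_of_abs_sub_le {ρ : Fin 9 → ℝ} (h : ∀ i, |ρ i - approxZero i| ≤ 1 / 10 ^ 26)
    (h8 : ρ 8 = 0) (hz : redMap ρ = 0) : IsBase ρ where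
  nhds := by
    refine Metric.closedBall_mem_nhds_of_mem ?_
    rw [Metric.mem_ball, dist_pi_lt_iff boxRadius_pos]
    exact fun i => (abs_sub_boxCenter_lt h i).trans (by norm_num [configRadius, boxRadius])
  vec := by
    have h1 := abs_sub_boxCenter_lt h
    refine mem_vecBox.2 fun k => ?_
    fin_cases k <;> simp only [toVec, mul_zero, sub_zero, add_zero] <;> exact h1 _
  mass := abs_sub_boxCenter_lt h 7
  last := h8
  zero := hz

theorem abs_sub_le_of_abs_sub_approxZero_le {x c e : ℝ} {i : Fin 9}
    (h : |x - approxZero i| ≤ 1 / 10 ^ 26) {z : ℚ} (hz : approxZero i = z)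
    (h1 : |(z : ℝ) - c| + 1 / 10 ^ 26 ≤ e) : |x - c| ≤ e := by
  rw [hz] at h
  linarith [abs_sub_le x (z : ℝ) c]

theorem mem_xBox {ρ : Fin 9 → ℝ} (h : ∀ i, |ρ i - approxZero i| ≤ 1 / 10 ^ 26) :
    toVec ρ 0 ∈ xBox := by
  simp only [xBox, Set.mem_ofPred_eq, toVec, Matrix.cons_val, mul_zero, sub_zero, add_zero]
  refine ⟨abs_sub_le_of_abs_sub_approxZero_le (h 0) rfl ?_,
    abs_sub_le_of_abs_sub_approxZero_le (h 1) rfl ?_,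
    abs_sub_le_of_abs_sub_approxZero_le (h 2) rfl ?_,
    abs_sub_le_of_abs_sub_approxZero_le (h 3) rfl ?_,
    abs_sub_le_of_abs_sub_approxZero_le (h 4) rfl ?_,
    abs_sub_le_of_abs_sub_approxZero_le (h 3) rfl ?_,
    abs_sub_le_of_abs_sub_approxZero_le (h 4) rfl ?_,
    abs_sub_le_of_abs_sub_approxZero_le (h 5) rfl ?_⟩ <;>
  · simp only [approxZero, Matrix.cons_val]
    norm_num [abs_le]

theorem mem_mBox {ρ : Fin 9 → ℝ} (h : ∀ i, |ρ i - approxZero i| ≤ 1 / 10 ^ 26) :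
    ρ 7 ∈ mBox := by
  refine abs_sub_le_of_abs_sub_approxZero_le (h 7) rfl ?_
  simp only [approxZero, Matrix.cons_val]
  norm_num [abs_le]

theorem abs_sub_lt_configRadius {x c e b : ℝ} (h : |x - c| ≤ e)
    (h1 : |c - b| + e < configRadius) : |x - b| < configRadius :=
  (abs_sub_le x c b).trans_lt (by linarith)

theorem xBox_subset_vecBox : xBox ⊆ vecBox := by
  rintro x ⟨h0, h1, h2, h3, h4, h5, h6, h7⟩
  refine mem_vecBox.2 fun k => ?_
  fin_cases k <;> [refine abs_sub_lt_configRadius h0 ?_; refine abs_sub_lt_configRadius h1 ?_;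
    refine abs_sub_lt_configRadius h2 ?_; refine abs_sub_lt_configRadius h3 ?_;
    refine abs_sub_lt_configRadius h4 ?_; refine abs_sub_lt_configRadius h5 ?_;
    refine abs_sub_lt_configRadius h6 ?_; refine abs_sub_lt_configRadius h7 ?_] <;>
  · simp only [toVec, boxCenter, configRadius, Matrix.cons_val, Fin.reduceFinMk]
    norm_num [abs_lt]

theorem mBox_subset_massBox : mBox ⊆ massBox := fun _ h =>
  abs_sub_lt_configRadius h (by
    simp only [boxCenter, configRadius, Matrix.cons_val]
    norm_num [abs_lt])

theorem PitchforkConditions.det_eq_zero {g : D6} {x v w : Vec} {m : ℝ}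
    (h : PitchforkConditions g x m v w) : (jacobian x m).det = 0 := by
  refine Matrix.exists_mulVec_eq_zero_iff.1 ⟨v, h.v_ne, ?_⟩
  have h1 : v ∈ LinearMap.ker (jacobian x m).mulVecLin := by
    rw [h.ker]
    exact Submodule.mem_span_singleton_self v
  exact h1

end FourBody

theorem mainTheorem3 :
    ∃ (x : FourBody.Vec) (m : ℝ) (v w : FourBody.Vec),
      (x ∈ FourBody.xBox ∧ m ∈ FourBody.mBox ∧ FourBody.IsSingularSolution x m) ∧
      (∀ (x' : FourBody.Vec) (m' : ℝ), x' ∈ FourBody.xBox → m' ∈ FourBody.mBox →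
        FourBody.IsSingularSolution x' m' → x' = x ∧ m' = m) ∧
      v 6 = 1 ∧ w 6 = 1 ∧
      (FourBody.PitchforkConditions .g3 x m v w ∧
        FourBody.SymmetryBreakingPitchfork .g3 2 x m v) ∧
      (FourBody.PitchforkConditions .g2 (FourBody.Phi .g1 x) m
          (FourBody.Phi .g1 v) (FourBody.Phi .g1 w) ∧
        FourBody.SymmetryBreakingPitchfork .g2 1 (FourBody.Phi .g1 x) m (FourBody.Phi .g1 v)) ∧
      (FourBody.PitchforkConditions .g1 (FourBody.Phi .g2 x) m
          (FourBody.Phi .g2 v) (FourBody.Phi .g2 w) ∧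
        FourBody.SymmetryBreakingPitchfork .g1 0 (FourBody.Phi .g2 x) m (FourBody.Phi .g2 v)) := by
  open FourBody in
  obtain ⟨ρ, hρ, h8, hz⟩ := exists_redMap_eq_zero
  have b := isBase_of_abs_sub_le hρ h8 hz
  have hc := b.pitchforkConditions
  have hp := b.symmetryBreakingPitchfork
  refine ⟨toVec ρ 0, ρ 7, rightKer ρ, leftKer ρ,
    ⟨mem_xBox hρ, mem_mBox hρ, b.isZero, hc.det_eq_zero⟩, ?_, by simp [rightKer, assemble],
    by simp [leftKer, assemble], ⟨hc, hp⟩, ?_, ?_⟩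
  -- Any singular solution in the printed box yields a zero of the reduced system with `T = 0`, and
  -- that zero is unique in `parBox`.
  · intro x' m' hx hm h
    obtain ⟨σ, hσ, h7, h8', rfl, hz'⟩ :=
      IsSingularSolution.exists_param (xBox_subset_vecBox hx) (mBox_subset_massBox hm) h
    have e : σ = ρ := redMap_injOn hσ b.mem (h8'.trans h8.symm) (hz'.trans hz.symm)
    subst e
    exact ⟨rfl, h7.symm⟩
  · have h1 := isSymmetry₁.pitchforkConditions hc
    have h2 := isSymmetry₁.symmetryBreakingPitchfork hp
    simp only [relabel_unknownPerm₁] at h1 h2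
    exact ⟨h1, h2⟩
  · have h1 := isSymmetry₂.pitchforkConditions hc
    have h2 := isSymmetry₂.symmetryBreakingPitchfork hp
    simp only [relabel_unknownPerm₂] at h1 h2
    exact ⟨h1, h2⟩
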